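/- Let $q\in\mathbb C$ with $0<|q|<1$, and let $\mathcal C=\mathbb Q[\hbar]$ act on $\mathbb C$ by letting $\hbar$ act as multiplication by $1-q$. Let $\mathcal C\langle A\rangle$ be the free $\mathcal C$-algebra on $A=\{\hbar b\}\cup\{g_k=ba^k\mid k\ge1\}$ (inside $\mathcal C\langle a,b\rangle$). With $[m]=(1-q^m)/(1-q)$, put $F_q(m;\hbar b)=1-q$, $F_q(m;g_k)=q^{km}/[m]^k$. Put $\widehat{\mathfrak H^0}=\mathcal C+\sum_{k\ge1}\mathcal C\langle A\rangle g_k$ and let $Z_q:\widehat{\mathfrak H^0}\to\mathbb C$ be the $\mathcal C$-linear map with $$Z_q(u_1\cdots u_r)=\sum_{0<m_1<\cdots<m_r}\ \prod_{i=1}^rF_q(m_i;u_i)\qquad(u_1,\dots,u_r\in A,\ Z_q(1)=1).$$ Let $\mathfrak n_0$ be the $\mathcal C$-span of the monomials $(\hbar b)^{\alpha_1}g_{\beta_1+1}\cdots(\hbar b)^{\alpha_r}g_{\beta_r+1}$ ($r\ge 1$, $\alpha_i,\beta_i\ge 0$) with $\alpha_s,\beta_t\ge1$ for some $s\le t$,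 and put $\mathfrak n=\mathfrak n_0+\hbar\,\widehat{\mathfrak H^0}$, $\mathfrak H^0=\mathcal C+\sum_{k\ge2}\mathcal C\langle A\rangle g_k+\mathfrak n$, $\mathcal Z_q=Z_q(\mathfrak H^0)$, $\mathcal N_q=Z_q(\mathfrak n)$; let $\mathcal P_q$ be the ideal of the ring $\mathcal Z_q$ generated by the values $Z_q(g_{2k})$, $k\ge1$. An index is a finite tuple $\mathbf k=(k_1,\dots,k_r)$ of positive integers; $\mathrm{dep}(\mathbf k)=r$; it is admissible if it is empty or $k_r\ge2$. Write $g_{\mathbf k}=g_{k_1}\cdots g_{k_r}$. The $q$-analogue of the symmetric multiple zeta value, $\zeta_q^{\mathcal S}(\mathbf k)\in\mathcal Z_q/(\mathcal N_q+\mathcal P_q)$, is the class of $Z_q(w_\hbar^{\mathcal S,*}(g_{\mathbf k}))$, where $w_\hbar^{\mathcal S,*}$ is the $\mathcal C$-linear map $$w_\hbar^{\mathcal S,*}(u_1\cdots u_r)=\sum_{i=0}^r u_1\cdots u_i *_\hbar \psi^*(u_{i+1}\cdots u_r)\qquad(u_1,\dots,u_r\in A).$$ Here $\psi^*$ is the $\mathcal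 C$-algebra anti-involution with $\psi^*(\hbar b)=\hbar b$, $\psi^*(g_k)=(-1)^kg_k$, and $*_\hbar$ is the $\mathcal C$-bilinear product with $w*_\hbar1=1*_\hbar w=w$ and $$wu*_\hbar w'v=(w*_\hbar w'v)u+(wu*_\hbar w')v+(w*_\hbar w')(u\circ_\hbar v)\qquad(u,v\in A),$$ where $\circ_\hbar$ is symmetric with $\hbar b\circ_\hbar\hbar b=\hbar\cdot\hbar b$, $\hbar b\circ_\hbar g_k=\hbar g_k$, $g_k\circ_\hbar g_l=g_{k+l}$. (The element $w_\hbar^{\mathcal S,*}(g_{\mathbf k})$ lies in $\mathfrak H^0$.) For a non-empty index $\mathbf k$ put $z_{\mathbf k}=yx^{k_1-1}\cdots yx^{k_r-1}$ and write $z_{\mathbf k}=yw$; the Hoffman dual $\mathbf k^\vee$ is the index with $z_{\mathbf k^\vee}=y\tau(w)$, where $\tau$ is the automorphism of $\mathbb Q\langle x,y\rangle$ exchanging $x$ and $y$. **Theorem (Ohno-type relation).** Let $\mathbf k$ be a non-empty admissible index, $r=\mathrm{dep}(\mathbf k)$ and $s=\mathrm{dep}(\mathbf k^\vee)$. Then for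 every integer $m\ge1$, $$\sum_{\substack{\mathbf e\in(\mathbb Z_{\ge0})^r\\ e_1+\cdots+e_r=m}}\zeta_q^{\mathcal S}(\mathbf k+\mathbf e)=\sum_{\substack{\mathbf e\in(\mathbb Z_{\ge0})^s\\ e_1+\cdots+e_s=m}}\zeta_q^{\mathcal S}\bigl((\mathbf k^\vee+\mathbf e)^\vee\bigr)\qquad\text{in }\ \mathcal Z_q/(\mathcal N_q+\mathcal P_q).$$ -/

import Mathlib

namespace QSMZV

open Polynomial Filter

noncomputable section

/-! ### Indices -/

/-- A (possibly empty) index: a tuple of positive integers. -/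
abbrev Index := List ℕ+

/-- An index is admissible if it is empty or its last entry is at least two. -/
def Admissible (k : Index) : Prop := ∀ a ∈ k.getLast?, 2 ≤ a

/-- The index `k + e = (k₁ + e₁, …, k_r + e_r)` for a tuple `e` of non-negative integers. -/
def addTuple (k : Index) (e : Fin k.length → ℕ) : Index :=
  List.ofFn fun i => (⟨(k.get i : ℕ) + e i, Nat.add_pos_left (k.get i).pos _⟩ : ℕ+)

/-- The two variables `x` and `y` of the non-commutative polynomial ring `ℚ⟨x, y⟩`. -/
inductive XY
  | x
  | y

/-- The automorphism `τ` on letters: it exchanges `x` and `y`. -/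
def XY.swap : XY → XY
  | .x => .y
  | .y => .x

/-- The monomial `z_k = z_{k₁} ⋯ z_{k_r}`, where `z_k = y x^{k-1}`, as a word in `x` and `y`. -/
def zWord (k : Index) : List XY :=
  k.flatMap fun a => XY.y :: List.replicate ((a : ℕ) - 1) XY.x

/-- `readIndex a w` is the index `l` with `z_l = y x^{a-1} w`. -/
def readIndex : ℕ+ → List XY → Index
  | a, [] => [a]
  | a, XY.x :: w => readIndex (a + 1) w
  | a, XY.y :: w => a :: readIndex 1 w

/-- The Hoffman dual: if `z_k = y w`, then `k^∨` is the index with `z_{k^∨} = y τ(w)`;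
the dual of the empty index is empty. -/
def hoffmanDual (k : Index) : Index :=
  match zWord k with
  | [] => []
  | _ :: w => readIndex 1 (w.map XY.swap)

theorem zWord_readIndex (w : List XY) : ∀ a : ℕ+,
    zWord (readIndex a w) = XY.y :: (List.replicate ((a : ℕ) - 1) XY.x ++ w) := by
  induction w with
  | nil => intro a; simp [readIndex, zWord]
  | cons c w ih =>
    intro a
    cases c with
    | x =>
      have h : ((a + 1 : ℕ+) : ℕ) - 1 = ((a : ℕ) - 1) + 1 := by
        have := a.pos
        simp only [PNat.add_coe, PNat.one_coe]
        omega
      rw [readIndex, ih, h, List.replicate_succ']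
      simp
    | y =>
      have h : zWord (a :: readIndex 1 w) =
          (XY.y :: List.replicate ((a : ℕ) - 1) XY.x) ++ zWord (readIndex 1 w) := by
        simp [zWord]
      rw [readIndex, h, ih]
      simp

/-- The defining property of the Hoffman dual. -/
theorem zWord_hoffmanDual (k : Index) (w : List XY) (h : zWord k = XY.y :: w) :
    zWord (hoffmanDual k) = XY.y :: w.map XY.swap := by
  simp [hoffmanDual, h, zWord_readIndex]

/-! ### The algebra `𝒞⟨A⟩` and the harmonic product -/

/-- The coefficient ring `𝒞 = ℚ[ħ]`; the variable `ħ` is `Polynomial.X`. -/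
abbrev 𝒞 := ℚ[X]

/-- The set `A = {ħb} ∪ {g_k | k ≥ 1}`. The letter `c` stands for `ħb = e₁ - g₁` and the
letter `g k` for `g_k = b a^k`. These elements of `𝒞⟨a, b⟩` are algebraically independent. -/
inductive Letter
  | c
  | g (k : ℕ+)

/-- The algebra `𝒞⟨A⟩` of non-commutative polynomials in `A` over `𝒞`. -/
abbrev CA := MonoidAlgebra 𝒞 (FreeMonoid Letter)

/-- The monomial `u₁ ⋯ u_r` of `𝒞⟨A⟩`. -/
def word (w : List Letter) : CA := MonoidAlgebra.of 𝒞 (FreeMonoid Letter) (FreeMonoid.ofList w)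

/-- The `𝒞`-linear map on `𝒞⟨A⟩` with prescribed values on monomials. -/
def onWords {M : Type*} [AddCommMonoid M] [Module 𝒞 M] (f : List Letter → M) : CA →ₗ[𝒞] M :=
  Finsupp.linearCombination 𝒞 (fun w : FreeMonoid Letter => f (FreeMonoid.toList w)) ∘ₗ
    (MonoidAlgebra.coeffLinearEquiv 𝒞).toLinearMap

/-- The product `u ∘_ħ v` on letters, with values in the span of `A`. -/
def circ : Letter → Letter → CA
  | .c, .c => (X : 𝒞) • word [.c]
  | .c, .g k => (X : 𝒞) • word [.g k]
  | .g k, .c => (X : 𝒞) • word [.g k]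
  | .g k, .g l => word [.g (k + l)]

/-- The harmonic product of two monomials, each given by the list of its letters read from right
to left:
`(w u) * (w' v) = (w * w' v) u + (w u * w') v + (w * w') (u ∘_ħ v)`. -/
def harmRev : List Letter → List Letter → CA
  | [], w' => word w'.reverse
  | u :: w, [] => word (u :: w).reverse
  | u :: w, v :: w' =>
      harmRev w (v :: w') * word [u] + harmRev (u :: w) w' * word [v] +
        harmRev w w' * circ u v
termination_by w w' => w.length + w'.length

/-- The harmonic product `*_ħ` on `𝒞⟨A⟩`. -/
def harm : CA →ₗ[𝒞] CA →ₗ[𝒞] CA :=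
  onWords fun w => onWords fun w' => harmRev w.reverse w'.reverse

/-- The anti-automorphism `ψ^*` on letters: `ħb ↦ ħb` and `b a^k ↦ b (-a)^k`. -/
def psiLetter : Letter → CA
  | .c => word [.c]
  | .g k => (-1 : 𝒞) ^ (k : ℕ) • word [.g k]

/-- The `𝒞`-algebra anti-automorphism `ψ^*` of `𝒞⟨A⟩`. -/
def psi : CA →ₗ[𝒞] CA := onWords fun w => (w.reverse.map psiLetter).prod

/-- The map `w^{𝒮,*}_ħ`, given on monomials by
`u₁ ⋯ u_r ↦ ∑_{i=0}^r u₁ ⋯ u_i *_ħ ψ^*(u_{i+1} ⋯ u_r)`. -/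
def wS : CA →ₗ[𝒞] CA :=
  onWords fun w => ∑ i ∈ Finset.range (w.length + 1),
    harm (word (w.take i)) (psi (word (w.drop i)))

/-- The monomial `g_k = g_{k₁} ⋯ g_{k_r}`. -/
def gIndex (k : Index) : CA := word (k.map Letter.g)

/-! ### Submodules of `𝒞⟨A⟩` -/

/-- `∑_{k ≥ n} 𝒞⟨A⟩ g_k`. -/
def endsInG (n : ℕ) : Submodule 𝒞 CA :=
  Submodule.span 𝒞 {v | ∃ (w : CA) (k : ℕ+), n ≤ (k : ℕ) ∧ v = w * word [.g k]}

/-- The module `Ĥ⁰ = 𝒞 + ∑_{k ≥ 1} 𝒞⟨A⟩ g_k`. -/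
def hatH0 : Submodule 𝒞 CA := 1 ⊔ endsInG 1

/-- The monomial `(ħb)^{α₁} g_{β₁+1} ⋯ (ħb)^{α_r} g_{β_r+1}` attached to the list of the pairs
`(α_i, β_i)`. -/
def basisMonomial (l : List (ℕ × ℕ)) : CA :=
  (l.map fun p => word [.c] ^ p.1 * word [.g p.2.succPNat]).prod

/-- The module `𝔫₀`, spanned by the above monomials with `α_s, β_t ≥ 1` for some `s ≤ t`. -/
def n0 : Submodule 𝒞 CA :=
  Submodule.span 𝒞 {v | ∃ (l : List (ℕ × ℕ)) (s t : Fin l.length),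
    s ≤ t ∧ 1 ≤ (l.get s).1 ∧ 1 ≤ (l.get t).2 ∧ v = basisMonomial l}

/-- The module `𝔫 = 𝔫₀ + ħ Ĥ⁰`. -/
def nMod : Submodule 𝒞 CA := n0 ⊔ hatH0.map (LinearMap.lsmul 𝒞 CA (X : 𝒞))

/-- The module `H⁰ = 𝒞 + ∑_{k ≥ 2} 𝒞⟨A⟩ g_k + 𝔫`. -/
def H0 : Submodule 𝒞 CA := 1 ⊔ endsInG 2 ⊔ nMod

/-! ### `q`-multiple zeta values -/

/-- The `q`-integer `[m] = (1 - q^m) / (1 - q)`. -/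
def qInt (q : ℂ) (m : ℕ) : ℂ := (1 - q ^ m) / (1 - q)

/-- `F_q(m; ħb) = 1 - q` and `F_q(m; g_k) = q^{km} / [m]^k`. -/
def F (q : ℂ) (m : ℕ) : Letter → ℂ
  | .c => 1 - q
  | .g k => q ^ ((k : ℕ) * m) / qInt q m ^ (k : ℕ)

/-- The truncated sum `∑_{0 < m₁ < ⋯ < m_r < M} ∏ F_q(m_i; u_i)`, written as an iterated sum with
the outermost summation over `m_r`; the monomial `u₁ ⋯ u_r` is given by the list of its letters
read from right to left. -/
def truncRev (q : ℂ) : List Letter → ℕ → ℂ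
  | [], _ => 1
  | u :: w, M => ∑ m ∈ Finset.Ioo 0 M, truncRev q w m * F q m u

theorem norm_F_g_le (q : ℂ) (hq : ‖q‖ < 1) (k : ℕ+) (m : ℕ) (hm : 0 < m) :
    ‖F q m (.g k)‖ ≤ (‖1 - q‖ / (1 - ‖q‖)) ^ (k : ℕ) * ‖q‖ ^ m := by
  have h1 : 0 < 1 - ‖q‖ := by linarith
  have h2 : 1 - ‖q‖ ≤ ‖1 - q ^ m‖ := by
    have h3 : ‖q‖ ^ m ≤ ‖q‖ := pow_le_of_le_one (norm_nonneg _) hq.le hm.ne'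
    have h4 := norm_sub_norm_le (1 : ℂ) (q ^ m)
    rw [norm_one, norm_pow] at h4
    linarith
  have h5 : ‖qInt q m‖⁻¹ ≤ ‖1 - q‖ / (1 - ‖q‖) := by
    rw [qInt, norm_div, inv_div]
    exact div_le_div_of_nonneg_left (norm_nonneg _) h1 h2
  have h6 : ‖q‖ ^ ((k : ℕ) * m) ≤ ‖q‖ ^ m :=
    pow_le_pow_of_le_one (norm_nonneg _) hq.le (Nat.le_mul_of_pos_left m k.pos)
  rw [F, norm_div, norm_pow, norm_pow, div_eq_mul_inv, ← inv_pow, mul_comm]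
  gcongr

theorem norm_F_le (q : ℂ) (hq : ‖q‖ < 1) (u : Letter) :
    ∃ B : ℝ, 0 ≤ B ∧ ∀ m : ℕ, 0 < m → ‖F q m u‖ ≤ B := by
  cases u with
  | c => exact ⟨‖1 - q‖, norm_nonneg _, fun m _ => le_rfl⟩
  | g k =>
    have h1 : 0 < 1 - ‖q‖ := by linarith
    refine ⟨(‖1 - q‖ / (1 - ‖q‖)) ^ (k : ℕ), by positivity, fun m hm => ?_⟩
    exact (norm_F_g_le q hq k m hm).trans
      (mul_le_of_le_one_right (by positivity) (pow_le_one₀ (norm_nonneg _) hq.le))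

theorem norm_truncRev_le (q : ℂ) (hq : ‖q‖ < 1) (w : List Letter) :
    ∃ B : ℝ, 0 ≤ B ∧ ∀ M : ℕ, ‖truncRev q w M‖ ≤ B * (M : ℝ) ^ w.length := by
  induction w with
  | nil => exact ⟨1, zero_le_one, fun M => by simp [truncRev]⟩
  | cons u w ih =>
    obtain ⟨B, hB, h⟩ := ih
    obtain ⟨D, hD, h'⟩ := norm_F_le q hq u
    refine ⟨B * D, by positivity, fun M => ?_⟩
    have hb : ∀ m ∈ Finset.Ioo 0 M,
        ‖truncRev q w m * F q m u‖ ≤ B * (M : ℝ) ^ w.length * D := by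
      intro m hm
      rw [Finset.mem_Ioo] at hm
      rw [norm_mul]
      refine mul_le_mul ((h m).trans ?_) (h' m hm.1) (norm_nonneg _) (by positivity)
      have : (m : ℝ) ≤ M := by exact_mod_cast hm.2.le
      gcongr
    have hc : ((Finset.Ioo 0 M).card : ℝ) ≤ M := by
      have : (Finset.Ioo 0 M).card ≤ M := by simp
      exact_mod_cast this
    calc ‖truncRev q (u :: w) M‖ ≤ ∑ m ∈ Finset.Ioo 0 M, B * (M : ℝ) ^ w.length * D :=
          norm_sum_le_of_le _ hb
      _ = (Finset.Ioo 0 M).card * (B * (M : ℝ) ^ w.length * D) := by simp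
      _ ≤ M * (B * (M : ℝ) ^ w.length * D) := by gcongr
      _ = B * D * (M : ℝ) ^ (u :: w).length := by rw [List.length_cons, pow_succ]; ring

/-- The truncated sums of a monomial that ends in a letter `g_k` converge as `M → ∞`. -/
theorem exists_tendsto_truncRev (q : ℂ) (hq : ‖q‖ < 1) (w : List Letter) (k : ℕ+) :
    ∃ z : ℂ, Tendsto (fun M => truncRev q (w ++ [Letter.g k]).reverse M) atTop (nhds z) := by
  obtain ⟨B, hB, h⟩ := norm_truncRev_le q hq w.reverse
  set f : ℕ → ℂ := fun m => if m = 0 then 0 else truncRev q w.reverse m * F q m (.g k) with hf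
  have hs : Summable f := by
    have h0 := (summable_norm_pow_mul_geometric_of_norm_lt_one w.reverse.length hq).mul_left
      (B * (‖1 - q‖ / (1 - ‖q‖)) ^ (k : ℕ))
    have h1 : 0 < 1 - ‖q‖ := by linarith
    refine Summable.of_norm_bounded h0 fun m => ?_
    rcases Nat.eq_zero_or_pos m with hm | hm
    · simp only [hf, hm, if_true, norm_zero]; positivity
    · simp only [hf, hm.ne', if_false, norm_mul, norm_pow, Complex.norm_natCast]
      calc ‖truncRev q w.reverse m‖ * ‖F q m (.g k)‖
          ≤ (B * (m : ℝ) ^ w.reverse.length) *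
              ((‖1 - q‖ / (1 - ‖q‖)) ^ (k : ℕ) * ‖q‖ ^ m) :=
            mul_le_mul (h m) (norm_F_g_le q hq k m hm) (norm_nonneg _) (by positivity)
        _ = _ := by ring
  refine ⟨∑' m, f m, hs.hasSum.tendsto_sum_nat.congr fun M => ?_⟩
  rw [List.reverse_append, List.reverse_singleton, List.singleton_append, truncRev,
    Finset.range_eq_Ico]
  symm
  refine Finset.sum_subset_zero_on_sdiff (fun m hm => ?_) (fun m hm => ?_) (fun m hm => ?_)
  · rw [Finset.mem_Ioo] at hm; rw [Finset.mem_Ico]; omega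
  · rw [Finset.mem_sdiff, Finset.mem_Ico, Finset.mem_Ioo] at hm
    have : m = 0 := by omega
    simp [hf, this]
  · rw [Finset.mem_Ioo] at hm
    simp [hf, hm.1.ne']

/-- `Z_q(u₁ ⋯ u_r) = lim_{M → ∞} Z_{q,M}(u₁ ⋯ u_r)`. -/
def ZqWord (q : ℂ) (w : List Letter) : ℂ :=
  limUnder Filter.atTop fun M => truncRev q w.reverse M

/-- The map `Z_q`, extended linearly from monomials, where `ħ` acts on `ℂ` as `1 - q`. It is only
meaningful on `Ĥ⁰`, where the limits exist. -/
def Zq (q : ℂ) : CA →ₗ[ℚ] ℂ :=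
  (Finsupp.lsum ℚ fun w : FreeMonoid Letter =>
    LinearMap.mulRight ℚ (ZqWord q (FreeMonoid.toList w)) ∘ₗ
      (Polynomial.aeval (R := ℚ) (1 - q)).toLinearMap) ∘ₗ
    ((MonoidAlgebra.coeffLinearEquiv 𝒞).toLinearMap.restrictScalars ℚ)

/-- The space `𝒵_q = Z_q(H⁰)` (a subring of `ℂ`). -/
def calZ (q : ℂ) : Submodule ℚ ℂ := (H0.restrictScalars ℚ).map (Zq q)

/-- `𝒩_q = Z_q(𝔫)`. -/
def calN (q : ℂ) : Submodule ℚ ℂ := (nMod.restrictScalars ℚ).map (Zq q)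

/-- The ideal `𝒫_q` of `𝒵_q` generated by the values `Z_q(g_{2k})` with `k ≥ 1`: the set of all
finite sums of products of an element of `𝒵_q` and a generator. -/
def calP (q : ℂ) : Submodule ℚ ℂ :=
  calZ q * Submodule.span ℚ (Set.range fun k : ℕ+ => Zq q (gIndex [2 * k]))

/-- The quotient `𝒵_q / (𝒩_q + 𝒫_q)`. -/
abbrev QuotSpace (q : ℂ) : Type := calZ q ⧸ (calN q ⊔ calP q).submoduleOf (calZ q)

/-! ### `q`-symmetric multiple zeta values -/

theorem onWords_word {M : Type*} [AddCommMonoid M] [Module 𝒞 M] (f : List Letter → M)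
    (w : List Letter) : onWords f (word w) = f w := by
  simp [onWords, word]

theorem word_append (v w : List Letter) : word (v ++ w) = word v * word w := by
  simp [word]

/-- The sign `(-1)^{wt(b)}`. -/
def sgn (b : Index) : 𝒞 := (b.map fun k : ℕ+ => (-1 : 𝒞) ^ (k : ℕ)).prod

/-- `g_{a_r} ⋯ g_{a_1} *_ħ ψ^*(g_{b_1} ⋯ g_{b_s})`. -/
def term (a b : Index) : CA := sgn b • harmRev (a.map Letter.g) (b.map Letter.g)

theorem psi_gIndex (b : Index) :
    psi (word (b.map Letter.g)) = sgn b • word (b.map Letter.g).reverse := by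
  rw [psi, onWords_word]
  induction b with
  | nil => simp [sgn, word, MonoidAlgebra.one_def]
  | cons k b ih =>
    simp only [List.map_cons, List.reverse_cons, List.map_append, List.prod_append, ih,
      List.map_nil, List.prod_nil, mul_one, psiLetter, word_append, sgn, List.prod_cons]
    rw [smul_mul_smul_comm, mul_comm]

theorem harm_psi (a b : Index) :
    harm (word (a.reverse.map Letter.g)) (psi (word (b.map Letter.g))) = term a b := by
  rw [psi_gIndex, map_smul, harm, onWords_word, onWords_word, term]
  simp

/-- The part of `harmRev a b` that ends in the letter `g_1` coming from `a`. -/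
def tailL (a b : Index) : CA :=
  match a with
  | [] => 0
  | k :: a => if k = 1 then harmRev (a.map Letter.g) (b.map Letter.g) * word [.g 1] else 0

/-- The part of `harmRev a b` that ends in the letter `g_1` coming from `b`. -/
def tailR (a b : Index) : CA :=
  match b with
  | [] => 0
  | k :: b => if k = 1 then harmRev (a.map Letter.g) (b.map Letter.g) * word [.g 1] else 0

theorem mem_H0 (v : CA) (k : ℕ+) (hk : k ≠ 1) : v * word [.g k] ∈ H0 := by
  refine Submodule.mem_sup_left (Submodule.mem_sup_right (Submodule.subset_span ⟨v, k, ?_, rfl⟩))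
  have h1 : (k : ℕ) ≠ 1 := fun h => hk (PNat.coe_eq_one_iff.mp h)
  have := k.pos
  omega

theorem harmRev_nil_right (w : List Letter) : harmRev w [] = word w.reverse := by
  cases w <;> simp [harmRev]

theorem sub_ite_mem (v : CA) (k : ℕ+) :
    v * word [.g k] - (if k = 1 then v * word [.g 1] else 0) ∈ H0 := by
  split_ifs with h
  · subst h; simp
  · simpa using mem_H0 v k h

theorem harmRev_sub_mem (a b : Index) :
    harmRev (a.map Letter.g) (b.map Letter.g) - (tailL a b + tailR a b) ∈ H0 := by
  cases a with
  | nil =>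
    cases b with
    | nil =>
      refine Submodule.mem_sup_left (Submodule.mem_sup_left ?_)
      simp only [List.map_nil, harmRev, tailL, tailR, add_zero, sub_zero]
      exact Submodule.one_le.mp le_rfl
    | cons l b =>
      have := sub_ite_mem (harmRev [] (b.map Letter.g)) l
      simpa [harmRev, tailL, tailR, word_append] using this
  | cons k a =>
    cases b with
    | nil =>
      have := sub_ite_mem (harmRev (a.map Letter.g) []) k
      simpa [harmRev, harmRev_nil_right, tailL, tailR, word_append] using this
    | cons l b =>
      have h1 := sub_ite_mem (harmRev (a.map Letter.g) ((l :: b).map Letter.g)) k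
      have h2 := sub_ite_mem (harmRev ((k :: a).map Letter.g) (b.map Letter.g)) l
      have h3 := mem_H0 (harmRev (a.map Letter.g) (b.map Letter.g)) (k + l)
        (by intro h; have := congrArg PNat.val h; have := k.pos; have := l.pos
            simp only [PNat.val_ofNat, PNat.add_coe] at *
            omega)
      have h4 := H0.add_mem (H0.add_mem h1 h2) h3
      simp only [List.map_cons, harmRev, tailL, tailR, circ] at h4 ⊢
      convert h4 using 1
      abel

/-- `∑_{i} term (b_i, …, b_1, a) (b_{i+1}, …, b_s)`. -/
def splitSum (a b : Index) : CA :=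
  ∑ i ∈ Finset.range (b.length + 1), term ((b.take i).reverse ++ a) (b.drop i)

theorem splitSum_cons (a : Index) (k : ℕ+) (b : Index) :
    splitSum a (k :: b) = splitSum (k :: a) b + term a (k :: b) := by
  rw [splitSum, List.length_cons, Finset.sum_range_succ']
  simp [splitSum]

theorem splitSum_sub_mem (b : Index) : ∀ a : Index,
    splitSum a b - sgn b • tailL a b ∈ H0 := by
  induction b with
  | nil =>
    intro a
    have := harmRev_sub_mem a []
    simpa [splitSum, term, sgn, tailR] using this
  | cons k b ih =>
    intro a
    have h1 := ih (k :: a)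
    have h2 := H0.smul_mem (sgn (k :: b)) (harmRev_sub_mem a (k :: b))
    have h3 : sgn (k :: b) • tailR a (k :: b) = - (sgn b • tailL (k :: a) b) := by
      simp only [tailL, tailR]
      split_ifs with h
      · subst h; simp [sgn]
      · simp
    have h4 := H0.add_mem h1 h2
    rw [smul_sub, smul_add, h3] at h4
    rw [splitSum_cons, term]
    convert h4 using 1
    abel

/-- The element `w^{𝒮,*}_ħ(g_k)` belongs to `H⁰`. -/
theorem wS_gIndex_mem (k : Index) : wS (gIndex k) ∈ H0 := by
  have h : wS (gIndex k) = splitSum [] k := by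
    rw [wS, gIndex, onWords_word, splitSum, List.length_map]
    refine Finset.sum_congr rfl fun i _ => ?_
    rw [← List.map_take, ← List.map_drop, ← harm_psi]
    simp
  rw [h]
  simpa [tailL] using splitSum_sub_mem k []

/-- The `q`-analogue `ζ_q^𝒮(k)` of the symmetric multiple zeta value: the class of
`Z_q^{𝒮,*}(g_k) = Z_q(w^{𝒮,*}_ħ(g_k))` in `𝒵_q / (𝒩_q + 𝒫_q)`. -/
def zetaS (q : ℂ) (k : Index) : QuotSpace q :=
  Submodule.Quotient.mk
    ⟨Zq q (wS (gIndex k)), Submodule.mem_map_of_mem (wS_gIndex_mem k)⟩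

end

end QSMZV

namespace QSMZV

open Polynomial Filter

noncomputable section

/-! ### The shuffle algebra of words in `x` and `y` -/

/-- The shuffle algebra on words in `x` and `y`; a word is stored as the list of its letters read
from right to left. -/
def Sh : Type := List XY →₀ ℚ

namespace Sh

instance : AddCommGroup Sh := inferInstanceAs (AddCommGroup (List XY →₀ ℚ))
instance : Module ℚ Sh := inferInstanceAs (Module ℚ (List XY →₀ ℚ))

/-- The basis element attached to a word. -/
def of (w : List XY) : Sh := Finsupp.single w (1 : ℚ)

/-- The linear map with prescribed values on words. -/
def lift {M : Type*} [AddCommGroup M] [Module ℚ M] (f : List XY → M) : Sh →ₗ[ℚ] M :=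
  Finsupp.linearCombination ℚ f

@[simp] theorem lift_of {M : Type*} [AddCommGroup M] [Module ℚ M] (f : List XY → M)
    (w : List XY) : lift f (of w) = f w :=
  (Finsupp.linearCombination_single ℚ (1 : ℚ) w).trans (one_smul ℚ _)

@[elab_as_elim]
theorem induction {P : Sh → Prop} (a : Sh) (h0 : P 0) (hadd : ∀ a b, P a → P b → P (a + b))
    (h : ∀ (r : ℚ) w, P (r • of w)) : P a := by
  refine Finsupp.induction_linear (motive := P) a h0 hadd fun w r => ?_
  have h1 : r • of w = (Finsupp.single w r : List XY →₀ ℚ) :=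
    (Finsupp.smul_single r w (1 : ℚ)).trans (by rw [smul_eq_mul, mul_one])
  exact h1 ▸ h r w

theorem hom_ext {M : Type*} [AddCommGroup M] [Module ℚ M] {f g : Sh →ₗ[ℚ] M}
    (h : ∀ w, f (of w) = g (of w)) : f = g := by
  ext a
  induction a using Sh.induction with
  | h0 => simp
  | hadd a b ha hb => simp [ha, hb]
  | h r w => simp [h]

theorem hom_ext₂ {M : Type*} [AddCommGroup M] [Module ℚ M] {f g : Sh →ₗ[ℚ] Sh →ₗ[ℚ] M}
    (h : ∀ v w, f (of v) (of w) = g (of v) (of w)) : f = g :=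
  hom_ext fun v => hom_ext fun w => h v w

/-- Append a letter at the right end of a word. -/
def snoc (l : XY) : Sh →ₗ[ℚ] Sh := lift fun w => of (l :: w)

@[simp] theorem snoc_of (l : XY) (w : List XY) : snoc l (of w) = of (l :: w) := by simp [snoc]

/-- The shuffle product of two words. -/
def shuffle : List XY → List XY → Sh
  | [], w' => of w'
  | l :: w, [] => of (l :: w)
  | l :: w, l' :: w' => snoc l (shuffle w (l' :: w')) + snoc l' (shuffle (l :: w) w')
termination_by w w' => w.length + w'.length

theorem shuffle_nil_right (w : List XY) : shuffle w [] = of w := by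
  cases w <;> simp [shuffle]

/-- The shuffle product as a bilinear map. -/
def mulₗ : Sh →ₗ[ℚ] Sh →ₗ[ℚ] Sh := lift fun w => lift fun w' => shuffle w w'

theorem mulₗ_of (w w' : List XY) : mulₗ (of w) (of w') = shuffle w w' := by simp [mulₗ]

theorem mulₗ_snoc (l l' : XY) (a b : Sh) : mulₗ (snoc l a) (snoc l' b) =
    snoc l (mulₗ a (snoc l' b)) + snoc l' (mulₗ (snoc l a) b) := by
  have h : (mulₗ.compl₁₂ (snoc l) (snoc l')) =
      (mulₗ.compl₂ (snoc l')).compr₂ (snoc l) + (mulₗ.comp (snoc l)).compr₂ (snoc l') := by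
    refine hom_ext₂ fun v w => ?_
    simp [mulₗ_of, shuffle]
  exact LinearMap.congr_fun₂ h a b

theorem shuffle_comm : ∀ v w : List XY, shuffle v w = shuffle w v
  | [], w => by rw [shuffle_nil_right, shuffle]
  | l :: v, [] => by rw [shuffle_nil_right, shuffle]
  | l :: v, l' :: w => by
    rw [shuffle, shuffle, shuffle_comm v, shuffle_comm (l :: v), add_comm]
termination_by v w => v.length + w.length

theorem mulₗ_comm (a b : Sh) : mulₗ a b = mulₗ b a := by
  have h : mulₗ = mulₗ.flip := hom_ext₂ fun v w => by simp [mulₗ_of, shuffle_comm v]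
  exact LinearMap.congr_fun₂ h a b

theorem mulₗ_one_left (a : Sh) : mulₗ (of []) a = a := by
  have h : mulₗ (of []) = LinearMap.id := hom_ext fun w => by simp [mulₗ_of, shuffle]
  exact LinearMap.congr_fun h a

theorem mulₗ_assoc_of : ∀ u v w : List XY,
    mulₗ (mulₗ (of u) (of v)) (of w) = mulₗ (of u) (mulₗ (of v) (of w))
  | [], v, w => by simp [mulₗ_one_left]
  | l :: u, [], w => by rw [mulₗ_comm (of (l :: u)), mulₗ_one_left, mulₗ_one_left]
  | l :: u, l' :: v, [] => by
    rw [mulₗ_comm _ (of []), mulₗ_comm _ (of []), mulₗ_one_left, mulₗ_one_left]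
  | l :: u, l' :: v, l'' :: w => by
    have h1 := mulₗ_assoc_of u (l' :: v) (l'' :: w)
    have h2 := mulₗ_assoc_of (l :: u) v (l'' :: w)
    have h3 := mulₗ_assoc_of (l :: u) (l' :: v) w
    simp only [← snoc_of] at h1 h2 h3 ⊢
    simp only [mulₗ_snoc, map_add, LinearMap.add_apply] at h1 h2 h3 ⊢
    rw [h1, h2, ← h3]
    simp only [map_add]
    abel
termination_by u v w => u.length + v.length + w.length

theorem mulₗ_assoc (a b c : Sh) : mulₗ (mulₗ a b) c = mulₗ a (mulₗ b c) := by
  induction a using Sh.induction with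
  | h0 => simp
  | hadd a a' ha hb => simp [ha, hb]
  | h r u =>
    induction b using Sh.induction with
    | h0 => simp
    | hadd a a' ha hb =>
      simp only [map_add, LinearMap.add_apply] at ha hb ⊢
      rw [ha, hb]
    | h r' v =>
      induction c using Sh.induction with
      | h0 => simp
      | hadd a a' ha hb =>
        simp only [map_add] at ha hb ⊢
        rw [ha, hb]
      | h r'' w => simp [mulₗ_assoc_of]

instance : CommRing Sh where
  __ := (inferInstance : AddCommGroup Sh)
  mul a b := mulₗ a b
  one := of []
  mul_assoc := mulₗ_assoc
  mul_comm := mulₗ_comm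
  one_mul := mulₗ_one_left
  mul_one a := (mulₗ_comm _ _).trans (mulₗ_one_left a)
  zero_mul a := by change mulₗ 0 a = 0; simp
  mul_zero a := by change mulₗ a 0 = 0; simp
  left_distrib a b c := by change mulₗ a (b + c) = mulₗ a b + mulₗ a c; simp
  right_distrib a b c := by change mulₗ (a + b) c = mulₗ a c + mulₗ b c; simp

theorem mul_def (a b : Sh) : a * b = mulₗ a b := rfl
theorem one_def : (1 : Sh) = of [] := rfl

instance : Algebra ℚ Sh := Algebra.ofModule
  (fun r a b => by simp [mul_def]) (fun r a b => by simp [mul_def])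

theorem of_mul_of (v w : List XY) : of v * of w = shuffle v w := mulₗ_of v w

theorem snoc_mul_snoc (l l' : XY) (a b : Sh) :
    snoc l a * snoc l' b = snoc l (a * snoc l' b) + snoc l' (snoc l a * b) :=
  mulₗ_snoc l l' a b

/-- The power `y^n`, which is the `n`-th divided power of `y`. -/
def yPow (n : ℕ) : Sh := of (List.replicate n XY.y)

@[simp] theorem yPow_zero : yPow 0 = 1 := rfl

theorem yPow_succ (n : ℕ) : yPow (n + 1) = snoc .y (yPow n) := by
  simp [yPow, List.replicate_succ]

/-- Strip the last letter `y`. -/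
def strip : Sh →ₗ[ℚ] Sh := lift fun
  | .y :: w => of w
  | _ => 0

theorem snoc_mul_y (l : XY) (a : Sh) :
    snoc l a * yPow 1 = snoc l (a * yPow 1) + snoc .y (snoc l a) := by
  rw [yPow_succ, snoc_mul_snoc]; simp

theorem snoc_iter_mul_y (a : Sh) (n : ℕ) : ((snoc .y)^[n] a) * yPow 1 =
    (snoc .y)^[n] (a * yPow 1) + (n : ℚ) • (snoc .y)^[n + 1] a := by
  induction n with
  | zero => simp
  | succ n ih =>
    rw [Function.iterate_succ_apply', snoc_mul_y, ih, Function.iterate_succ_apply' _ (n + 1),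
      Function.iterate_succ_apply' _ n, Function.iterate_succ_apply' _ n]
    simp only [map_add, map_smul]
    push_cast
    module

theorem yPow_mul_y (n : ℕ) : yPow n * yPow 1 = ((n : ℚ) + 1) • yPow (n + 1) := by
  have h : ∀ n, (snoc .y)^[n] (1 : Sh) = yPow n := by
    intro n
    induction n with
    | zero => rfl
    | succ n ih => rw [Function.iterate_succ_apply', ih, yPow_succ]
  have h1 := snoc_iter_mul_y 1 n
  rw [h, h, one_mul, yPow_succ 0, yPow_zero, ← Function.iterate_succ_apply, h] at h1
  rw [yPow_succ 0, yPow_zero, h1]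
  module

end Sh

namespace Sh
open TensorProduct

/-- The bilinear map with prescribed values on pairs of words. -/
def lift₂ {M : Type*} [AddCommGroup M] [Module ℚ M] (f : List XY → List XY → M) :
    Sh →ₗ[ℚ] Sh →ₗ[ℚ] M := lift fun v => lift (f v)

@[simp] theorem lift₂_of {M : Type*} [AddCommGroup M] [Module ℚ M] (f : List XY → List XY → M)
    (v w : List XY) : lift₂ f (of v) (of w) = f v w := by simp [lift₂]

/-- The indicator of the letter `y`. -/
def isY : XY → ℚ
  | .x => 0
  | .y => 1

@[simp] theorem strip_one : strip (1 : Sh) = 0 := by simp [strip, one_def]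

theorem strip_snoc (l : XY) (a : Sh) : strip (snoc l a) = isY l • a := by
  have h : strip ∘ₗ snoc l = isY l • LinearMap.id := hom_ext fun w => by
    cases l <;> simp [strip, isY]
  exact LinearMap.congr_fun h a

/-- The sign `w ↦ (-1)^{|w|} w`. -/
def sign : Sh →ₗ[ℚ] Sh := lift fun w => (-1 : ℚ) ^ w.length • of w

@[simp] theorem sign_one : sign (1 : Sh) = 1 := by simp [sign, one_def]

theorem sign_snoc (l : XY) (a : Sh) : sign (snoc l a) = - snoc l (sign a) := by
  have h : sign ∘ₗ snoc l = - (snoc l ∘ₗ sign) := hom_ext fun w => by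
    simp [sign, pow_succ]
  exact LinearMap.congr_fun h a

theorem sign_strip (a : Sh) : strip (sign a) = - sign (strip a) := by
  have h : strip ∘ₗ sign = - (sign ∘ₗ strip) := hom_ext fun w => by
    cases w with
    | nil => simp [← one_def]
    | cons l w => simp [← snoc_of, sign_snoc, strip_snoc]
  exact LinearMap.congr_fun h a

theorem sign_mul_y (a : Sh) : sign (a * yPow 1) = - (sign a * yPow 1) := by
  have h : ∀ w, sign (of w * yPow 1) = - (sign (of w) * yPow 1) := by
    intro w
    induction w with
    | nil => rw [← one_def, sign_one, one_mul, yPow_succ, sign_snoc]; simp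
    | cons l w ih =>
      rw [← snoc_of, snoc_mul_y, map_add, sign_snoc, sign_snoc, sign_snoc, ih, neg_mul, snoc_mul_y]
      simp only [map_neg]
      abel
  have h' : sign ∘ₗ LinearMap.mulRight ℚ (yPow 1) = - (LinearMap.mulRight ℚ (yPow 1) ∘ₗ sign) :=
    hom_ext fun w => by simpa using h w
  simpa using LinearMap.congr_fun h' a

/-- `∑ v₁ ⊗ S(v₂)` over all factorizations `s = s₁ y v₂`, where `v₁ = p s₁` and `S` is the
antipode. The word `s` is read from left to right. -/
def delta : List XY → List XY → Sh ⊗[ℚ] Sh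
  | _, [] => 0
  | p, l :: s => isY l • (of p ⊗ₜ sign (of s)) + delta (l :: p) s

/-- The bilinear extension of `delta`. -/
def deltaₗ : Sh →ₗ[ℚ] Sh →ₗ[ℚ] Sh ⊗[ℚ] Sh := lift₂ delta

theorem deltaₗ_one (a : Sh) : deltaₗ a 1 = 0 := by
  have h : deltaₗ.flip 1 = 0 := hom_ext fun w => by simp [deltaₗ, one_def, delta]
  exact LinearMap.congr_fun h a

theorem deltaₗ_snoc (l : XY) (a b : Sh) :
    deltaₗ a (snoc l b) = isY l • (a ⊗ₜ sign b) + deltaₗ (snoc l a) b := by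
  have h : deltaₗ.compl₂ (snoc l) = isY l • (TensorProduct.mk ℚ Sh Sh).compl₂ sign +
      deltaₗ.comp (snoc l) := hom_ext₂ fun v w => by simp [deltaₗ, delta]
  exact LinearMap.congr_fun₂ h a b

/-- The image of `delta` under the shuffle product. -/
def D : Sh →ₗ[ℚ] Sh →ₗ[ℚ] Sh := deltaₗ.compr₂ (LinearMap.mul' ℚ Sh)

theorem D_one (a : Sh) : D a 1 = 0 := by simp [D, deltaₗ_one]

theorem D_snoc (l : XY) (a b : Sh) :
    D a (snoc l b) = isY l • (a * sign b) + D (snoc l a) b := by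
  simp [D, deltaₗ_snoc]

/-- `∑ p s₁ · S(s₂)` over all factorizations `s = s₁ s₂`. -/
def antSum : List XY → List XY → Sh
  | p, [] => of p
  | p, l :: s => of p * sign (of (l :: s)) + antSum (l :: p) s

/-- The bilinear extension of `antSum`. -/
def antSumₗ : Sh →ₗ[ℚ] Sh →ₗ[ℚ] Sh := lift₂ antSum

theorem antSumₗ_one (a : Sh) : antSumₗ a 1 = a := by
  have h : antSumₗ.flip 1 = LinearMap.id := hom_ext fun w => by simp [antSumₗ, one_def, antSum]
  exact LinearMap.congr_fun h a

theorem antSumₗ_snoc (l : XY) (a b : Sh) :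
    antSumₗ a (snoc l b) = a * sign (snoc l b) + antSumₗ (snoc l a) b := by
  have h : antSumₗ.compl₂ (snoc l) = (LinearMap.mul ℚ Sh).compl₂ (sign ∘ₗ snoc l) +
      antSumₗ.comp (snoc l) := hom_ext₂ fun v w => by simp [antSumₗ, antSum]
  exact LinearMap.congr_fun₂ h a b

theorem antSumₗ_snoc_of (l : XY) (a : Sh) (s : List XY) :
    antSumₗ (snoc l a) (of s) = snoc l (a * sign (of s)) := by
  induction s generalizing l a with
  | nil => rw [← one_def, antSumₗ_one, sign_one, mul_one]
  | cons l' s ih =>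
    rw [← snoc_of, antSumₗ_snoc, ih, sign_snoc, mul_neg, snoc_mul_snoc, mul_neg, map_neg]
    abel

theorem antSumₗ_one_snoc (l : XY) (s : List XY) : antSumₗ 1 (of (l :: s)) = 0 := by
  rw [← snoc_of, antSumₗ_snoc, antSumₗ_snoc_of, sign_snoc]
  simp

theorem D_mul_y (a : Sh) (s : List XY) :
    D a (of s * yPow 1) + D (a * yPow 1) (of s) - D (snoc .y a) (of s) = antSumₗ a (of s) := by
  induction s generalizing a with
  | nil =>
    rw [← one_def, D_one, D_one, antSumₗ_one, one_mul, yPow_succ, yPow_zero, D_snoc, D_one]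
    simp [isY]
  | cons l s ih =>
    have h := ih (snoc l a)
    rw [snoc_mul_y, map_add, LinearMap.add_apply] at h
    rw [← snoc_of, snoc_mul_y, antSumₗ_snoc, ← h, map_add, D_snoc, D_snoc, D_snoc, D_snoc,
      sign_mul_y, show isY .y = 1 from rfl]
    have : a * yPow 1 * sign (of s) = a * (sign (of s) * yPow 1) := by ring
    rw [this, mul_neg]
    module

theorem D_one_mul_y (l : XY) (s : List XY) : D 1 (of (l :: s) * yPow 1) = 0 := by
  have h := D_mul_y 1 (l :: s)
  rw [antSumₗ_one_snoc, one_mul, yPow_succ 0, yPow_zero] at h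
  rw [yPow_succ 0, yPow_zero]
  simpa using h

theorem strip_delta (a : Sh) (s : List XY) :
    strip.rTensor Sh (deltaₗ a (of s)) + strip.lTensor Sh (deltaₗ a (of s)) =
      strip a ⊗ₜ sign (strip (of s)) := by
  induction s generalizing a with
  | nil => simp [← one_def, deltaₗ_one]
  | cons l s ih =>
    have h := ih (snoc l a)
    rw [← snoc_of, deltaₗ_snoc, strip_snoc, map_add, map_add, map_smul, map_smul,
      LinearMap.rTensor_tmul, LinearMap.lTensor_tmul, sign_strip]
    rw [strip_snoc] at h
    rw [eq_sub_of_add_eq h]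
    simp only [map_smul, tmul_neg, tmul_smul, smul_tmul', smul_neg]
    abel

/-- Reversal of words. -/
def rev : Sh →ₗ[ℚ] Sh := lift fun w => of w.reverse

@[simp] theorem rev_of (w : List XY) : rev (of w) = of w.reverse := by simp [rev]

/-- Prepend a letter at the left end of a word. -/
def lcons (l : XY) : Sh →ₗ[ℚ] Sh := lift fun w => of (w ++ [l])

theorem rev_snoc (l : XY) (a : Sh) : rev (snoc l a) = lcons l (rev a) := by
  have h : rev ∘ₗ snoc l = lcons l ∘ₗ rev := hom_ext fun w => by simp [lcons]
  exact LinearMap.congr_fun h a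

theorem lcons_of_mul_y (l : XY) (w : List XY) :
    of (w ++ [l]) * yPow 1 = lcons l (of w * yPow 1) + of (w ++ [l, .y]) := by
  have h : ∀ (l' : XY) (a : Sh), lcons l (snoc l' a) = snoc l' (lcons l a) := fun l' a => by
    have h : lcons l ∘ₗ snoc l' = snoc l' ∘ₗ lcons l := hom_ext fun w => by simp [lcons]
    exact LinearMap.congr_fun h a
  induction w with
  | nil =>
    rw [← one_def, one_mul, List.nil_append, ← snoc_of, ← one_def, snoc_mul_y, one_mul,
      yPow_succ 0, yPow_zero]
    simp [one_def, lcons, add_comm]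
  | cons l' w ih =>
    rw [List.cons_append, ← snoc_of, snoc_mul_y, ih, ← snoc_of, snoc_mul_y, map_add, map_add, h, h,
      h]
    simp [lcons]
    abel

theorem rev_mul_y (a : Sh) : rev (a * yPow 1) = rev a * yPow 1 := by
  have h : ∀ w, rev (of w * yPow 1) = rev (of w) * yPow 1 := by
    intro w
    induction w with
    | nil => rw [← one_def, one_mul, one_def, rev_of, List.reverse_nil, ← one_def, one_mul]
             simp [yPow]
    | cons l w ih =>
      rw [rev_of, List.reverse_cons, lcons_of_mul_y, ← rev_of, ← ih, ← snoc_of, snoc_mul_y,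
        map_add, rev_snoc]
      simp
  have h' : rev ∘ₗ LinearMap.mulRight ℚ (yPow 1) = LinearMap.mulRight ℚ (yPow 1) ∘ₗ rev :=
    hom_ext fun w => by simpa using h w
  simpa using LinearMap.congr_fun h' a

theorem D_rev_snoc_mul_y (l : XY) (a : Sh) : D 1 (rev (snoc l a * yPow 1)) = 0 := by
  have h : (D 1 ∘ₗ rev ∘ₗ LinearMap.mulRight ℚ (yPow 1) ∘ₗ snoc l) = 0 := hom_ext fun w => by
    obtain ⟨l', v, hv⟩ : ∃ l' v, (l :: w).reverse = l' :: v :=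
      List.exists_cons_of_ne_nil (by simp)
    simp only [LinearMap.comp_apply, snoc_of, LinearMap.mulRight_apply, rev_mul_y, rev_of, hv,
      D_one_mul_y, LinearMap.zero_apply]
  exact LinearMap.congr_fun h a

theorem mul_yPow_mul_y (a : Sh) (n : ℕ) :
    a * yPow n * yPow 1 = ((n : ℚ) + 1) • (a * yPow (n + 1)) := by
  rw [mul_assoc, yPow_mul_y, mul_smul_comm]

theorem D_rev_snoc_iter (a : Sh) (n i : ℕ) :
    D 1 (rev ((snoc .y)^[i + 1] (a * yPow n))) =
      ((-1 : ℚ) ^ n * (i + n).choose n) • D 1 (rev ((snoc .y)^[i + n + 1] a)) := by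
  induction n generalizing i with
  | zero => simp
  | succ n ih =>
    have h := D_rev_snoc_mul_y .y ((snoc .y)^[i] (a * yPow n))
    rw [← Function.iterate_succ_apply' (snoc .y), snoc_iter_mul_y, mul_yPow_mul_y] at h
    have e : ∀ (m : ℕ) (r : ℚ) (b : Sh), (snoc .y)^[m] (r • b) = r • (snoc .y)^[m] b := by
      intro m r b
      induction m with
      | zero => rfl
      | succ m ihm => rw [Function.iterate_succ_apply', ihm, map_smul, Function.iterate_succ_apply']
    rw [e, map_add, map_add, map_smul, map_smul, map_smul, map_smul, ih (i + 1),
      show i + 1 + n + 1 = i + (n + 1) + 1 by ring] at h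
    have h2 : ((n : ℚ) + 1) ≠ 0 := by positivity
    have h3 : ((i + (n + 1)).choose (n + 1) : ℚ) * (n + 1) = (i + 1 + n).choose n * (i + 1) := by
      have := Nat.choose_succ_right_eq (i + (n + 1)) n
      rw [show i + (n + 1) - n = i + 1 by omega] at this
      rw [show i + 1 + n = i + (n + 1) by ring]
      exact_mod_cast this
    apply smul_right_injective _ h2
    simp only
    rw [eq_neg_of_add_eq_zero_left h, smul_smul, smul_smul, ← neg_smul]
    congr 1
    push_cast
    rw [pow_succ]
    linear_combination (-1 : ℚ) ^ n * h3

/-- The image under `D` of `y^[n]`-shuffles. -/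
theorem D_rev_mul_yPow (a : Sh) (n : ℕ) :
    D 1 (rev (snoc .y (a * yPow n))) =
      (-1 : ℚ) ^ n • D 1 (rev (snoc .y ((snoc .y)^[n] a))) := by
  have h := D_rev_snoc_iter a n 0
  rw [← Function.iterate_succ_apply' (snoc .y)]
  simpa using h

end Sh

namespace Sh

/-- Auxiliary function for `reg`: the regularization of `w y^n`. -/
def regWord : ℕ → List XY → Sh
  | 0, [] => 1
  | _ + 1, [] => 0
  | n, .y :: w => regWord (n + 1) w
  | n, .x :: w => (-1 : ℚ) ^ n • snoc .x (of w * yPow n)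

/-- The linear extension of `regWord n`. -/
def regₗ (n : ℕ) : Sh →ₗ[ℚ] Sh := lift (regWord n)

theorem regₗ_zero_one : regₗ 0 1 = 1 := by simp [regₗ, one_def, regWord]

theorem regₗ_succ_one (n : ℕ) : regₗ (n + 1) 1 = 0 := by simp [regₗ, one_def, regWord]

theorem regₗ_snoc_y (n : ℕ) (a : Sh) : regₗ n (snoc .y a) = regₗ (n + 1) a := by
  have h : regₗ n ∘ₗ snoc .y = regₗ (n + 1) := hom_ext fun w => by
    simp [regₗ, regWord]
  exact LinearMap.congr_fun h a

theorem regₗ_snoc_x (n : ℕ) (a : Sh) :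
    regₗ n (snoc .x a) = (-1 : ℚ) ^ n • snoc .x (a * yPow n) := by
  have h : regₗ n ∘ₗ snoc .x = (-1 : ℚ) ^ n • (snoc .x ∘ₗ LinearMap.mulRight ℚ (yPow n)) :=
    hom_ext fun w => by simp [regₗ, regWord]
  exact LinearMap.congr_fun h a

/-- The shuffle regularization, with values in the span of `1` and of the words ending in `x`. -/
def reg : Sh →ₗ[ℚ] Sh := regₗ 0

theorem regₗ_mul_y (n : ℕ) (a : Sh) : regₗ n (a * yPow 1) = -(n : ℚ) • regₗ (n + 1) a := by
  have h : ∀ w n, regₗ n (of w * yPow 1) = -(n : ℚ) • regₗ (n + 1) (of w) := by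
    intro w
    induction w with
    | nil =>
      intro n
      rw [← one_def, one_mul, yPow_succ, regₗ_snoc_y, yPow_zero, regₗ_succ_one, smul_zero]
    | cons l w ih =>
      intro n
      rw [← snoc_of, snoc_mul_y, map_add, regₗ_snoc_y]
      cases l with
      | x =>
        have e : of w * yPow 1 * yPow n = ((n : ℚ) + 1) • (of w * yPow (n + 1)) := by
          rw [mul_right_comm, mul_yPow_mul_y]
        simp only [regₗ_snoc_x, e, map_smul, pow_succ]
        module
      | y =>
        simp only [regₗ_snoc_y, ih]
        push_cast
        module
  have h' : regₗ n ∘ₗ LinearMap.mulRight ℚ (yPow 1) = -(n : ℚ) • regₗ (n + 1) :=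
    hom_ext fun w => by simpa using h w n
  simpa using LinearMap.congr_fun h' a

theorem reg_mul_y (a : Sh) : reg (a * yPow 1) = 0 := by
  simpa [reg] using regₗ_mul_y 0 a

theorem reg_mul_yPow_succ (a : Sh) (n : ℕ) : reg (a * yPow (n + 1)) = 0 := by
  have h := reg_mul_y (a * yPow n)
  rw [mul_yPow_mul_y, map_smul] at h
  exact (smul_eq_zero.mp h).resolve_left (by positivity)

theorem snoc_iter_eq_sum (a : Sh) (n : ℕ) : (snoc .y)^[n] (snoc .x a) =
    ∑ p ∈ Finset.HasAntidiagonal.antidiagonal n, (-1 : ℚ) ^ p.1 • (snoc .x (a * yPow p.1) * yPow p.2) := by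
  induction n generalizing a with
  | zero => simp
  | succ n ih =>
    have h1 := snoc_iter_mul_y (snoc .x a) n
    have h2 : (snoc .y)^[n] (snoc .x a * yPow 1) = (snoc .y)^[n] (snoc .x (a * yPow 1)) +
        (snoc .y)^[n + 1] (snoc .x a) := by
      have e : ∀ m (b c : Sh), (snoc .y)^[m] (b + c) = (snoc .y)^[m] b + (snoc .y)^[m] c := by
        intro m b c
        induction m with
        | zero => rfl
        | succ m ihm => simp only [Function.iterate_succ_apply', ihm, map_add]
      rw [snoc_mul_y, e, ← Function.iterate_succ_apply]
    rw [h2, ih, ih, Finset.sum_mul] at h1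
    set T := (snoc .y)^[n + 1] (snoc .x a)
    set g : ℕ × ℕ → Sh := fun p => (-1 : ℚ) ^ p.1 • (snoc .x (a * yPow p.1) * yPow p.2) with hg
    have e1 : ∑ p ∈ Finset.HasAntidiagonal.antidiagonal (n + 1), (p.2 : ℚ) • g p =
        ∑ p ∈ Finset.HasAntidiagonal.antidiagonal n,
          (-1 : ℚ) ^ p.1 • (snoc .x (a * yPow p.1) * yPow p.2) * yPow 1 := by
      rw [Finset.Nat.sum_antidiagonal_succ']
      simp only [Nat.cast_zero, zero_smul, zero_add, hg]
      refine Finset.sum_congr rfl fun p _ => ?_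
      rw [smul_mul_assoc, mul_yPow_mul_y]
      push_cast
      module
    have e2 : ∑ p ∈ Finset.HasAntidiagonal.antidiagonal (n + 1), (p.1 : ℚ) • g p =
        - ∑ p ∈ Finset.HasAntidiagonal.antidiagonal n,
          (-1 : ℚ) ^ p.1 • (snoc .x (a * yPow 1 * yPow p.1) * yPow p.2) := by
      rw [Finset.Nat.sum_antidiagonal_succ]
      simp only [Nat.cast_zero, zero_smul, zero_add, hg, ← Finset.sum_neg_distrib]
      refine Finset.sum_congr rfl fun p _ => ?_
      rw [mul_right_comm, mul_yPow_mul_y, map_smul, smul_mul_assoc, pow_succ]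
      push_cast
      module
    have e3 : ((n : ℚ) + 1) • ∑ p ∈ Finset.HasAntidiagonal.antidiagonal (n + 1), g p =
        ∑ p ∈ Finset.HasAntidiagonal.antidiagonal (n + 1), (p.2 : ℚ) • g p +
          ∑ p ∈ Finset.HasAntidiagonal.antidiagonal (n + 1), (p.1 : ℚ) • g p := by
      rw [Finset.smul_sum, ← Finset.sum_add_distrib]
      refine Finset.sum_congr rfl fun p hp => ?_
      rw [← add_smul]
      have := Finset.HasAntidiagonal.mem_antidiagonal.mp hp
      congr 1
      rw [add_comm (p.2 : ℚ)]
      exact_mod_cast this.symm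
    rw [e1, e2, h1] at e3
    have h3 : ((n : ℚ) + 1) ≠ 0 := by positivity
    apply smul_right_injective _ h3
    simp only
    rw [e3]
    module

/-- Every word is a polynomial in `y` with coefficients that end in `x`. -/
theorem eq_sum_reg (w : List XY) (L : ℕ) (hL : w.length < L) :
    of w = ∑ j ∈ Finset.range L, reg (strip^[j] (of w)) * yPow j := by
  have hs : ∀ n (a : Sh), strip ((snoc .y)^[n + 1] a) = (snoc .y)^[n] a := fun n a => by
    rw [Function.iterate_succ_apply', strip_snoc, isY, one_smul]
  have hr : ∀ n m (a : Sh), regₗ m ((snoc .y)^[n] a) = regₗ (m + n) a := by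
    intro n
    induction n with
    | zero => intro m a; rfl
    | succ n ih =>
      intro m a
      rw [Function.iterate_succ_apply', regₗ_snoc_y, ih, show m + 1 + n = m + (n + 1) by ring]
  have hd : ∀ j n (a : Sh), strip^[j] ((snoc .y)^[j + n] a) = (snoc .y)^[n] a := by
    intro j
    induction j with
    | zero => intro n a; simp
    | succ j ih =>
      intro n a
      rw [Function.iterate_succ_apply, show j + 1 + n = j + n + 1 by ring, hs, ih]
  have hz : ∀ j, strip^[j] (0 : Sh) = 0 := fun j => by
    induction j with
    | zero => rfl
    | succ j ih => rw [Function.iterate_succ_apply', ih, map_zero]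
  have key : ∀ n (a : Sh), strip a = 0 → n < L →
      ∑ j ∈ Finset.range L, reg (strip^[j] ((snoc .y)^[n] a)) * yPow j =
        ∑ p ∈ Finset.HasAntidiagonal.antidiagonal n, regₗ p.1 a * yPow p.2 := by
    intro n a ha hn
    rw [← Finset.Nat.sum_antidiagonal_swap, Finset.Nat.sum_antidiagonal_eq_sum_range_succ_mk]
    simp only [Prod.swap_prod_mk]
    symm
    refine Finset.sum_subset_zero_on_sdiff (fun j hj => ?_) (fun j hj => ?_) (fun j hj => ?_)
    · rw [Finset.mem_range] at hj ⊢; omega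
    · rw [Finset.mem_sdiff, Finset.mem_range, Finset.mem_range] at hj
      obtain ⟨i, rfl⟩ : ∃ i, j = i + 1 + n := ⟨j - n - 1, by omega⟩
      have e := hd n 0 a
      rw [add_zero] at e
      rw [Function.iterate_add_apply, e, Function.iterate_succ_apply, Function.iterate_zero, id, ha,
        hz, map_zero, zero_mul]
    · rw [Finset.mem_range] at hj
      obtain ⟨i, rfl⟩ : ∃ i, n = j + i := ⟨n - j, by omega⟩
      rw [hd, reg, hr, Nat.zero_add, Nat.add_sub_cancel_left]
  have hw : ∀ w : List XY, (∃ n ≤ w.length, of w = (snoc .y)^[n] 1) ∨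
      ∃ n ≤ w.length, ∃ v, of w = (snoc .y)^[n] (snoc .x (of v)) := by
    intro w
    induction w with
    | nil => exact Or.inl ⟨0, le_rfl, rfl⟩
    | cons l w ih =>
      cases l with
      | x => exact Or.inr ⟨0, Nat.zero_le _, w, by simp⟩
      | y =>
        rcases ih with ⟨n, hn, h⟩ | ⟨n, hn, v, h⟩
        · exact Or.inl ⟨n + 1, by simpa using hn, by
            rw [Function.iterate_succ_apply', ← h, snoc_of]⟩
        · exact Or.inr ⟨n + 1, by simpa using hn, v, by
            rw [Function.iterate_succ_apply', ← h, snoc_of]⟩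
  rcases hw w with ⟨n, hn, h⟩ | ⟨n, hn, v, h⟩
  · rw [h, key n 1 strip_one (by omega), Finset.Nat.sum_antidiagonal_eq_sum_range_succ_mk,
      Finset.sum_range_succ']
    simp only [regₗ_succ_one, zero_mul, Finset.sum_const_zero,
      zero_add, regₗ_zero_one, one_mul, Nat.sub_zero]
    clear hn h
    induction n with
    | zero => rfl
    | succ n ih => rw [Function.iterate_succ_apply', ih, yPow_succ]
  · rw [h, key n _ (by rw [strip_snoc, isY, zero_smul]) (by omega), snoc_iter_eq_sum]
    simp only [regₗ_snoc_x, smul_mul_assoc]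

/-- The span of `1` and of the words ending in `x`. -/
def endsX : Submodule ℚ Sh := Submodule.span ℚ {1} ⊔ LinearMap.range (snoc .x)

theorem one_mem_endsX : (1 : Sh) ∈ endsX :=
  Submodule.mem_sup_left (Submodule.mem_span_singleton_self _)

theorem snoc_x_mem_endsX (a : Sh) : snoc .x a ∈ endsX := Submodule.mem_sup_right ⟨a, rfl⟩

theorem mem_endsX_iff {a : Sh} : a ∈ endsX ↔ ∃ (r : ℚ) (b : Sh), a = r • 1 + snoc .x b := by
  rw [endsX, Submodule.mem_sup]
  constructor
  · rintro ⟨y, hy, z, ⟨b, rfl⟩, rfl⟩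
    obtain ⟨r, rfl⟩ := Submodule.mem_span_singleton.mp hy
    exact ⟨r, b, rfl⟩
  · rintro ⟨r, b, rfl⟩
    exact ⟨r • 1, Submodule.mem_span_singleton.mpr ⟨r, rfl⟩, _, ⟨b, rfl⟩, rfl⟩

theorem mul_mem_endsX {a b : Sh} (ha : a ∈ endsX) (hb : b ∈ endsX) : a * b ∈ endsX := by
  obtain ⟨r, a, rfl⟩ := mem_endsX_iff.mp ha
  obtain ⟨r', b, rfl⟩ := mem_endsX_iff.mp hb
  rw [mem_endsX_iff]
  refine ⟨r * r', r • b + r' • a + (a * snoc .x b + snoc .x a * b), ?_⟩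
  simp only [add_mul, mul_add, snoc_mul_snoc, smul_mul_assoc, mul_smul_comm, one_mul, mul_one,
    map_add, map_smul, smul_add, smul_smul, mul_comm r']
  abel

theorem reg_of_mem_endsX {a : Sh} (ha : a ∈ endsX) : reg a = a := by
  obtain ⟨r, a, rfl⟩ := mem_endsX_iff.mp ha
  simp [reg, regₗ_zero_one, regₗ_snoc_x]

theorem reg_mem_endsX (a : Sh) : reg a ∈ endsX := by
  have h : ∀ w n, regWord n w ∈ endsX := by
    intro w
    induction w with
    | nil =>
      intro n
      cases n with
      | zero => exact one_mem_endsX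
      | succ n => exact zero_mem _
    | cons l w ih =>
      intro n
      cases l with
      | x => rw [regWord]; exact endsX.smul_mem _ (snoc_x_mem_endsX _)
      | y => rw [regWord]; exact ih _
  induction a using Sh.induction with
  | h0 => simp
  | hadd a b ha hb => rw [map_add]; exact add_mem ha hb
  | h r w =>
    rw [map_smul, reg, regₗ, lift_of]
    exact endsX.smul_mem _ (h w 0)

theorem reg_mul (a b : Sh) : reg (a * b) = reg a * reg b := by
  have key : ∀ h ∈ endsX, ∀ h' ∈ endsX, ∀ n m,
      reg (h * yPow n * (h' * yPow m)) = reg (h * yPow n) * reg (h' * yPow m) := by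
    intro h hh h' hh' n m
    cases n with
    | succ n =>
      rw [show h * yPow (n + 1) * (h' * yPow m) = (h * (h' * yPow m)) * yPow (n + 1) by ring,
        reg_mul_yPow_succ, reg_mul_yPow_succ, zero_mul]
    | zero =>
      cases m with
      | succ m =>
        rw [← mul_assoc, reg_mul_yPow_succ, reg_mul_yPow_succ, mul_zero]
      | zero =>
        simp only [yPow_zero, mul_one]
        rw [reg_of_mem_endsX hh, reg_of_mem_endsX hh', reg_of_mem_endsX (mul_mem_endsX hh hh')]
  have h : ∀ v w, reg (of v * of w) = reg (of v) * reg (of w) := by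
    intro v w
    rw [eq_sum_reg v _ (Nat.lt_succ_self _), eq_sum_reg w _ (Nat.lt_succ_self _),
      Finset.sum_mul_sum, map_sum, map_sum, map_sum, Finset.sum_mul_sum]
    refine Finset.sum_congr rfl fun i _ => ?_
    rw [map_sum]
    exact Finset.sum_congr rfl fun j _ => key _ (reg_mem_endsX _) _ (reg_mem_endsX _) i j
  have h' : (LinearMap.mul ℚ Sh).compr₂ reg = (LinearMap.mul ℚ Sh).compl₁₂ reg reg :=
    hom_ext₂ fun v w => by simpa using h v w
  simpa using LinearMap.congr_fun₂ h' a b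

/-! ### Words that begin with the letter `y` -/

/-- The span of the non-empty words that begin with `y`. -/
def startsY : Submodule ℚ Sh := Submodule.span ℚ (of '' {w | w.getLast? = some XY.y})

/-- The span of the empty word and of the words that begin with `y`. -/
def H1 : Submodule ℚ Sh := Submodule.span ℚ {1} ⊔ startsY

theorem of_mem_startsY {w : List XY} (h : w.getLast? = some XY.y) : of w ∈ startsY :=
  Submodule.subset_span ⟨w, h, rfl⟩

theorem snoc_mem_startsY (l : XY) {a : Sh} (ha : a ∈ startsY) : snoc l a ∈ startsY := by
  induction ha using Submodule.span_induction with
  | mem a h =>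
    obtain ⟨w, hw, rfl⟩ := h
    rw [snoc_of]
    refine of_mem_startsY ?_
    cases w with
    | nil => simp at hw
    | cons l' w => simpa using hw
  | zero => simp
  | add a b _ _ ha hb => rw [map_add]; exact add_mem ha hb
  | smul r a _ ha => rw [map_smul]; exact startsY.smul_mem r ha

theorem one_mem_H1 : (1 : Sh) ∈ H1 :=
  Submodule.mem_sup_left (Submodule.mem_span_singleton_self _)

theorem startsY_le_H1 : startsY ≤ H1 := le_sup_right

theorem snoc_y_mem_startsY {a : Sh} (ha : a ∈ H1) : snoc .y a ∈ startsY := by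
  obtain ⟨b, hb, c, hc, rfl⟩ := Submodule.mem_sup.mp ha
  obtain ⟨r, rfl⟩ := Submodule.mem_span_singleton.mp hb
  rw [map_add, map_smul]
  exact add_mem (startsY.smul_mem r (Submodule.subset_span ⟨[.y], rfl, by rw [← snoc_of]; rfl⟩)) (snoc_mem_startsY _ hc)

theorem shuffle_mem_startsY : ∀ v w : List XY, (v = [] ∨ v.getLast? = some XY.y) →
    (w = [] ∨ w.getLast? = some XY.y) → (v ≠ [] ∨ w ≠ []) → shuffle v w ∈ startsY
  | [], w, _, hw, h => by
    rw [shuffle]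
    exact of_mem_startsY (hw.resolve_left (h.resolve_left (fun h => h rfl)))
  | l :: v, [], hv, _, _ => by
    rw [shuffle]
    exact of_mem_startsY (hv.resolve_left (by simp))
  | l :: v, l' :: w, hv, hw, _ => by
    rw [shuffle]
    have h : ∀ l (v : List XY), (l :: v = [] ∨ (l :: v).getLast? = some XY.y) →
        (v = [] ∨ v.getLast? = some XY.y) := by
      intro l v hv
      cases v with
      | nil => exact Or.inl rfl
      | cons l' v => simpa using hv
    exact add_mem
      (snoc_mem_startsY _ (shuffle_mem_startsY v (l' :: w) (h l v hv) hw (Or.inr (by simp))))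
      (snoc_mem_startsY _ (shuffle_mem_startsY (l :: v) w hv (h l' w hw) (Or.inl (by simp))))
termination_by v w => v.length + w.length

theorem mul_mem_startsY {a b : Sh} (ha : a ∈ startsY) (hb : b ∈ H1) : a * b ∈ startsY := by
  obtain ⟨b₀, hb₀, b, hb', rfl⟩ := Submodule.mem_sup.mp hb
  obtain ⟨r, rfl⟩ := Submodule.mem_span_singleton.mp hb₀
  rw [mul_add, mul_smul_comm, mul_one]
  refine add_mem (startsY.smul_mem r ha) ?_
  induction ha using Submodule.span_induction with
  | mem a h =>
    obtain ⟨v, hv, rfl⟩ := h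
    clear hb
    induction hb' using Submodule.span_induction with
    | mem b h =>
      obtain ⟨w, hw, rfl⟩ := h
      rw [of_mul_of]
      exact shuffle_mem_startsY v w (Or.inr hv) (Or.inr hw)
        (Or.inl (by rintro rfl; simp at hv))
    | zero => simp
    | add a b _ _ ha hb =>
      rw [mul_add]
      exact add_mem ha hb
    | smul r a _ ha => rw [mul_smul_comm]; exact startsY.smul_mem r ha
  | zero => simp
  | add a b _ _ ha hb => rw [add_mul]; exact add_mem ha hb
  | smul r a _ ha => rw [smul_mul_assoc]; exact startsY.smul_mem r ha

theorem mul_mem_H1 {a b : Sh} (ha : a ∈ H1) (hb : b ∈ H1) : a * b ∈ H1 := by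
  obtain ⟨a₀, ha₀, a, ha', rfl⟩ := Submodule.mem_sup.mp ha
  obtain ⟨r, rfl⟩ := Submodule.mem_span_singleton.mp ha₀
  rw [add_mul, smul_mul_assoc, one_mul]
  exact add_mem (H1.smul_mem r hb) (startsY_le_H1 (mul_mem_startsY ha' hb))

theorem yPow_mem_H1 (n : ℕ) : yPow n ∈ H1 := by
  induction n with
  | zero => exact one_mem_H1
  | succ n ih => rw [yPow_succ]; exact startsY_le_H1 (snoc_y_mem_startsY ih)

theorem of_mem_H1 {w : List XY} (h : w = [] ∨ w.getLast? = some XY.y) : of w ∈ H1 := by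
  rcases h with rfl | h
  · exact one_mem_H1
  · exact startsY_le_H1 (of_mem_startsY h)

/-- The span of the empty word and of the words that begin with `y` and end in `x`. -/
def H0 : Submodule ℚ Sh := Submodule.span ℚ {1} ⊔ startsY.map (snoc .x)

theorem H0_le_H1 : H0 ≤ H1 := by
  refine sup_le le_sup_left ?_
  rintro _ ⟨a, ha, rfl⟩
  exact startsY_le_H1 (snoc_mem_startsY _ ha)

theorem reg_mem_H0 {a : Sh} (ha : a ∈ H1) : reg a ∈ H0 := by
  have h1 : (1 : Sh) ∈ H0 := Submodule.mem_sup_left (Submodule.mem_span_singleton_self _)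
  have h : ∀ w n, (w = [] ∨ w.getLast? = some XY.y) → regWord n w ∈ H0 := by
    intro w
    induction w with
    | nil =>
      intro n _
      cases n with
      | zero => exact h1
      | succ n => exact zero_mem _
    | cons l w ih =>
      intro n hw
      cases l with
      | x =>
        rw [regWord]
        have hw' : w.getLast? = some XY.y := by
          cases w with
          | nil => simp at hw
          | cons l' w => simpa using hw
        exact H0.smul_mem _ (Submodule.mem_sup_right ⟨_,
          mul_mem_startsY (of_mem_startsY hw') (yPow_mem_H1 n), rfl⟩)
      | y =>
        rw [regWord]
        refine ih _ ?_
        cases w with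
        | nil => exact Or.inl rfl
        | cons l' w => simpa using hw
  obtain ⟨a₀, ha₀, a, ha', rfl⟩ := Submodule.mem_sup.mp ha
  obtain ⟨r, rfl⟩ := Submodule.mem_span_singleton.mp ha₀
  rw [map_add, map_smul]
  refine add_mem (H0.smul_mem r ?_) ?_
  · rw [reg, regₗ_zero_one]; exact h1
  · clear ha
    induction ha' using Submodule.span_induction with
    | mem a h' =>
      obtain ⟨w, hw, rfl⟩ := h'
      rw [reg, regₗ, lift_of]
      exact h w 0 (Or.inr hw)
    | zero => simp
    | add a b _ _ ha hb => rw [map_add]; exact add_mem ha hb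
    | smul r a _ ha => rw [map_smul]; exact H0.smul_mem r ha

end Sh

namespace Sh

/-! ### Generating series in the shuffle algebra -/

/-- The coefficientwise extension of `snoc l` to power series. -/
def snocS (l : XY) (F : PowerSeries Sh) : PowerSeries Sh :=
  PowerSeries.mk fun n => snoc l (PowerSeries.coeff n F)

@[simp] theorem coeff_snocS (l : XY) (F : PowerSeries Sh) (n : ℕ) :
    PowerSeries.coeff n (snocS l F) = snoc l (PowerSeries.coeff n F) := by simp [snocS]

theorem snocS_add (l : XY) (F G : PowerSeries Sh) : snocS l (F + G) = snocS l F + snocS l G := by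
  ext n; simp

theorem snocS_sub (l : XY) (F G : PowerSeries Sh) : snocS l (F - G) = snocS l F - snocS l G := by
  ext n; simp

theorem snocS_X_mul (l : XY) (F : PowerSeries Sh) :
    snocS l (PowerSeries.X * F) = PowerSeries.X * snocS l F := by
  ext n
  cases n with
  | zero => simp
  | succ n => simp [PowerSeries.coeff_succ_X_mul]

theorem snocS_mul_snocS (l l' : XY) (F G : PowerSeries Sh) :
    snocS l F * snocS l' G = snocS l (F * snocS l' G) + snocS l' (snocS l F * G) := by
  ext n
  simp only [PowerSeries.coeff_mul, coeff_snocS, map_add, map_sum, snoc_mul_snoc,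
    Finset.sum_add_distrib]

/-- The series `∑ (c t)^n F y^n`. -/
def geo (c : ℚ) (F : PowerSeries Sh) : PowerSeries Sh :=
  PowerSeries.mk fun n => ∑ p ∈ Finset.HasAntidiagonal.antidiagonal n,
    c ^ p.1 • (snoc .y)^[p.1] (PowerSeries.coeff p.2 F)

theorem coeff_geo (c : ℚ) (F : PowerSeries Sh) (n : ℕ) : PowerSeries.coeff n (geo c F) =
    ∑ p ∈ Finset.HasAntidiagonal.antidiagonal n,
      c ^ p.1 • (snoc .y)^[p.1] (PowerSeries.coeff p.2 F) := by simp [geo]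

theorem geo_eq (c : ℚ) (F : PowerSeries Sh) :
    geo c F = F + PowerSeries.X * c • snocS .y (geo c F) := by
  ext n
  cases n with
  | zero => simp [coeff_geo]
  | succ n =>
    rw [coeff_geo, Finset.Nat.sum_antidiagonal_succ, map_add, PowerSeries.coeff_succ_X_mul,
      PowerSeries.coeff_smul, coeff_snocS, coeff_geo, map_sum, Finset.smul_sum]
    simp only [pow_zero, one_smul, Function.iterate_zero, id, map_smul, smul_smul,
      Function.iterate_succ_apply', pow_succ']

theorem eq_geo {c : ℚ} {F G : PowerSeries Sh} (h : G = F + PowerSeries.X * c • snocS .y G) :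
    G = geo c F := by
  have h2 := geo_eq c F
  ext n
  induction n with
  | zero => rw [h, h2]; simp
  | succ n ih =>
    rw [h, h2]
    simp only [map_add, PowerSeries.coeff_succ_X_mul, PowerSeries.coeff_smul, coeff_snocS, ih]

/-- The series `∑ (-t)^n y^n`. -/
def ySeries : PowerSeries Sh := PowerSeries.mk fun n => (-1 : ℚ) ^ n • yPow n

theorem ySeries_eq : ySeries = 1 - PowerSeries.X * snocS .y ySeries := by
  ext n
  cases n with
  | zero => simp [ySeries]
  | succ n =>
    rw [map_sub, PowerSeries.coeff_succ_X_mul, PowerSeries.coeff_one]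
    simp [ySeries, yPow_succ, pow_succ]

theorem snocS_mul_ySeries (l : XY) (F : PowerSeries Sh) :
    snocS l F * ySeries = geo (-1) (snocS l (F * ySeries)) := by
  apply eq_geo
  have h := snocS_mul_snocS l .y F ySeries
  have h1 : snocS l (F * ySeries) = snocS l F - PowerSeries.X * snocS l (F * snocS .y ySeries) := by
    rw [← snocS_X_mul, ← snocS_sub]
    congr 1
    conv_lhs => rw [ySeries_eq]
    ring
  rw [h1]
  conv_lhs => rw [ySeries_eq]
  rw [neg_one_smul]
  linear_combination (-PowerSeries.X) * h

/-- The image of a word under the substitution `x ↦ (1 - t y)⁻¹ x`, `y ↦ y`. -/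
def insBeforeX : List XY → PowerSeries Sh
  | [] => 1
  | .y :: w => snocS .y (insBeforeX w)
  | .x :: w => snocS .x (geo 1 (insBeforeX w))

/-- The image of a word under the substitution `x ↦ x`, `y ↦ (1 + t y)⁻¹ y`. -/
def insBeforeY : List XY → PowerSeries Sh
  | [] => 1
  | .x :: w => snocS .x (insBeforeY w)
  | .y :: w => snocS .y (geo (-1) (insBeforeY w))

theorem insBeforeX_mul_ySeries (w : List XY) :
    insBeforeX w * ySeries = geo (-1) (insBeforeY w) := by
  induction w with
  | nil =>
    rw [insBeforeX, insBeforeY, one_mul]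
    apply eq_geo
    conv_lhs => rw [ySeries_eq]
    rw [neg_one_smul]
    ring
  | cons l w ih =>
    cases l with
    | y => rw [insBeforeX, snocS_mul_ySeries, ih, insBeforeY]
    | x =>
      rw [insBeforeX, snocS_mul_ySeries, insBeforeY]
      congr 2
      set G := insBeforeX w * ySeries with hG
      set b := geo 1 (insBeforeX w)
      have hN : insBeforeY w = G + PowerSeries.X * snocS .y G := by
        have := geo_eq (-1) (insBeforeY w)
        rw [← ih, neg_one_smul] at this
        linear_combination -this
      have hb : b = insBeforeX w + PowerSeries.X * snocS .y b := by
        simpa using geo_eq 1 (insBeforeX w)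
      have hbp : b * ySeries = G + PowerSeries.X * (snocS .y b * ySeries) := by
        conv_lhs => rw [hb]
        rw [hG]
        ring
      have h1 : snocS .y b * ySeries = snocS .y (b * ySeries) -
          PowerSeries.X * snocS .y (snocS .y b * ySeries) := by
        have := geo_eq (-1) (snocS .y (b * ySeries))
        rw [← snocS_mul_ySeries, neg_one_smul] at this
        linear_combination this
      have h2 : snocS .y (b * ySeries) = snocS .y G +
          PowerSeries.X * snocS .y (snocS .y b * ySeries) := by
        rw [← snocS_X_mul, ← snocS_add, ← hbp]
      rw [hN, hbp, h1, h2]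
      ring

/-- Comparison of the coefficients in `insBeforeX_mul_ySeries`. -/
theorem sum_insBeforeX_mul_yPow (w : List XY) (m : ℕ) :
    ∑ p ∈ Finset.HasAntidiagonal.antidiagonal m,
      (-1 : ℚ) ^ p.2 • (PowerSeries.coeff p.1 (insBeforeX w) * yPow p.2) =
    PowerSeries.coeff m (geo (-1) (insBeforeY w)) := by
  rw [← insBeforeX_mul_ySeries, PowerSeries.coeff_mul]
  simp [ySeries]

theorem coeff_insBeforeX_mem_H1 (w : List XY) (hw : w = [] ∨ w.getLast? = some XY.y) (n : ℕ) :
    PowerSeries.coeff n (insBeforeX w) ∈ H1 := by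
  have key : ∀ w : List XY, w.getLast? = some XY.y → ∀ n,
      PowerSeries.coeff n (insBeforeX w) ∈ startsY := by
    intro w
    induction w with
    | nil => simp
    | cons l w ih =>
      intro hw n
      cases w with
      | nil =>
        obtain rfl : l = .y := by simpa using hw
        rw [insBeforeX, coeff_snocS, insBeforeX, PowerSeries.coeff_one]
        split_ifs
        · exact snoc_y_mem_startsY one_mem_H1
        · simp
      | cons l' w =>
        have hi := ih (by simpa using hw)
        cases l with
        | y => rw [insBeforeX, coeff_snocS]; exact snoc_mem_startsY _ (hi n)
        | x =>
          rw [insBeforeX, coeff_snocS, coeff_geo]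
          refine snoc_mem_startsY _ (sum_mem fun p _ => startsY.smul_mem _ ?_)
          induction p.1 with
          | zero => exact hi _
          | succ k ihk => rw [Function.iterate_succ_apply']; exact snoc_mem_startsY _ ihk
  rcases hw with rfl | hw
  · rw [insBeforeX, PowerSeries.coeff_one]
    split_ifs
    · exact one_mem_H1
    · simp
  · exact startsY_le_H1 (key w hw n)

end Sh

/-! ### Evaluation of `𝒞⟨A⟩` -/

theorem CA_induction {P : CA → Prop} (v : CA) (h0 : P 0) (hadd : ∀ a b, P a → P b → P (a + b))
    (h : ∀ (r : 𝒞) w, P (r • word w)) : P v := by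
  refine MonoidAlgebra.induction_linear v h0 hadd fun w r => ?_
  have := h r (FreeMonoid.toList w)
  rwa [word, MonoidAlgebra.of_apply, MonoidAlgebra.smul_single, smul_eq_mul, mul_one,
    FreeMonoid.ofList_toList] at this

theorem CA_hom_ext {M : Type*} [AddCommMonoid M] [Module 𝒞 M] {f g : CA →ₗ[𝒞] M}
    (h : ∀ w, f (word w) = g (word w)) : f = g := by
  refine LinearMap.ext fun v => ?_
  induction v using CA_induction with
  | h0 => simp
  | hadd a b ha hb => simp [ha, hb]
  | h r w => simp [h]

/-- The additive map on `𝒞⟨A⟩` with prescribed values on monomials, where `ħ` acts on `ℂ` as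
`1 - q`. -/
def evalW (q : ℂ) (g : List Letter → ℂ) : CA →ₗ[ℚ] ℂ :=
  (Finsupp.lsum ℚ fun w : FreeMonoid Letter =>
    LinearMap.mulRight ℚ (g (FreeMonoid.toList w)) ∘ₗ
      (Polynomial.aeval (R := ℚ) (1 - q)).toLinearMap) ∘ₗ
    ((MonoidAlgebra.coeffLinearEquiv 𝒞).toLinearMap.restrictScalars ℚ)

theorem Zq_eq (q : ℂ) : Zq q = evalW q (ZqWord q) := rfl

theorem evalW_smul_word (q : ℂ) (g : List Letter → ℂ) (c : 𝒞) (w : List Letter) :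
    evalW q g (c • word w) = aeval (1 - q) c * g w := by
  simp [evalW, word]

@[simp] theorem evalW_word (q : ℂ) (g : List Letter → ℂ) (w : List Letter) :
    evalW q g (word w) = g w := by
  simpa using evalW_smul_word q g 1 w

theorem evalW_smul (q : ℂ) (g : List Letter → ℂ) (c : 𝒞) (v : CA) :
    evalW q g (c • v) = aeval (1 - q) c * evalW q g v := by
  induction v using CA_induction with
  | h0 => simp
  | hadd a b ha hb => rw [smul_add, map_add, map_add, ha, hb, mul_add]
  | h r w => rw [smul_smul, evalW_smul_word, evalW_smul_word, map_mul, mul_assoc]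

theorem mul_word_mem_endsInG {n : ℕ} (v : CA) {k : ℕ+} (hk : n ≤ (k : ℕ)) :
    v * word [.g k] ∈ endsInG n := Submodule.subset_span ⟨v, k, hk, rfl⟩

theorem word_mem_endsInG {n : ℕ} (w : List Letter) {k : ℕ+} (hk : n ≤ (k : ℕ)) :
    word (w ++ [.g k]) ∈ endsInG n := by
  rw [word_append]; exact mul_word_mem_endsInG _ hk

theorem endsInG_eq_span (n : ℕ) : endsInG n =
    Submodule.span 𝒞 {v | ∃ w, ∃ k : ℕ+, n ≤ (k : ℕ) ∧ v = word (w ++ [.g k])} := by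
  refine le_antisymm (Submodule.span_le.mpr ?_) (Submodule.span_le.mpr ?_)
  · rintro _ ⟨w, k, hk, rfl⟩
    rw [SetLike.mem_coe]
    induction w using CA_induction with
    | h0 => simp
    | hadd a b ha hb => rw [add_mul]; exact add_mem ha hb
    | h r w =>
      rw [smul_mul_assoc, ← word_append]
      exact Submodule.smul_mem _ r (Submodule.subset_span ⟨w, k, hk, rfl⟩)
  · rintro _ ⟨w, k, hk, rfl⟩
    exact word_mem_endsInG w hk

theorem endsInG_induction {n : ℕ} {P : CA → Prop} (h0 : P 0)
    (hadd : ∀ a b, P a → P b → P (a + b)) (hsmul : ∀ (r : 𝒞) a, P a → P (r • a))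
    (h : ∀ w (k : ℕ+), n ≤ (k : ℕ) → P (word (w ++ [.g k]))) {v : CA} (hv : v ∈ endsInG n) :
    P v := by
  rw [endsInG_eq_span] at hv
  induction hv using Submodule.span_induction with
  | mem v hv =>
    obtain ⟨w, k, hk, rfl⟩ := hv
    exact h w k hk
  | zero => exact h0
  | add a b _ _ ha hb => exact hadd a b ha hb
  | smul r a _ ha => exact hsmul r a ha

theorem word_nil : word [] = 1 := by simp [word, MonoidAlgebra.one_def]

theorem hatH0_induction {P : CA → Prop} (h0 : P 0)
    (hadd : ∀ a b, P a → P b → P (a + b)) (hsmul : ∀ (r : 𝒞) a, P a → P (r • a))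
    (h1 : P (word [])) (h : ∀ w (k : ℕ+), P (word (w ++ [.g k]))) {v : CA} (hv : v ∈ hatH0) :
    P v := by
  obtain ⟨a, ha, b, hb, rfl⟩ := Submodule.mem_sup.mp hv
  refine hadd _ _ ?_ (endsInG_induction h0 hadd hsmul (fun w k _ => h w k) hb)
  obtain ⟨r, rfl⟩ := Submodule.mem_one.mp ha
  rw [Algebra.algebraMap_eq_smul_one, ← word_nil]
  exact hsmul _ _ h1

theorem one_mem_hatH0 : (1 : CA) ∈ hatH0 := Submodule.mem_sup_left (Submodule.one_le.mp le_rfl)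

theorem endsInG_le_hatH0 : endsInG 1 ≤ hatH0 := le_sup_right

/-- Right multiplication by the letter `g_1`. -/
def opY : CA →ₗ[𝒞] CA := LinearMap.mulRight 𝒞 (word [.g 1])

/-- Right multiplication by the letter `ħb`. -/
def opC : CA →ₗ[𝒞] CA := LinearMap.mulRight 𝒞 (word [.c])

/-- The map `w g_k ↦ w g_{k+1}`. -/
def opX : CA →ₗ[𝒞] CA := onWords fun w => match w.reverse with
  | .g k :: w' => word (w'.reverse ++ [.g (k + 1)])
  | _ => 0

theorem opY_word (w : List Letter) : opY (word w) = word (w ++ [.g 1]) := by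
  simp [opY, word_append]

theorem opC_word (w : List Letter) : opC (word w) = word (w ++ [.c]) := by
  simp [opC, word_append]

theorem opX_word (w : List Letter) (k : ℕ+) :
    opX (word (w ++ [.g k])) = word (w ++ [.g (k + 1)]) := by
  simp [opX, onWords_word]

theorem opX_one : opX 1 = 0 := by
  rw [← word_nil, opX, onWords_word]; rfl

theorem opY_mem_endsInG (v : CA) : opY v ∈ endsInG 1 := mul_word_mem_endsInG _ le_rfl

theorem opX_mem_endsInG {v : CA} (hv : v ∈ endsInG 1) : opX v ∈ endsInG 2 := by
  refine endsInG_induction (P := fun v => opX v ∈ endsInG 2) ?_ ?_ ?_ ?_ hv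
  · simp
  · intro a b ha hb
    rw [map_add]; exact add_mem ha hb
  · intro r a ha
    rw [map_smul]; exact Submodule.smul_mem _ r ha
  · intro w k hk
    rw [opX_word]
    exact word_mem_endsInG w (by rw [PNat.add_coe, PNat.one_coe]; omega)

theorem endsInG_mono {m n : ℕ} (h : m ≤ n) : endsInG n ≤ endsInG m :=
  Submodule.span_mono fun _ ⟨w, k, hk, e⟩ => ⟨w, k, h.trans hk, e⟩

theorem opX_mem_endsInG_of_mem_hatH0 {v : CA} (hv : v ∈ hatH0) : opX v ∈ endsInG 1 := by
  obtain ⟨a, ha, b, hb, rfl⟩ := Submodule.mem_sup.mp hv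
  obtain ⟨r, rfl⟩ := Submodule.mem_one.mp ha
  rw [Algebra.algebraMap_eq_smul_one, map_add, map_smul, opX_one, smul_zero, zero_add]
  exact endsInG_mono one_le_two (opX_mem_endsInG hb)

/-! ### The dual generating functions -/

section analysis

variable {q : ℂ}

theorem one_sub_pow_ne_zero (hq : ‖q‖ < 1) (m : ℕ) : 1 - q ^ (m + 1) ≠ 0 := by
  intro h
  have h1 : ‖q ^ (m + 1)‖ = 1 := by rw [← sub_eq_zero.mp h, norm_one]
  rw [norm_pow] at h1
  exact (pow_lt_one₀ (norm_nonneg q) hq (Nat.succ_ne_zero m)).ne h1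

theorem one_sub_ne_zero (hq : ‖q‖ < 1) : 1 - q ≠ 0 := by
  simpa using one_sub_pow_ne_zero hq 0

theorem truncRev_cons_succ (q : ℂ) (u : Letter) (w : List Letter) (M : ℕ) :
    truncRev q (u :: w) (M + 1) =
      ∑ m ∈ Finset.range M, truncRev q w (m + 1) * F q (m + 1) u := by
  rw [truncRev, ← Finset.sum_image (f := fun m => truncRev q w m * F q m u)
    (g := fun m => m + 1) (by intro a _ b _ h; simpa using h)]
  refine Finset.sum_congr ?_ fun _ _ => rfl
  ext m
  simp only [Finset.mem_Ioo, Finset.mem_image, Finset.mem_range]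
  constructor
  · rintro ⟨h1, h2⟩
    exact ⟨m - 1, by omega, by omega⟩
  · rintro ⟨a, ha, rfl⟩
    omega

/-- The function `j ↦ ∑ q^{j m_r} ∏ F_q(m_i; u_i)`; the word is read from right to left. -/
def dualFun (q : ℂ) : List Letter → ℕ → ℂ
  | [], _ => 1
  | u :: w, j => ∑' m : ℕ, truncRev q w (m + 1) * F q (m + 1) u * q ^ (j * (m + 1))

theorem summable_norm_dualFun (hq : ‖q‖ < 1) (w : List Letter) (u : Letter) (j : ℕ)
    (h : u ≠ .c ∨ 1 ≤ j) :
    Summable fun m : ℕ => ‖truncRev q w (m + 1) * F q (m + 1) u * q ^ (j * (m + 1))‖ := by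
  obtain ⟨B, hB, hT⟩ := norm_truncRev_le q hq w
  obtain ⟨C, hC, hF⟩ : ∃ C : ℝ, 0 ≤ C ∧ ∀ m : ℕ,
      ‖F q (m + 1) u * q ^ (j * (m + 1))‖ ≤ C * ‖q‖ ^ (m + 1) := by
    have h1 : 0 < 1 - ‖q‖ := by linarith
    cases u with
    | c =>
      refine ⟨‖1 - q‖, norm_nonneg _, fun m => ?_⟩
      rw [norm_mul, F, norm_pow]
      gcongr 1
      exact pow_le_pow_of_le_one (norm_nonneg _) hq.le
        (Nat.le_mul_of_pos_left _ (h.resolve_left (by simp)))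
    | g k =>
      refine ⟨(‖1 - q‖ / (1 - ‖q‖)) ^ (k : ℕ), by positivity, fun m => ?_⟩
      rw [norm_mul]
      refine (mul_le_of_le_one_right (norm_nonneg _) ?_).trans
        (norm_F_g_le q hq k (m + 1) (Nat.succ_pos m))
      rw [norm_pow]
      exact pow_le_one₀ (norm_nonneg _) hq.le
  have h0 := ((summable_nat_add_iff 1).mpr
    (summable_norm_pow_mul_geometric_of_norm_lt_one w.length hq)).mul_left (B * C)
  refine Summable.of_nonneg_of_le (fun m => norm_nonneg _) (fun m => ?_) h0
  rw [mul_assoc, norm_mul]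
  calc ‖truncRev q w (m + 1)‖ * ‖F q (m + 1) u * q ^ (j * (m + 1))‖
      ≤ (B * ((m + 1 : ℕ) : ℝ) ^ w.length) * (C * ‖q‖ ^ (m + 1)) :=
        mul_le_mul (hT _) (hF m) (norm_nonneg _) (by positivity)
    _ = _ := by
      rw [norm_mul, norm_pow, norm_pow, Complex.norm_natCast]
      ring

theorem summable_dualFun (hq : ‖q‖ < 1) (w : List Letter) (u : Letter) (j : ℕ)
    (h : u ≠ .c ∨ 1 ≤ j) :
    Summable fun m : ℕ => truncRev q w (m + 1) * F q (m + 1) u * q ^ (j * (m + 1)) :=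
  (summable_norm_dualFun hq w u j h).of_norm

theorem tendsto_truncRev (hq : ‖q‖ < 1) (w : List Letter) (k : ℕ+) :
    Tendsto (truncRev q (.g k :: w)) atTop (nhds (dualFun q (.g k :: w) 0)) := by
  rw [← tendsto_add_atTop_iff_nat 1]
  have h := (summable_dualFun hq w (.g k) 0 (Or.inl (by simp))).hasSum.tendsto_sum_nat
  refine h.congr fun M => ?_
  rw [truncRev_cons_succ]
  simp

theorem ZqWord_eq (hq : ‖q‖ < 1) (w : List Letter) (k : ℕ+) :
    ZqWord q (w ++ [.g k]) = dualFun q (.g k :: w.reverse) 0 := by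
  rw [ZqWord, List.reverse_append]
  exact (tendsto_truncRev hq w.reverse k).limUnder_eq

theorem dualFun_g_succ (hq : ‖q‖ < 1) (w : List Letter) (k : ℕ+) (j : ℕ) :
    dualFun q (.g (k + 1) :: w) j - dualFun q (.g (k + 1) :: w) (j + 1) =
      (1 - q) * dualFun q (.g k :: w) (j + 1) := by
  rw [dualFun, dualFun, dualFun,
    ← (summable_dualFun hq w (.g (k + 1)) j (Or.inl (by simp))).tsum_sub
      (summable_dualFun hq w (.g (k + 1)) (j + 1) (Or.inl (by simp))), ← tsum_mul_left]
  refine tsum_congr fun m => ?_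
  have h1 := one_sub_pow_ne_zero hq m
  have h2 := one_sub_ne_zero hq
  have h3 : F q (m + 1) (.g (k + 1)) =
      F q (m + 1) (.g k) * (q ^ (m + 1) * (1 - q) / (1 - q ^ (m + 1))) := by
    simp only [F, PNat.add_coe, PNat.one_coe]
    rw [add_mul, pow_add, pow_succ (qInt q (m + 1)), mul_div_mul_comm, one_mul]
    congr 1
    rw [qInt, div_div_eq_mul_div]
  rw [h3]
  field_simp
  ring

theorem dualFun_nil_sum (hq : ‖q‖ < 1) (w : List Letter) (i : ℕ) :
    (1 - q ^ (i + 1)) * ∑' m : ℕ, truncRev q w (m + 1) * q ^ ((i + 1) * (m + 1)) =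
      q ^ (i + 1) * dualFun q w (i + 1) := by
  have hz : ‖q ^ (i + 1)‖ < 1 := by
    rw [norm_pow]; exact pow_lt_one₀ (norm_nonneg q) hq (Nat.succ_ne_zero i)
  have hs : Summable fun m : ℕ => truncRev q w (m + 1) * q ^ ((i + 1) * (m + 1)) := by
    have := (summable_dualFun hq w .c (i + 1) (Or.inr (by omega))).mul_left (1 - q)⁻¹
    refine this.congr fun m => ?_
    have h2 := one_sub_ne_zero hq
    simp only [F]
    field_simp
  cases w with
  | nil =>
    have h1 := one_sub_pow_ne_zero hq i
    have h2 : ∀ m : ℕ, truncRev q [] (m + 1) * q ^ ((i + 1) * (m + 1)) =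
        q ^ (i + 1) * (q ^ (i + 1)) ^ m := by
      intro m
      rw [truncRev, one_mul, pow_mul, pow_succ' (q ^ (i + 1))]
    rw [tsum_congr h2, tsum_mul_left, tsum_geometric_of_norm_lt_one hz, dualFun]
    field_simp
  | cons u w =>
    have e : ∀ m : ℕ, truncRev q (u :: w) (m + 1 + 1) * q ^ ((i + 1) * (m + 1 + 1)) =
        q ^ (i + 1) * (truncRev q (u :: w) (m + 1) * q ^ ((i + 1) * (m + 1)) +
          truncRev q w (m + 1) * F q (m + 1) u * q ^ ((i + 1) * (m + 1))) := by
      intro m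
      rw [truncRev_cons_succ, Finset.sum_range_succ, ← truncRev_cons_succ, mul_add (i + 1) (m + 1),
        pow_add, mul_one]
      ring
    have h0 : truncRev q (u :: w) (0 + 1) = 0 := by rw [truncRev_cons_succ]; simp
    have h1 := hs.tsum_eq_zero_add
    rw [h0, zero_mul, zero_add, tsum_congr e, tsum_mul_left,
      hs.tsum_add (summable_dualFun hq w u (i + 1) (Or.inr (by omega)))] at h1
    rw [dualFun]
    linear_combination h1

theorem dualFun_g_one (hq : ‖q‖ < 1) (w : List Letter) (j : ℕ) :
    dualFun q (.g 1 :: w) j - dualFun q (.g 1 :: w) (j + 1) =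
      F q (j + 1) (.g 1) * dualFun q w (j + 1) := by
  have h1 := one_sub_pow_ne_zero hq j
  have h2 := one_sub_ne_zero hq
  have h3 : dualFun q (.g 1 :: w) j - dualFun q (.g 1 :: w) (j + 1) =
      (1 - q) * ∑' m : ℕ, truncRev q w (m + 1) * q ^ ((j + 1) * (m + 1)) := by
    rw [dualFun, dualFun,
      ← (summable_dualFun hq w (.g 1) j (Or.inl (by simp))).tsum_sub
        (summable_dualFun hq w (.g 1) (j + 1) (Or.inl (by simp))), ← tsum_mul_left]
    refine tsum_congr fun m => ?_
    have h1 := one_sub_pow_ne_zero hq m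
    simp only [F, qInt, PNat.one_coe]
    field_simp
    ring
  rw [h3]
  have h4 := dualFun_nil_sum hq w j
  simp only [F, qInt, PNat.one_coe, one_mul, pow_one]
  field_simp
  linear_combination h4

theorem dualFun_c (hq : ‖q‖ < 1) (w : List Letter) (j : ℕ) :
    dualFun q (.c :: w) (j + 1) = F q (j + 1) (.g 1) * dualFun q w (j + 1) := by
  have h1 := one_sub_pow_ne_zero hq j
  have h2 := one_sub_ne_zero hq
  have h3 : dualFun q (.c :: w) (j + 1) =
      (1 - q) * ∑' m : ℕ, truncRev q w (m + 1) * q ^ ((j + 1) * (m + 1)) := by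
    rw [dualFun, ← tsum_mul_left]
    refine tsum_congr fun m => ?_
    simp only [F]
    ring
  rw [h3]
  have h4 := dualFun_nil_sum hq w j
  simp only [F, qInt, PNat.one_coe, one_mul, pow_one]
  field_simp
  linear_combination h4

theorem tendsto_dualFun (hq : ‖q‖ < 1) (w : List Letter) (k : ℕ+) :
    Tendsto (dualFun q (.g k :: w)) atTop (nhds 0) := by
  have h0 := summable_norm_dualFun hq w (.g k) 0 (Or.inl (by simp))
  have h2 := (tendsto_pow_atTop_nhds_zero_of_lt_one (norm_nonneg q) hq).const_mul
    (∑' m : ℕ, ‖truncRev q w (m + 1) * F q (m + 1) (.g k) * q ^ (0 * (m + 1))‖)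
  rw [mul_zero] at h2
  refine squeeze_zero_norm (fun j => ?_) h2
  rw [dualFun, ← tsum_mul_right]
  refine (norm_tsum_le_tsum_norm (summable_norm_dualFun hq w (.g k) j (Or.inl (by simp)))).trans ?_
  refine (summable_norm_dualFun hq w (.g k) j (Or.inl (by simp))).tsum_le_tsum (fun m => ?_)
    (h0.mul_right _)
  rw [norm_mul, norm_mul _ (q ^ (0 * (m + 1)))]
  simp only [zero_mul, pow_zero, norm_one, mul_one, norm_pow]
  gcongr 1
  exact pow_le_pow_of_le_one (norm_nonneg _) hq.le (Nat.le_mul_of_pos_right _ (Nat.succ_pos m))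

/-- The linear extension of `dualFun`, evaluated at `j`. -/
def dualEval (q : ℂ) (j : ℕ) : CA →ₗ[ℚ] ℂ := evalW q fun w => dualFun q w.reverse j

theorem dualEval_smul (j : ℕ) (c : 𝒞) (v : CA) :
    dualEval q j (c • v) = aeval (1 - q) c * dualEval q j v := evalW_smul _ _ _ _

theorem dualEval_one (j : ℕ) : dualEval q j 1 = 1 := by
  rw [← word_nil, dualEval, evalW_word]; rfl

theorem dualEval_opY (hq : ‖q‖ < 1) (v : CA) (j : ℕ) :
    dualEval q j (opY v) - dualEval q (j + 1) (opY v) =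
      F q (j + 1) (.g 1) * dualEval q (j + 1) v := by
  induction v using CA_induction with
  | h0 => simp
  | hadd a b ha hb => rw [map_add, map_add, map_add, map_add]; linear_combination ha + hb
  | h r w =>
    have h := dualFun_g_one hq w.reverse j
    simp only [map_smul, dualEval_smul, opY_word]
    simp only [dualEval, evalW_word, List.reverse_append, List.reverse_singleton,
      List.singleton_append]
    linear_combination aeval (1 - q) r * h

theorem dualEval_opC (hq : ‖q‖ < 1) (v : CA) (j : ℕ) :
    dualEval q (j + 1) (opC v) = F q (j + 1) (.g 1) * dualEval q (j + 1) v := by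
  induction v using CA_induction with
  | h0 => simp
  | hadd a b ha hb => rw [map_add, map_add, map_add]; linear_combination ha + hb
  | h r w =>
    have h := dualFun_c hq w.reverse j
    simp only [map_smul, dualEval_smul, opC_word]
    simp only [dualEval, evalW_word, List.reverse_append, List.reverse_singleton,
      List.singleton_append]
    linear_combination aeval (1 - q) r * h

theorem dualEval_opX (hq : ‖q‖ < 1) {v : CA} (hv : v ∈ endsInG 1) (j : ℕ) :
    dualEval q j (opX v) - dualEval q (j + 1) (opX v) = (1 - q) * dualEval q (j + 1) v := by
  refine endsInG_induction (P := fun v => dualEval q j (opX v) - dualEval q (j + 1) (opX v) =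
    (1 - q) * dualEval q (j + 1) v) ?_ ?_ ?_ ?_ hv
  · simp
  · intro a b ha hb
    rw [map_add, map_add, map_add, map_add]; linear_combination ha + hb
  · intro r a ha
    simp only [map_smul, dualEval_smul]
    linear_combination aeval (1 - q) r * ha
  · intro w k _
    have h := dualFun_g_succ hq w.reverse k j
    simpa [dualEval, evalW_word, opX_word] using h

theorem tendsto_dualEval (hq : ‖q‖ < 1) {v : CA} (hv : v ∈ endsInG 1) :
    Tendsto (fun j => dualEval q j v) atTop (nhds 0) := by
  refine endsInG_induction (P := fun v => Tendsto (fun j => dualEval q j v) atTop (nhds 0)) ?_ ?_ ?_ ?_ hv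
  · simp
  · intro a b ha hb
    simpa using ha.add hb
  · intro r a ha
    simpa [dualEval_smul] using ha.const_mul (aeval (1 - q) r)
  · intro w k _
    simpa [dualEval, evalW_word] using tendsto_dualFun hq w.reverse k

theorem Zq_smul (c : 𝒞) (v : CA) : Zq q (c • v) = aeval (1 - q) c * Zq q v :=
  evalW_smul _ _ _ _

theorem Zq_one : Zq q 1 = 1 := by
  rw [← word_nil, Zq_eq, evalW_word, ZqWord]
  simp only [List.reverse_nil, truncRev]
  exact tendsto_const_nhds.limUnder_eq

theorem Zq_eq_dualEval (hq : ‖q‖ < 1) {v : CA} (hv : v ∈ hatH0) : Zq q v = dualEval q 0 v := by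
  refine hatH0_induction (P := fun v => Zq q v = dualEval q 0 v) ?_ ?_ ?_ ?_ ?_ hv
  · simp
  · intro a b ha hb
    rw [map_add, map_add, ha, hb]
  · intro r a ha
    rw [Zq_smul, dualEval_smul, ha]
  · rw [word_nil, Zq_one, dualEval_one]
  · intro w k
    rw [Zq_eq, dualEval, evalW_word, evalW_word, ZqWord_eq hq]; simp

/-- Truncated sums, extended linearly. -/
def truncEval (q : ℂ) (M : ℕ) : CA →ₗ[ℚ] ℂ := evalW q fun w => truncRev q w.reverse M

theorem truncEval_smul (M : ℕ) (c : 𝒞) (v : CA) :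
    truncEval q M (c • v) = aeval (1 - q) c * truncEval q M v := evalW_smul _ _ _ _

theorem tendsto_truncEval (hq : ‖q‖ < 1) {v : CA} (hv : v ∈ hatH0) :
    Tendsto (fun M => truncEval q M v) atTop (nhds (Zq q v)) := by
  refine hatH0_induction (P := fun v => Tendsto (fun M => truncEval q M v) atTop
    (nhds (Zq q v))) ?_ ?_ ?_ ?_ ?_ hv
  · simp
  · intro a b ha hb
    simpa using ha.add hb
  · intro r a ha
    simpa [truncEval_smul, Zq_smul] using ha.const_mul (aeval (1 - q) r)
  · rw [word_nil, Zq_one, ← word_nil]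
    simp [truncEval, truncRev]
  · intro w k
    rw [Zq_eq, evalW_word, ZqWord_eq hq]
    simpa [truncEval] using tendsto_truncRev hq w.reverse k

end analysis

/-! ### The module `𝔫` in terms of words -/

/-- For a word read from right to left: some letter `ħb` is followed by a letter `g_k` with
`k ≥ 2`. -/
def IsN : List Letter → Prop
  | [] => False
  | .c :: w => IsN w
  | .g k :: w => (2 ≤ (k : ℕ) ∧ Letter.c ∈ w) ∨ IsN w

theorem IsN.cons {w : List Letter} (h : IsN w) (u : Letter) : IsN (u :: w) := by
  cases u with
  | c => exact h
  | g k => exact Or.inr h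

theorem IsN.append {w : List Letter} (h : IsN w) (v : List Letter) : IsN (v ++ w) := by
  induction v with
  | nil => exact h
  | cons u v ih => exact ih.cons u

theorem IsN.mem {w : List Letter} (h : IsN w) : Letter.c ∈ w := by
  induction w with
  | nil => exact h.elim
  | cons u w ih =>
    cases u with
    | c => simp
    | g k =>
      rcases h with h | h
      · exact List.mem_cons_of_mem _ h.2
      · exact List.mem_cons_of_mem _ (ih h)

theorem word_replicate (n : ℕ) (u : Letter) : word (List.replicate n u) = word [u] ^ n := by
  induction n with
  | zero => simp [word_nil]
  | succ n ih => rw [List.replicate_succ', word_append, ih, pow_succ]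

theorem basisMonomial_append (l l' : List (ℕ × ℕ)) :
    basisMonomial (l ++ l') = basisMonomial l * basisMonomial l' := by
  simp [basisMonomial]

theorem exists_basisMonomial_eq (w : List Letter) : ∀ (n : ℕ) (k : ℕ+), ∃ l,
    basisMonomial l = word (w.reverse ++ List.replicate n .c ++ [.g k]) ∧
    ((0 < n ∨ Letter.c ∈ w) → ∃ p ∈ l, 1 ≤ p.1) ∧
    (((2 ≤ (k : ℕ) ∧ (0 < n ∨ Letter.c ∈ w)) ∨ IsN w) →
      ∃ l₁ p l₂, l = l₁ ++ [p] ++ l₂ ∧ 1 ≤ p.2 ∧ ∃ r ∈ l₁ ++ [p], 1 ≤ r.1) := by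
  have hk : ∀ k : ℕ+, ((k : ℕ) - 1).succPNat = k := fun k => by
    apply PNat.eq
    rw [Nat.succPNat_coe]
    have := k.pos
    omega
  have hb : ∀ (n : ℕ) (k : ℕ+), basisMonomial [(n, (k : ℕ) - 1)] =
      word (List.replicate n .c ++ [.g k]) := fun n k => by
    simp [basisMonomial, word_append, word_replicate, hk]
  induction w with
  | nil =>
    intro n k
    refine ⟨[(n, (k : ℕ) - 1)], by simpa using hb n k, ?_, ?_⟩
    · rintro (h | h)
      · exact ⟨_, List.mem_singleton_self _, h⟩
      · simp at h
    · rintro (⟨h1, h | h⟩ | h)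
      · exact ⟨[], _, [], rfl, by simp only; omega, _, List.mem_singleton_self _, h⟩
      · simp at h
      · exact h.elim
  | cons u w ih =>
    intro n k
    cases u with
    | c =>
      obtain ⟨l, h1, h2, h3⟩ := ih (n + 1) k
      refine ⟨l, ?_, fun _ => h2 (Or.inl n.succ_pos), fun h => h3 ?_⟩
      · rw [h1]; simp [List.replicate_succ]
      · rcases h with h | h
        · exact Or.inl ⟨h.1, Or.inl n.succ_pos⟩
        · exact Or.inr h
    | g k' =>
      obtain ⟨l, h1, h2, h3⟩ := ih 0 k'
      refine ⟨l ++ [(n, (k : ℕ) - 1)], ?_, ?_, ?_⟩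
      · rw [basisMonomial_append, h1, hb, ← word_append]; simp
      · rintro (h | h)
        · exact ⟨_, List.mem_append_right _ (List.mem_singleton_self _), h⟩
        · obtain ⟨p, hp, h⟩ := h2 (Or.inr (by simpa using h))
          exact ⟨p, List.mem_append_left _ hp, h⟩
      · rintro (⟨h4, h | h⟩ | h)
        · exact ⟨l, _, [], (List.append_nil _).symm, by simp only; omega, _,
            List.mem_append_right _ (List.mem_singleton_self _), h⟩
        · obtain ⟨p, hp, h⟩ := h2 (Or.inr (by simpa using h))
          exact ⟨l, _, [], (List.append_nil _).symm, by simp only; omega, p,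
            List.mem_append_left _ hp, h⟩
        · obtain ⟨l₁, p, l₂, e, hp, r, hr, h5⟩ := h3 (by
            rcases h with h | h
            · exact Or.inl ⟨h.1, Or.inr h.2⟩
            · exact Or.inr h)
          exact ⟨l₁, p, l₂ ++ [(n, (k : ℕ) - 1)], by rw [e]; simp, hp, r, hr, h5⟩

theorem word_mem_n0 {w : List Letter} {k : ℕ+} (h : IsN (.g k :: w)) :
    word (.g k :: w).reverse ∈ n0 := by
  obtain ⟨l, h1, -, h3⟩ := exists_basisMonomial_eq w 0 k
  obtain ⟨l₁, p, l₂, rfl, hp, r, hr, h5⟩ := h3 (by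
    rcases h with h | h
    · exact Or.inl ⟨h.1, Or.inr h.2⟩
    · exact Or.inr h)
  obtain ⟨i, hi, rfl⟩ := List.getElem_of_mem hr
  have hi' : i < l₁.length + 1 := by simpa using hi
  refine Submodule.subset_span ⟨l₁ ++ [p] ++ l₂, ⟨i, by simp; omega⟩, ⟨l₁.length, by simp⟩, ?_, ?_,
    ?_, ?_⟩
  · exact Fin.mk_le_mk.mpr (by omega)
  · rw [List.get_eq_getElem, List.getElem_append_left hi]
    exact h5
  · simpa using hp
  · rw [h1]; simp

theorem basisMonomial_eq_word {l : List (ℕ × ℕ)} (s t : Fin l.length) (hst : s ≤ t)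
    (hs : 1 ≤ (l.get s).1) (ht : 1 ≤ (l.get t).2) :
    ∃ w k, IsN (.g k :: w) ∧ basisMonomial l = word (.g k :: w).reverse := by
  set f : ℕ × ℕ → List Letter := fun p => List.replicate p.1 .c ++ [.g p.2.succPNat] with hf
  have hw : ∀ l : List (ℕ × ℕ), basisMonomial l = word (l.flatMap f) := by
    intro l
    induction l with
    | nil => simp [basisMonomial, word_nil]
    | cons p l ih =>
      rw [List.flatMap_cons, word_append, ← ih, hf]
      simp [basisMonomial, word_append, word_replicate]
  have hl : l = l.take t ++ [l.get t] ++ l.drop (t + 1) := by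
    rw [List.append_assoc, List.singleton_append, List.get_eq_getElem, ← List.drop_eq_getElem_cons,
      List.take_append_drop]
  have hN : IsN (l.flatMap f).reverse := by
    rw [hl, List.flatMap_append, List.flatMap_append, List.reverse_append, List.reverse_append]
    refine IsN.append ?_ _
    simp only [hf, List.flatMap_cons, List.flatMap_nil, List.append_nil, List.reverse_append,
      List.reverse_singleton, List.cons_append]
    refine Or.inl ⟨by rw [Nat.succPNat_coe]; omega, ?_⟩
    rw [List.mem_append]
    rcases hst.lt_or_eq with h | h
    · refine Or.inr (List.mem_reverse.mpr (List.mem_flatMap.mpr ⟨l.get s, ?_, ?_⟩))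
      · rw [List.mem_take_iff_getElem]
        exact ⟨s, lt_min h s.2, rfl⟩
      · exact List.mem_append_left _ (List.mem_replicate.mpr ⟨Nat.one_le_iff_ne_zero.mp hs, rfl⟩)
    · subst h
      exact Or.inl (by simpa [Nat.one_le_iff_ne_zero] using hs)
  have hne : l ≠ [] := by
    rintro rfl
    exact s.elim0
  obtain ⟨l', p, rfl⟩ := List.eq_nil_or_concat l |>.resolve_left hne
  refine ⟨((l'.flatMap f) ++ List.replicate p.1 Letter.c).reverse, p.2.succPNat, ?_, ?_⟩
  · rw [List.concat_eq_append, List.flatMap_append] at hN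
    simpa [hf] using hN
  · rw [hw]; simp [hf]

theorem nMod_induction {P : CA → Prop} (hadd : ∀ a b, P a → P b → P (a + b)) (h0 : P 0)
    (hsmul : ∀ (r : 𝒞) a, P a → P (r • a))
    (hw : ∀ w k, IsN (.g k :: w) → P (word (.g k :: w).reverse))
    (hX : ∀ v ∈ hatH0, P ((X : 𝒞) • v)) {v : CA} (hv : v ∈ nMod) : P v := by
  obtain ⟨a, ha, b, ⟨b, hb, rfl⟩, rfl⟩ := Submodule.mem_sup.mp hv
  clear hv
  refine hadd _ _ ?_ (hX _ hb)
  induction ha using Submodule.span_induction with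
  | mem v hv =>
    obtain ⟨l, s, t, hst, hs, ht, rfl⟩ := hv
    obtain ⟨w, k, h, e⟩ := basisMonomial_eq_word s t hst hs ht
    rw [e]
    exact hw w k h
  | zero => exact h0
  | add a b _ _ ha hb => exact hadd a b ha hb
  | smul r a _ ha => exact hsmul r a ha

theorem word_mem_nMod {w : List Letter} {k : ℕ+} (h : IsN (.g k :: w)) :
    word (.g k :: w).reverse ∈ nMod := Submodule.mem_sup_left (word_mem_n0 h)

theorem X_smul_mem_nMod {v : CA} (hv : v ∈ hatH0) : (X : 𝒞) • v ∈ nMod :=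
  Submodule.mem_sup_right ⟨v, hv, rfl⟩

theorem word_cons_mem_hatH0 (w : List Letter) (k : ℕ+) : word (.g k :: w).reverse ∈ hatH0 := by
  rw [List.reverse_cons]
  exact endsInG_le_hatH0 (word_mem_endsInG _ k.pos)

theorem nMod_le_hatH0 : nMod ≤ hatH0 := fun _ hv =>
  nMod_induction (P := fun v => v ∈ hatH0) (fun _ _ => add_mem) (zero_mem _)
    (fun r _ h => hatH0.smul_mem r h) (fun w k _ => word_cons_mem_hatH0 w k)
    (fun _ h => hatH0.smul_mem _ h) hv

theorem H0_le_hatH0 : H0 ≤ hatH0 :=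
  sup_le (sup_le le_sup_left ((endsInG_mono one_le_two).trans endsInG_le_hatH0)) nMod_le_hatH0

/-- The span of the monomials in which the letter `ħb` occurs, together with the multiples of
`ħ`. -/
def withC : Submodule 𝒞 CA :=
  Submodule.span 𝒞 {v | ∃ w : List Letter, Letter.c ∈ w ∧ v = word w.reverse} ⊔
    LinearMap.range (LinearMap.lsmul 𝒞 CA (X : 𝒞))

/-- The span of the monomials in which some letter `ħb` is followed by a letter `g_k` with `k ≥ 2`,
together with the multiples of `ħ`. -/
def withN : Submodule 𝒞 CA :=
  Submodule.span 𝒞 {v | ∃ w : List Letter, IsN w ∧ v = word w.reverse} ⊔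
    LinearMap.range (LinearMap.lsmul 𝒞 CA (X : 𝒞))

theorem span_sup_X_induction {S : Set CA} {P : CA → Prop} (hadd : ∀ a b, P a → P b → P (a + b))
    (h0 : P 0) (hsmul : ∀ (r : 𝒞) a, P a → P (r • a)) (hS : ∀ v ∈ S, P v)
    (hX : ∀ v, P ((X : 𝒞) • v)) {v : CA}
    (hv : v ∈ Submodule.span 𝒞 S ⊔ LinearMap.range (LinearMap.lsmul 𝒞 CA (X : 𝒞))) : P v := by
  obtain ⟨a, ha, b, ⟨b, rfl⟩, rfl⟩ := Submodule.mem_sup.mp hv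
  clear hv
  refine hadd _ _ ?_ (hX b)
  induction ha using Submodule.span_induction with
  | mem v hv => exact hS v hv
  | zero => exact h0
  | add a b _ _ ha hb => exact hadd a b ha hb
  | smul r a _ ha => exact hsmul r a ha

theorem word_mem_withC {w : List Letter} (h : Letter.c ∈ w) : word w.reverse ∈ withC :=
  Submodule.mem_sup_left (Submodule.subset_span ⟨w, h, rfl⟩)

theorem word_mem_withN {w : List Letter} (h : IsN w) : word w.reverse ∈ withN :=
  Submodule.mem_sup_left (Submodule.subset_span ⟨w, h, rfl⟩)

theorem X_smul_mem_withC (v : CA) : (X : 𝒞) • v ∈ withC := Submodule.mem_sup_right ⟨v, rfl⟩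

theorem X_smul_mem_withN (v : CA) : (X : 𝒞) • v ∈ withN := Submodule.mem_sup_right ⟨v, rfl⟩

theorem word_reverse_mul (w : List Letter) (u : Letter) :
    word w.reverse * word [u] = word (u :: w).reverse := by
  rw [List.reverse_cons, word_append]

theorem withC_mul_letter {v : CA} (hv : v ∈ withC) (u : Letter) : v * word [u] ∈ withC := by
  refine span_sup_X_induction (P := fun v => v * word [u] ∈ withC) ?_ ?_ ?_ ?_ ?_ hv
  · intro a b ha hb; rw [add_mul]; exact add_mem ha hb
  · rw [zero_mul]; exact zero_mem _
  · intro r a ha; rw [smul_mul_assoc]; exact withC.smul_mem r ha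
  · rintro _ ⟨w, hw, rfl⟩
    rw [word_reverse_mul]
    exact word_mem_withC (List.mem_cons_of_mem _ hw)
  · intro v; rw [smul_mul_assoc]; exact X_smul_mem_withC _

theorem withN_mul_letter {v : CA} (hv : v ∈ withN) (u : Letter) : v * word [u] ∈ withN := by
  refine span_sup_X_induction (P := fun v => v * word [u] ∈ withN) ?_ ?_ ?_ ?_ ?_ hv
  · intro a b ha hb; rw [add_mul]; exact add_mem ha hb
  · rw [zero_mul]; exact zero_mem _
  · intro r a ha; rw [smul_mul_assoc]; exact withN.smul_mem r ha
  · rintro _ ⟨w, hw, rfl⟩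
    rw [word_reverse_mul]
    exact word_mem_withN (hw.cons u)
  · intro v; rw [smul_mul_assoc]; exact X_smul_mem_withN _

theorem withC_mul_g {v : CA} (hv : v ∈ withC) {k : ℕ+} (hk : 2 ≤ (k : ℕ)) :
    v * word [.g k] ∈ withN := by
  refine span_sup_X_induction (P := fun v => v * word [.g k] ∈ withN) ?_ ?_ ?_ ?_ ?_ hv
  · intro a b ha hb; rw [add_mul]; exact add_mem ha hb
  · rw [zero_mul]; exact zero_mem _
  · intro r a ha; rw [smul_mul_assoc]; exact withN.smul_mem r ha
  · rintro _ ⟨w, hw, rfl⟩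
    rw [word_reverse_mul]
    exact word_mem_withN (Or.inl ⟨hk, hw⟩)
  · intro v; rw [smul_mul_assoc]; exact X_smul_mem_withN _

theorem mul_g_mem_hatH0 (v : CA) (k : ℕ+) : v * word [.g k] ∈ hatH0 :=
  endsInG_le_hatH0 (mul_word_mem_endsInG v k.pos)

theorem withN_mul_g {v : CA} (hv : v ∈ withN) (k : ℕ+) : v * word [.g k] ∈ nMod := by
  refine span_sup_X_induction (P := fun v => v * word [.g k] ∈ nMod) ?_ ?_ ?_ ?_ ?_ hv
  · intro a b ha hb; rw [add_mul]; exact add_mem ha hb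
  · rw [zero_mul]; exact zero_mem _
  · intro r a ha; rw [smul_mul_assoc]; exact nMod.smul_mem r ha
  · rintro _ ⟨w, hw, rfl⟩
    rw [word_reverse_mul]
    exact word_mem_nMod (hw.cons _)
  · intro v; rw [smul_mul_assoc]; exact X_smul_mem_nMod (mul_g_mem_hatH0 v k)

theorem withC_mul_g_mem_nMod {v : CA} (hv : v ∈ withC) {k : ℕ+} (hk : 2 ≤ (k : ℕ)) :
    v * word [.g k] ∈ nMod := by
  refine span_sup_X_induction (P := fun v => v * word [.g k] ∈ nMod) ?_ ?_ ?_ ?_ ?_ hv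
  · intro a b ha hb; rw [add_mul]; exact add_mem ha hb
  · rw [zero_mul]; exact zero_mem _
  · intro r a ha; rw [smul_mul_assoc]; exact nMod.smul_mem r ha
  · rintro _ ⟨w, hw, rfl⟩
    rw [word_reverse_mul]
    exact word_mem_nMod (Or.inl ⟨hk, hw⟩)
  · intro v; rw [smul_mul_assoc]; exact X_smul_mem_nMod (mul_g_mem_hatH0 v k)

/-! ### The harmonic product and the ideal `𝔫` -/

theorem two_le_add (k l : ℕ+) : 2 ≤ ((k + l : ℕ+) : ℕ) := by
  have := k.pos
  have := l.pos
  rw [PNat.add_coe]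
  omega

theorem harmRev_mem_withC : ∀ w w' : List Letter, Letter.c ∈ w → harmRev w w' ∈ withC
  | [], _, h => by simp at h
  | u :: w, [], h => by rw [harmRev]; exact word_mem_withC h
  | u :: w, v :: w', h => by
    rw [harmRev]
    have h2 := withC_mul_letter (harmRev_mem_withC (u :: w) w' h) v
    cases u with
    | c =>
      have h1 : harmRev w (v :: w') * word [.c] ∈ withC := by
        have : ∀ a : CA, a * word [.c] ∈ withC := by
          intro a
          induction a using CA_induction with
          | h0 => simp
          | hadd a b ha hb => rw [add_mul]; exact add_mem ha hb
          | h r w =>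
            rw [smul_mul_assoc, ← List.reverse_reverse w, word_reverse_mul]
            exact withC.smul_mem r (word_mem_withC (by simp))
        exact this _
      refine add_mem (add_mem h1 h2) ?_
      cases v <;>
      · rw [circ, mul_smul_comm]
        exact X_smul_mem_withC _
    | g k =>
      have h : Letter.c ∈ w := by simpa using h
      refine add_mem (add_mem (withC_mul_letter (harmRev_mem_withC w (v :: w') h) _) h2) ?_
      cases v with
      | c => rw [circ, mul_smul_comm]; exact X_smul_mem_withC _
      | g l => rw [circ]; exact withC_mul_letter (harmRev_mem_withC w w' h) _
termination_by w w' => w.length + w'.length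

theorem harmRev_mem_withN : ∀ w w' : List Letter, IsN w → harmRev w w' ∈ withN
  | [], _, h => h.elim
  | u :: w, [], h => by rw [harmRev]; exact word_mem_withN h
  | u :: w, v :: w', h => by
    rw [harmRev]
    have h2 := withN_mul_letter (harmRev_mem_withN (u :: w) w' h) v
    by_cases hw : IsN w
    · refine add_mem (add_mem (withN_mul_letter (harmRev_mem_withN w (v :: w') hw) u) h2) ?_
      have h3 := harmRev_mem_withN w w' hw
      cases u with
      | c => cases v <;> (rw [circ, mul_smul_comm]; exact X_smul_mem_withN _)
      | g k =>
        cases v with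
        | c => rw [circ, mul_smul_comm]; exact X_smul_mem_withN _
        | g l => rw [circ]; exact withN_mul_letter h3 _
    · cases u with
      | c => exact (hw h).elim
      | g k =>
        obtain ⟨hk, hc⟩ := h.resolve_right hw
        refine add_mem (add_mem (withC_mul_g (harmRev_mem_withC w (v :: w') hc) hk) h2) ?_
        cases v with
        | c => rw [circ, mul_smul_comm]; exact X_smul_mem_withN _
        | g l => rw [circ]; exact withC_mul_g (harmRev_mem_withC w w' hc) (two_le_add k l)
termination_by w w' => w.length + w'.length

theorem harmRev_g_mem_nMod {w : List Letter} {k : ℕ+} (h : IsN (.g k :: w)) (l : ℕ+)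
    (w' : List Letter) : harmRev (.g k :: w) (.g l :: w') ∈ nMod := by
  rw [harmRev, circ]
  refine add_mem (add_mem ?_ (withN_mul_g (harmRev_mem_withN _ _ h) l)) ?_
  · rcases h with ⟨hk, hc⟩ | h
    · exact withC_mul_g_mem_nMod (harmRev_mem_withC _ _ hc) hk
    · exact withN_mul_g (harmRev_mem_withN _ _ h) k
  · rcases h with ⟨_, hc⟩ | h
    · exact withC_mul_g_mem_nMod (harmRev_mem_withC _ _ hc) (two_le_add k l)
    · exact withN_mul_g (harmRev_mem_withN _ _ h) _

theorem harmRev_g_mem_endsInG {n : ℕ} {k l : ℕ+} (hk : n ≤ (k : ℕ)) (hl : n ≤ (l : ℕ))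
    (w w' : List Letter) : harmRev (.g k :: w) (.g l :: w') ∈ endsInG n := by
  rw [harmRev, circ]
  refine add_mem (add_mem (mul_word_mem_endsInG _ hk) (mul_word_mem_endsInG _ hl))
    (mul_word_mem_endsInG _ ?_)
  rw [PNat.add_coe]
  omega

theorem harm_word (v w : List Letter) : harm (word v) (word w) = harmRev v.reverse w.reverse := by
  rw [harm, onWords_word, onWords_word]

theorem harm_one (v : CA) : harm v 1 = v := by
  have : harm.flip 1 = LinearMap.id := CA_hom_ext fun w => by
    rw [← word_nil, LinearMap.flip_apply, harm_word, List.reverse_nil, harmRev_nil_right]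
    simp
  exact LinearMap.congr_fun this v

theorem one_harm (v : CA) : harm 1 v = v := by
  have : harm 1 = LinearMap.id := CA_hom_ext fun w => by
    rw [← word_nil, harm_word, List.reverse_nil, harmRev]
    simp
  exact LinearMap.congr_fun this v

theorem harm_mem_hatH0 {v w : CA} (hv : v ∈ hatH0) (hw : w ∈ hatH0) : harm v w ∈ hatH0 := by
  refine hatH0_induction (P := fun v : CA => harm v w ∈ hatH0) ?_ ?_ ?_ ?_ ?_ hv
  · rw [LinearMap.map_zero₂]; exact zero_mem _
  · intro a b ha hb; rw [LinearMap.map_add₂]; exact add_mem ha hb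
  · intro r a ha; rw [LinearMap.map_smul₂]; exact hatH0.smul_mem r ha
  · rwa [word_nil, one_harm]
  · intro v k
    refine hatH0_induction (P := fun w : CA => harm (word (v ++ [Letter.g k])) w ∈ hatH0) ?_ ?_ ?_ ?_ ?_ hw
    · simp
    · intro a b ha hb; rw [map_add]; exact add_mem ha hb
    · intro r a ha; rw [map_smul]; exact hatH0.smul_mem r ha
    · rw [word_nil, harm_one]; exact endsInG_le_hatH0 (word_mem_endsInG v k.pos)
    · intro w l
      rw [harm_word]
      simpa using endsInG_le_hatH0 (harmRev_g_mem_endsInG k.pos l.pos v.reverse w.reverse)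

theorem harm_mem_nMod {v w : CA} (hv : v ∈ nMod) (hw : w ∈ hatH0) : harm v w ∈ nMod := by
  refine nMod_induction (P := fun v : CA => harm v w ∈ nMod) ?_ ?_ ?_ ?_ ?_ hv
  · intro a b ha hb; rw [LinearMap.map_add₂]; exact add_mem ha hb
  · rw [LinearMap.map_zero₂]; exact zero_mem _
  · intro r a ha; rw [LinearMap.map_smul₂]; exact nMod.smul_mem r ha
  · intro v k h
    refine hatH0_induction (P := fun w => harm (word (.g k :: v).reverse) w ∈ nMod)
      ?_ ?_ ?_ ?_ ?_ hw
    · simp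
    · intro a b ha hb; rw [map_add]; exact add_mem ha hb
    · intro r a ha; rw [map_smul]; exact nMod.smul_mem r ha
    · rw [word_nil, harm_one]; exact word_mem_nMod h
    · intro w l
      rw [harm_word]
      simpa using harmRev_g_mem_nMod h l w.reverse
  · intro v hv
    rw [LinearMap.map_smul₂]
    exact X_smul_mem_nMod (harm_mem_hatH0 hv hw)

theorem harm_mem_endsInG_two {v w : CA} (hv : v ∈ endsInG 2) (hw : w ∈ endsInG 2) :
    harm v w ∈ endsInG 2 := by
  refine endsInG_induction (P := fun v : CA => harm v w ∈ endsInG 2) ?_ ?_ ?_ ?_ hv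
  · rw [LinearMap.map_zero₂]; exact zero_mem _
  · intro a b ha hb; rw [LinearMap.map_add₂]; exact add_mem ha hb
  · intro r a ha; rw [LinearMap.map_smul₂]; exact (endsInG 2).smul_mem r ha
  · intro v k hk
    refine endsInG_induction (P := fun w : CA => harm (word (v ++ [Letter.g k])) w ∈ endsInG 2) ?_ ?_ ?_ ?_ hw
    · simp
    · intro a b ha hb; rw [map_add]; exact add_mem ha hb
    · intro r a ha; rw [map_smul]; exact (endsInG 2).smul_mem r ha
    · intro w l hl
      rw [harm_word]
      simpa using harmRev_g_mem_endsInG hk hl v.reverse w.reverse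

/-! ### Multiplicativity of `Z_q` -/

theorem sum_Ioo_succ (f : ℕ → ℂ) (M : ℕ) (hM : 0 < M) :
    ∑ m ∈ Finset.Ioo 0 (M + 1), f m = ∑ m ∈ Finset.Ioo 0 M, f m + f M := by
  have h : Finset.Ioo 0 (M + 1) = insert M (Finset.Ioo 0 M) := by
    ext m
    simp only [Finset.mem_Ioo, Finset.mem_insert]
    omega
  rw [h, Finset.sum_insert (by simp), add_comm]

theorem sum_Ioo_mul_sum_Ioo (a b : ℕ → ℂ) (M : ℕ) :
    (∑ m ∈ Finset.Ioo 0 M, a m) * ∑ m ∈ Finset.Ioo 0 M, b m =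
      ∑ m ∈ Finset.Ioo 0 M, (a m * ∑ i ∈ Finset.Ioo 0 m, b i + (∑ i ∈ Finset.Ioo 0 m, a i) * b m +
        a m * b m) := by
  induction M with
  | zero => simp
  | succ M ih =>
    rcases Nat.eq_zero_or_pos M with rfl | hM
    · have h : Finset.Ioo 0 (0 + 1) = ∅ := rfl
      simp [h]
    · rw [sum_Ioo_succ _ M hM, sum_Ioo_succ _ M hM, sum_Ioo_succ _ M hM, ← ih]
      ring

theorem truncEval_mul_letter (q : ℂ) (v : CA) (u : Letter) (M : ℕ) :
    truncEval q M (v * word [u]) = ∑ m ∈ Finset.Ioo 0 M, truncEval q m v * F q m u := by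
  induction v using CA_induction with
  | h0 => simp
  | hadd a b ha hb =>
    rw [add_mul, map_add, ha, hb, ← Finset.sum_add_distrib]
    exact Finset.sum_congr rfl fun m _ => by rw [map_add]; ring
  | h r w =>
    rw [smul_mul_assoc, truncEval_smul, ← word_append, truncEval, evalW_word, List.reverse_append,
      List.reverse_singleton, List.singleton_append, truncRev, Finset.mul_sum]
    refine Finset.sum_congr rfl fun m _ => ?_
    rw [truncEval_smul, truncEval, evalW_word]
    ring

theorem truncEval_mul_circ (q : ℂ) (w : CA) (u v : Letter) (M : ℕ) :
    truncEval q M (w * circ u v) =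
      ∑ m ∈ Finset.Ioo 0 M, truncEval q m w * (F q m u * F q m v) := by
  have hX : aeval (1 - q) (X : 𝒞) = 1 - q := by simp
  cases u with
  | c =>
    cases v with
    | c =>
      rw [circ, mul_smul_comm, truncEval_smul, truncEval_mul_letter, Finset.mul_sum, hX]
      exact Finset.sum_congr rfl fun m _ => by simp only [F]; ring
    | g k =>
      rw [circ, mul_smul_comm, truncEval_smul, truncEval_mul_letter, Finset.mul_sum, hX]
      exact Finset.sum_congr rfl fun m _ => by simp only [F]; ring
  | g k =>
    cases v with
    | c =>
      rw [circ, mul_smul_comm, truncEval_smul, truncEval_mul_letter, Finset.mul_sum, hX]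
      exact Finset.sum_congr rfl fun m _ => by simp only [F]; ring
    | g l =>
      rw [circ, truncEval_mul_letter]
      refine Finset.sum_congr rfl fun m _ => ?_
      simp only [F, PNat.add_coe]
      rw [add_mul, pow_add, pow_add, mul_div_mul_comm]

theorem truncEval_harmRev (q : ℂ) : ∀ (w w' : List Letter) (M : ℕ),
    truncEval q M (harmRev w w') = truncRev q w M * truncRev q w' M
  | [], w', M => by simp [harmRev, truncEval, truncRev]
  | u :: w, [], M => by
    simp only [harmRev, truncEval, evalW_word, List.reverse_reverse]
    rw [truncRev.eq_1, mul_one]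
  | u :: w, v :: w', M => by
    rw [harmRev, map_add, map_add, truncEval_mul_letter, truncEval_mul_letter,
      truncEval_mul_circ q, truncRev, truncRev, sum_Ioo_mul_sum_Ioo, ← Finset.sum_add_distrib,
      ← Finset.sum_add_distrib]
    refine Finset.sum_congr rfl fun m _ => ?_
    rw [truncEval_harmRev q w, truncEval_harmRev q (u :: w), truncEval_harmRev q w w',
      truncRev, truncRev]
    ring
termination_by w w' => w.length + w'.length

theorem truncEval_harm (q : ℂ) (v w : CA) (M : ℕ) :
    truncEval q M (harm v w) = truncEval q M v * truncEval q M w := by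
  induction v using CA_induction with
  | h0 => simp
  | hadd a b ha hb => rw [map_add, LinearMap.add_apply, map_add, ha, hb, map_add, add_mul]
  | h r v =>
    rw [map_smul, LinearMap.smul_apply, truncEval_smul, truncEval_smul, mul_assoc]
    congr 1
    induction w using CA_induction with
    | h0 => simp
    | hadd a b ha hb => rw [map_add, map_add, ha, hb, map_add, mul_add]
    | h s w =>
      rw [map_smul, truncEval_smul, truncEval_smul, harm_word, truncEval_harmRev q, truncEval,
        evalW_word, evalW_word]
      ring

theorem Zq_harm {q : ℂ} (hq : ‖q‖ < 1) {v w : CA} (hv : v ∈ hatH0) (hw : w ∈ hatH0) :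
    Zq q (harm v w) = Zq q v * Zq q w := by
  have h1 := tendsto_truncEval hq (harm_mem_hatH0 hv hw)
  have h2 := (tendsto_truncEval hq hv).mul (tendsto_truncEval hq hw)
  simp only [truncEval_harm q] at h1
  exact tendsto_nhds_unique h1 h2

/-- The space `Z_q(Ĥ⁰)`. -/
def hatZ (q : ℂ) : Submodule ℚ ℂ := (hatH0.restrictScalars ℚ).map (Zq q)

theorem Zq_mem_hatZ {q : ℂ} {v : CA} (hv : v ∈ hatH0) : Zq q v ∈ hatZ q :=
  Submodule.mem_map_of_mem hv

theorem Zq_mem_calN {q : ℂ} {v : CA} (hv : v ∈ nMod) : Zq q v ∈ calN q :=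
  Submodule.mem_map_of_mem hv

theorem Zq_mem_calZ {q : ℂ} {v : CA} (hv : v ∈ H0) : Zq q v ∈ calZ q :=
  Submodule.mem_map_of_mem hv

theorem calN_le_calZ (q : ℂ) : calN q ≤ calZ q :=
  Submodule.map_mono fun _ h => Submodule.mem_sup_right h

theorem calZ_le_hatZ (q : ℂ) : calZ q ≤ hatZ q :=
  Submodule.map_mono fun _ h => H0_le_hatH0 h

theorem one_mem_calZ (q : ℂ) : (1 : ℂ) ∈ calZ q := by
  have := Zq_mem_calZ (q := q) (v := 1)
    (Submodule.mem_sup_left (Submodule.mem_sup_left (Submodule.one_le.mp le_rfl)))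
  rwa [Zq_one] at this

theorem mul_mem_hatZ {q : ℂ} (hq : ‖q‖ < 1) {a b : ℂ} (ha : a ∈ hatZ q) (hb : b ∈ hatZ q) :
    a * b ∈ hatZ q := by
  obtain ⟨v, hv, rfl⟩ := ha
  obtain ⟨w, hw, rfl⟩ := hb
  exact ⟨harm v w, harm_mem_hatH0 hv hw, Zq_harm hq hv hw⟩

theorem mul_mem_calN {q : ℂ} (hq : ‖q‖ < 1) {a b : ℂ} (ha : a ∈ calN q) (hb : b ∈ hatZ q) :
    a * b ∈ calN q := by
  obtain ⟨v, hv, rfl⟩ := ha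
  obtain ⟨w, hw, rfl⟩ := hb
  exact ⟨harm v w, harm_mem_nMod hv hw, Zq_harm hq (nMod_le_hatH0 hv) hw⟩

theorem mul_mem_calZ {q : ℂ} (hq : ‖q‖ < 1) {a b : ℂ} (ha : a ∈ calZ q) (hb : b ∈ calZ q) :
    a * b ∈ calZ q := by
  have hb' := calZ_le_hatZ q hb
  obtain ⟨v, hv, rfl⟩ := ha
  obtain ⟨w, hw, rfl⟩ := hb
  obtain ⟨v₀, hv₀, v₁, hv₁, rfl⟩ := Submodule.mem_sup.mp hv
  obtain ⟨w₀, hw₀, w₁, hw₁, rfl⟩ := Submodule.mem_sup.mp hw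
  have hle : (1 ⊔ endsInG 2 : Submodule 𝒞 CA) ≤ hatH0 :=
    sup_le le_sup_left ((endsInG_mono one_le_two).trans endsInG_le_hatH0)
  have hle' : (1 ⊔ endsInG 2 : Submodule 𝒞 CA) ≤ H0 := le_sup_left
  rw [map_add (Zq q) v₀, add_mul]
  refine add_mem ?_ (calN_le_calZ q (mul_mem_calN hq (Zq_mem_calN hv₁) hb'))
  rw [map_add (Zq q) w₀, mul_add]
  refine add_mem ?_ (calN_le_calZ q ?_)
  · rw [← Zq_harm hq (hle hv₀) (hle hw₀)]
    refine Zq_mem_calZ (hle' ?_)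
    obtain ⟨a, ha, b, hb, rfl⟩ := Submodule.mem_sup.mp hv₀
    obtain ⟨r, rfl⟩ := Submodule.mem_one.mp ha
    rw [Algebra.algebraMap_eq_smul_one, map_add, LinearMap.add_apply, map_smul,
      LinearMap.smul_apply, one_harm]
    refine add_mem (Submodule.smul_mem _ r hw₀) ?_
    obtain ⟨c, hc, d, hd, rfl⟩ := Submodule.mem_sup.mp hw₀
    obtain ⟨s, rfl⟩ := Submodule.mem_one.mp hc
    rw [Algebra.algebraMap_eq_smul_one, map_add, map_smul, harm_one]
    exact Submodule.mem_sup_right (add_mem (Submodule.smul_mem _ s hb)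
      (harm_mem_endsInG_two hb hd))
  · rw [mul_comm]
    exact mul_mem_calN hq (Zq_mem_calN hw₁) (Zq_mem_hatZ (hle hv₀))

/-! ### Products of dual generating functions -/

/-- The span of the monomials ending in some `g_k` in which the letter `ħb` occurs, together with
`ħ Ĥ⁰`. -/
def hatC : Submodule 𝒞 CA :=
  Submodule.span 𝒞 {v | ∃ (w : List Letter) (k : ℕ+), Letter.c ∈ w ∧
    v = word (.g k :: w).reverse} ⊔ hatH0.map (LinearMap.lsmul 𝒞 CA (X : 𝒞))

theorem word_mem_hatC {w : List Letter} (h : Letter.c ∈ w) (k : ℕ+) :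
    word (.g k :: w).reverse ∈ hatC :=
  Submodule.mem_sup_left (Submodule.subset_span ⟨w, k, h, rfl⟩)

theorem X_smul_mem_hatC {v : CA} (hv : v ∈ hatH0) : (X : 𝒞) • v ∈ hatC :=
  Submodule.mem_sup_right ⟨v, hv, rfl⟩

theorem hatC_induction {P : CA → Prop} (hadd : ∀ a b, P a → P b → P (a + b)) (h0 : P 0)
    (hsmul : ∀ (r : 𝒞) a, P a → P (r • a))
    (hw : ∀ (w : List Letter) (k : ℕ+), Letter.c ∈ w → P (word (.g k :: w).reverse))
    (hX : ∀ v ∈ hatH0, P ((X : 𝒞) • v)) {v : CA} (hv : v ∈ hatC) : P v := by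
  obtain ⟨a, ha, b, ⟨b, hb, rfl⟩, rfl⟩ := Submodule.mem_sup.mp hv
  clear hv
  refine hadd _ _ ?_ (hX _ hb)
  induction ha using Submodule.span_induction with
  | mem v hv =>
    obtain ⟨w, k, h, rfl⟩ := hv
    exact hw w k h
  | zero => exact h0
  | add a b _ _ ha hb => exact hadd a b ha hb
  | smul r a _ ha => exact hsmul r a ha

theorem nMod_le_hatC : nMod ≤ hatC := fun _ hv =>
  nMod_induction (P := fun v => v ∈ hatC) (fun _ _ => add_mem) (zero_mem _)
    (fun r _ h => hatC.smul_mem r h)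
    (fun w k h => by
      refine word_mem_hatC ?_ k
      rcases h with h | h
      · exact h.2
      · exact h.mem)
    (fun _ h => X_smul_mem_hatC h) hv

theorem opY_mem_hatH0 (v : CA) : opY v ∈ hatH0 := endsInG_le_hatH0 (opY_mem_endsInG v)

theorem opX_mem_hatH0 {v : CA} (hv : v ∈ hatH0) : opX v ∈ hatH0 :=
  endsInG_le_hatH0 (opX_mem_endsInG_of_mem_hatH0 hv)

theorem opY_word_reverse (w : List Letter) :
    opY (word w.reverse) = word (.g 1 :: w).reverse := by rw [opY_word, List.reverse_cons]

theorem opX_word_reverse (w : List Letter) (k : ℕ+) :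
    opX (word (.g k :: w).reverse) = word (.g (k + 1) :: w).reverse := by
  rw [List.reverse_cons, opX_word, List.reverse_cons]

theorem opY_mem_hatC {v : CA} (hv : v ∈ hatC) : opY v ∈ hatC := by
  refine hatC_induction (P := fun v : CA => opY v ∈ hatC) ?_ ?_ ?_ ?_ ?_ hv
  · intro a b ha hb; rw [map_add]; exact add_mem ha hb
  · rw [map_zero]; exact zero_mem _
  · intro r a ha; rw [map_smul]; exact hatC.smul_mem r ha
  · intro w k h; rw [opY_word_reverse]; exact word_mem_hatC (List.mem_cons_of_mem _ h) 1
  · intro v _; rw [map_smul]; exact X_smul_mem_hatC (opY_mem_hatH0 v)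

theorem opY_mem_nMod {v : CA} (hv : v ∈ nMod) : opY v ∈ nMod := by
  refine nMod_induction (P := fun v : CA => opY v ∈ nMod) ?_ ?_ ?_ ?_ ?_ hv
  · intro a b ha hb; rw [map_add]; exact add_mem ha hb
  · rw [map_zero]; exact zero_mem _
  · intro r a ha; rw [map_smul]; exact nMod.smul_mem r ha
  · intro w k h; rw [opY_word_reverse]; exact word_mem_nMod (h.cons _)
  · intro v _; rw [map_smul]; exact X_smul_mem_nMod (opY_mem_hatH0 v)

theorem opX_mem_nMod {v : CA} (hv : v ∈ hatC) : opX v ∈ nMod := by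
  refine hatC_induction (P := fun v : CA => opX v ∈ nMod) ?_ ?_ ?_ ?_ ?_ hv
  · intro a b ha hb; rw [map_add]; exact add_mem ha hb
  · rw [map_zero]; exact zero_mem _
  · intro r a ha; rw [map_smul]; exact nMod.smul_mem r ha
  · intro w k h
    rw [opX_word_reverse]
    refine word_mem_nMod (Or.inl ⟨?_, h⟩)
    rw [PNat.add_coe, PNat.one_coe]
    have := k.pos
    omega
  · intro v hv; rw [map_smul]; exact X_smul_mem_nMod (opX_mem_hatH0 hv)

theorem opY_opC_mem_hatC (v : CA) : opY (opC v) ∈ hatC := by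
  induction v using CA_induction with
  | h0 => simp
  | hadd a b ha hb => rw [map_add, map_add]; exact add_mem ha hb
  | h r w =>
    rw [map_smul, map_smul, opC_word, ← List.reverse_reverse (w ++ [Letter.c]), opY_word_reverse]
    exact hatC.smul_mem r (word_mem_hatC (by simp) 1)

/-- The operator attached to a letter. -/
def opL : XY → CA →ₗ[𝒞] CA
  | .x => opX
  | .y => opY

/-- The operator attached to a pair of letters at the same place. -/
def opLL : XY → XY → CA →ₗ[𝒞] CA
  | .x, .x => (X : 𝒞) • opX
  | .x, .y => (X : 𝒞) • opY
  | .y, .x => (X : 𝒞) • opY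
  | .y, .y => opY ∘ₗ opC

/-- The element of `𝒞⟨A⟩` attached to a word in `x` and `y`. -/
def emb : List XY → CA
  | [] => 1
  | l :: w => opL l (emb w)

/-- The linear extension of `emb`. -/
def embₗ : Sh →ₗ[ℚ] CA := Sh.lift emb

theorem embₗ_snoc (l : XY) (a : Sh) : embₗ (Sh.snoc l a) = opL l (embₗ a) := by
  have h : embₗ ∘ₗ Sh.snoc l = (opL l).restrictScalars ℚ ∘ₗ embₗ := Sh.hom_ext fun w => by
    simp [embₗ, emb]
  exact LinearMap.congr_fun h a

theorem embₗ_of (w : List XY) : embₗ (Sh.of w) = emb w := by simp [embₗ]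

/-- The product of two dual generating functions, as an element of `𝒞⟨A⟩`. -/
def dualProd : List XY → List XY → CA
  | [], w' => emb w'
  | l :: w, [] => emb (l :: w)
  | l :: w, l' :: w' => opL l (dualProd w (l' :: w')) + opL l' (dualProd (l :: w) w') +
      opLL l l' (dualProd w w')
termination_by w w' => w.length + w'.length

theorem opL_mem_endsInG (l : XY) {v : CA} (hv : v ∈ hatH0) : opL l v ∈ endsInG 1 := by
  cases l with
  | x => exact opX_mem_endsInG_of_mem_hatH0 hv
  | y => exact opY_mem_endsInG v

theorem opLL_mem_endsInG (l l' : XY) {v : CA} (hv : v ∈ hatH0) : opLL l l' v ∈ endsInG 1 := by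
  cases l <;> cases l'
  · exact Submodule.smul_mem _ _ (opX_mem_endsInG_of_mem_hatH0 hv)
  · exact Submodule.smul_mem _ _ (opY_mem_endsInG v)
  · exact Submodule.smul_mem _ _ (opY_mem_endsInG v)
  · exact opY_mem_endsInG _

theorem emb_mem_hatH0 (w : List XY) : emb w ∈ hatH0 := by
  induction w with
  | nil => exact one_mem_hatH0
  | cons l w ih => exact endsInG_le_hatH0 (opL_mem_endsInG l ih)

theorem embₗ_mem_hatH0 (a : Sh) : embₗ a ∈ hatH0 := by
  induction a using Sh.induction with
  | h0 => simp
  | hadd a b ha hb => rw [map_add]; exact add_mem ha hb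
  | h r w =>
    rw [map_smul, embₗ_of]
    exact (hatH0.restrictScalars ℚ).smul_mem r (emb_mem_hatH0 w)

theorem emb_mem_endsInG {w : List XY} (hw : w ≠ []) : emb w ∈ endsInG 1 := by
  obtain ⟨l, w, rfl⟩ := List.exists_cons_of_ne_nil hw
  exact opL_mem_endsInG l (emb_mem_hatH0 w)

theorem dualProd_mem_hatH0 : ∀ w w' : List XY, dualProd w w' ∈ hatH0
  | [], w' => by rw [dualProd]; exact emb_mem_hatH0 _
  | l :: w, [] => by rw [dualProd]; exact emb_mem_hatH0 _
  | l :: w, l' :: w' => by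
    rw [dualProd]
    exact endsInG_le_hatH0 (add_mem (add_mem (opL_mem_endsInG l (dualProd_mem_hatH0 w (l' :: w')))
      (opL_mem_endsInG l' (dualProd_mem_hatH0 (l :: w) w')))
      (opLL_mem_endsInG l l' (dualProd_mem_hatH0 w w')))
termination_by w w' => w.length + w'.length

theorem dualProd_mem_endsInG (w w' : List XY) (h : w ≠ [] ∨ w' ≠ []) :
    dualProd w w' ∈ endsInG 1 := by
  cases w with
  | nil => rw [dualProd]; exact emb_mem_endsInG (h.resolve_left (fun h => h rfl))
  | cons l w =>
    cases w' with
    | nil => rw [dualProd]; exact emb_mem_endsInG (by simp)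
    | cons l' w' =>
      rw [dualProd]
      exact add_mem (add_mem (opL_mem_endsInG l (dualProd_mem_hatH0 w (l' :: w')))
        (opL_mem_endsInG l' (dualProd_mem_hatH0 (l :: w) w')))
        (opLL_mem_endsInG l l' (dualProd_mem_hatH0 w w'))

theorem opL_mem_hatC (l : XY) {v : CA} (hv : v ∈ hatC) : opL l v ∈ hatC := by
  cases l with
  | x => exact nMod_le_hatC (opX_mem_nMod hv)
  | y => exact opY_mem_hatC hv

theorem opL_mem_nMod (l : XY) {v : CA} (hv : v ∈ nMod) : opL l v ∈ nMod := by
  cases l with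
  | x => exact opX_mem_nMod (nMod_le_hatC hv)
  | y => exact opY_mem_nMod hv

theorem opLL_x_mem_nMod (l : XY) {v : CA} (hv : v ∈ hatH0) : opLL .x l v ∈ nMod := by
  cases l
  · exact X_smul_mem_nMod (opX_mem_hatH0 hv)
  · exact X_smul_mem_nMod (opY_mem_hatH0 v)

theorem opLL_mem_hatC (l l' : XY) {v : CA} (hv : v ∈ hatH0) : opLL l l' v ∈ hatC := by
  cases l
  · exact nMod_le_hatC (opLL_x_mem_nMod l' hv)
  · cases l'
    · exact X_smul_mem_hatC (opY_mem_hatH0 v)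
    · exact opY_opC_mem_hatC v

theorem dualProd_sub_cons (l l' : XY) (w w' : List XY) :
    dualProd (l :: w) (l' :: w') - embₗ (Sh.shuffle (l :: w) (l' :: w')) =
      opL l (dualProd w (l' :: w') - embₗ (Sh.shuffle w (l' :: w'))) +
      opL l' (dualProd (l :: w) w' - embₗ (Sh.shuffle (l :: w) w')) +
      opLL l l' (dualProd w w') := by
  rw [dualProd, Sh.shuffle, map_add, embₗ_snoc, embₗ_snoc, map_sub, map_sub]
  abel

theorem dualProd_sub_mem_hatC : ∀ w w' : List XY,
    dualProd w w' - embₗ (Sh.shuffle w w') ∈ hatC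
  | [], w' => by rw [dualProd, Sh.shuffle, embₗ_of, sub_self]; exact zero_mem _
  | l :: w, [] => by rw [dualProd, Sh.shuffle, embₗ_of, sub_self]; exact zero_mem _
  | l :: w, l' :: w' => by
    rw [dualProd_sub_cons]
    exact add_mem (add_mem (opL_mem_hatC l (dualProd_sub_mem_hatC w (l' :: w')))
      (opL_mem_hatC l' (dualProd_sub_mem_hatC (l :: w) w')))
      (opLL_mem_hatC l l' (dualProd_mem_hatH0 w w'))
termination_by w w' => w.length + w'.length

theorem dualProd_sub_mem_nMod (w w' : List XY) :
    dualProd (.x :: w) w' - embₗ (Sh.shuffle (.x :: w) w') ∈ nMod := by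
  induction w' with
  | nil => rw [dualProd, Sh.shuffle, embₗ_of, sub_self]; exact zero_mem _
  | cons l' w' ih =>
    rw [dualProd_sub_cons]
    exact add_mem (add_mem (opX_mem_nMod (dualProd_sub_mem_hatC w (l' :: w')))
      (opL_mem_nMod l' ih)) (opLL_x_mem_nMod l' (dualProd_mem_hatH0 w w'))

section evaluation

variable {q : ℂ}

/-- The weight of a letter. -/
def weight (q : ℂ) (j : ℕ) : XY → ℂ
  | .x => 1 - q
  | .y => F q j (.g 1)

theorem dualEval_X_smul (j : ℕ) (v : CA) :
    dualEval q j ((X : 𝒞) • v) = (1 - q) * dualEval q j v := by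
  rw [dualEval_smul]; simp

theorem dualEval_opL (hq : ‖q‖ < 1) (l : XY) {v : CA} (hv : l = .y ∨ v ∈ endsInG 1) (j : ℕ) :
    dualEval q j (opL l v) - dualEval q (j + 1) (opL l v) =
      weight q (j + 1) l * dualEval q (j + 1) v := by
  cases l with
  | x => exact dualEval_opX hq (hv.resolve_left (by simp)) j
  | y => exact dualEval_opY hq v j

theorem dualEval_opLL (hq : ‖q‖ < 1) (l l' : XY) {v : CA}
    (hv : (l = .y ∧ l' = .y) ∨ v ∈ endsInG 1) (j : ℕ) :
    dualEval q j (opLL l l' v) - dualEval q (j + 1) (opLL l l' v) =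
      weight q (j + 1) l * weight q (j + 1) l' * dualEval q (j + 1) v := by
  have hY := dualEval_opY hq v j
  cases l <;> cases l'
  · have h := dualEval_opX hq (hv.resolve_left (by simp)) j
    simp only [opLL, LinearMap.smul_apply, dualEval_X_smul, weight]
    linear_combination (1 - q) * h
  · simp only [opLL, LinearMap.smul_apply, dualEval_X_smul, weight]
    linear_combination (1 - q) * hY
  · simp only [opLL, LinearMap.smul_apply, dualEval_X_smul, weight]
    linear_combination (1 - q) * hY
  · have h := dualEval_opY hq (opC v) j
    rw [dualEval_opC hq] at h
    simp only [opLL, LinearMap.comp_apply, weight]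
    linear_combination h

theorem eq_zero_of_eq_succ {h : ℕ → ℂ} (h1 : ∀ j, h j = h (j + 1))
    (h2 : Tendsto h atTop (nhds 0)) (j : ℕ) : h j = 0 := by
  have h3 : ∀ j, h j = h 0 := fun j => by
    induction j with
    | zero => rfl
    | succ j ih => rw [← h1, ih]
  have h4 : h = fun _ => h 0 := funext h3
  rw [h4] at h2
  rw [h3]
  exact tendsto_nhds_unique tendsto_const_nhds h2

theorem starts_of_cons {l : XY} {w : List XY} (h : l :: w = [] ∨ (l :: w).getLast? = some XY.y) :
    (w = [] ∨ w.getLast? = some XY.y) ∧ (l = .y ∨ w ≠ []) := by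
  cases w with
  | nil => simpa using h
  | cons l' w => simpa using h

theorem dualEval_dualProd (hq : ‖q‖ < 1) : ∀ w w' : List XY,
    (w = [] ∨ w.getLast? = some XY.y) → (w' = [] ∨ w'.getLast? = some XY.y) → ∀ j,
    dualEval q j (dualProd w w') = dualEval q j (emb w) * dualEval q j (emb w')
  | [], w', _, _, j => by rw [dualProd, emb, dualEval_one, one_mul]
  | l :: w, [], _, _, j => by rw [dualProd, emb, dualEval_one, mul_one]
  | l :: w, l' :: w', hw, hw', j => by
    obtain ⟨h1, h2⟩ := starts_of_cons hw
    obtain ⟨h1', h2'⟩ := starts_of_cons hw'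
    rw [← sub_eq_zero]
    refine eq_zero_of_eq_succ (h := fun j => dualEval q j (dualProd (l :: w) (l' :: w')) -
      dualEval q j (emb (l :: w)) * dualEval q j (emb (l' :: w'))) (fun j => ?_) ?_ j
    · have e1 := dualEval_opL hq l (Or.inr (dualProd_mem_endsInG w (l' :: w') (Or.inr (by simp)))) j
      have e2 := dualEval_opL hq l' (Or.inr (dualProd_mem_endsInG (l :: w) w' (Or.inl (by simp)))) j
      have e3 := dualEval_opLL hq l l' (v := dualProd w w') (by
        by_cases hne : w ≠ [] ∨ w' ≠ []
        · exact Or.inr (dualProd_mem_endsInG w w' hne)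
        · rw [not_or] at hne
          exact Or.inl ⟨h2.resolve_right hne.1, h2'.resolve_right hne.2⟩) j
      have e4 := dualEval_opL hq l (v := emb w) (h2.imp_right emb_mem_endsInG) j
      have e5 := dualEval_opL hq l' (v := emb w') (h2'.imp_right emb_mem_endsInG) j
      rw [dualEval_dualProd hq w (l' :: w') h1 hw'] at e1
      rw [dualEval_dualProd hq (l :: w) w' hw h1'] at e2
      rw [dualEval_dualProd hq w w' h1 h1'] at e3
      simp only [dualProd, emb, map_add] at e1 e2 e3 e4 e5 ⊢
      linear_combination e1 + e2 + e3 - e4 * dualEval q j ((opL l') (emb w')) -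
        e5 * dualEval q (j + 1) ((opL l) (emb w)) -
        weight q (j + 1) l * dualEval q (j + 1) (emb w) * e5
    · have t1 := tendsto_dualEval hq (dualProd_mem_endsInG (l :: w) (l' :: w') (Or.inl (by simp)))
      have t2 := tendsto_dualEval hq (emb_mem_endsInG (w := l :: w) (by simp))
      have t3 := tendsto_dualEval hq (emb_mem_endsInG (w := l' :: w') (by simp))
      simpa using t1.sub (t2.mul t3)
termination_by w w' => w.length + w'.length

/-- The value of a word in `x` and `y`. -/
def zSh (q : ℂ) : Sh →ₗ[ℚ] ℂ := Zq q ∘ₗ embₗ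

theorem zSh_mem_hatZ (a : Sh) : zSh q a ∈ hatZ q := Zq_mem_hatZ (embₗ_mem_hatH0 a)

theorem zSh_one : zSh q 1 = 1 := by
  rw [zSh, LinearMap.comp_apply, Sh.one_def, embₗ_of, emb, Zq_one]

theorem zSh_mem_calZ {a : Sh} (ha : a ∈ Sh.H0) : zSh q a ∈ calZ q := by
  obtain ⟨a₀, h₀, _, ⟨b, hb, rfl⟩, rfl⟩ := Submodule.mem_sup.mp ha
  obtain ⟨r, rfl⟩ := Submodule.mem_span_singleton.mp h₀
  rw [map_add, map_smul, zSh_one]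
  refine add_mem ((calZ q).smul_mem r (one_mem_calZ q)) ?_
  clear ha h₀
  induction hb using Submodule.span_induction with
  | mem a h =>
    obtain ⟨w, hw, rfl⟩ := h
    rw [Sh.snoc_of, zSh, LinearMap.comp_apply, embₗ_of]
    refine Zq_mem_calZ (Submodule.mem_sup_left (Submodule.mem_sup_right (opX_mem_endsInG ?_)))
    exact emb_mem_endsInG (by rintro rfl; simp at hw)
  | zero => simp
  | add a b _ _ ha hb => rw [map_add, map_add]; exact add_mem ha hb
  | smul r a _ ha => rw [map_smul, map_smul]; exact (calZ q).smul_mem r ha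

theorem zSh_mul_sub_mem_of (hq : ‖q‖ < 1) (v w : List XY) (hv : v.getLast? = some XY.y)
    (hw : w = [] ∨ w.getLast? = some XY.y) :
    zSh q (Sh.of (.x :: v) * Sh.of w) - zSh q (Sh.of (.x :: v)) * zSh q (Sh.of w) ∈ calN q := by
  have hv' : (.x :: v : List XY) = [] ∨ (.x :: v : List XY).getLast? = some XY.y := by
    cases v with
    | nil => simp at hv
    | cons l v => exact Or.inr (by simpa using hv)
  have h1 := dualEval_dualProd hq _ _ hv' hw 0
  rw [← Zq_eq_dualEval hq (emb_mem_hatH0 _), ← Zq_eq_dualEval hq (emb_mem_hatH0 _),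
    ← Zq_eq_dualEval hq (dualProd_mem_hatH0 _ _)] at h1
  have h2 := Zq_mem_calN (q := q) (dualProd_sub_mem_nMod v w)
  rw [map_sub] at h2
  rw [Sh.of_mul_of]
  simp only [zSh, LinearMap.comp_apply, embₗ_of]
  rw [← h1, ← neg_sub]
  exact neg_mem h2

/-- On words ending in `x` the values are compatible with shuffles modulo `𝒩_q`. -/
theorem zSh_mul_sub_mem (hq : ‖q‖ < 1) {a b : Sh} (ha : a ∈ Sh.H0) (hb : b ∈ Sh.H1) :
    zSh q (a * b) - zSh q a * zSh q b ∈ calN q := by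
  obtain ⟨a₀, h₀, _, ⟨c, hc, rfl⟩, rfl⟩ := Submodule.mem_sup.mp ha
  obtain ⟨r, rfl⟩ := Submodule.mem_span_singleton.mp h₀
  have e : zSh q ((r • 1 + Sh.snoc .x c) * b) - zSh q (r • 1 + Sh.snoc .x c) * zSh q b =
      zSh q (Sh.snoc .x c * b) - zSh q (Sh.snoc .x c) * zSh q b := by
    rw [add_mul, smul_mul_assoc, one_mul, map_add, map_add, map_smul, map_smul, zSh_one, add_mul,
      smul_mul_assoc, one_mul]
    ring
  rw [e]
  clear ha h₀ e
  have key : ∀ w : List XY, (w = [] ∨ w.getLast? = some XY.y) →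
      zSh q (Sh.snoc .x c * Sh.of w) - zSh q (Sh.snoc .x c) * zSh q (Sh.of w) ∈ calN q := by
    intro w hw
    induction hc using Submodule.span_induction with
    | mem a h =>
      obtain ⟨v, hv, rfl⟩ := h
      rw [Sh.snoc_of]
      exact zSh_mul_sub_mem_of hq v w hv hw
    | zero => simp
    | add a b _ _ ha hb =>
      have := add_mem ha hb
      simp only [map_add, add_mul] at this ⊢
      convert this using 1
      ring
    | smul r a _ ha =>
      have := (calN q).smul_mem r ha
      simp only [map_smul, smul_mul_assoc, smul_sub] at this ⊢
      exact this
  obtain ⟨b₀, h₀, b, hb', rfl⟩ := Submodule.mem_sup.mp hb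
  obtain ⟨s, rfl⟩ := Submodule.mem_span_singleton.mp h₀
  clear hb h₀
  have h1 := (calN q).smul_mem s (key [] (Or.inl rfl))
  rw [← Sh.one_def] at h1
  have h2 : zSh q (Sh.snoc .x c * b) - zSh q (Sh.snoc .x c) * zSh q b ∈ calN q := by
    induction hb' using Submodule.span_induction with
    | mem a h =>
      obtain ⟨w, hw, rfl⟩ := h
      exact key w (Or.inr hw)
    | zero => simp
    | add a b _ _ ha hb =>
      have := add_mem ha hb
      simp only [map_add, mul_add] at this ⊢
      convert this using 1
      ring
    | smul r a _ ha =>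
      have := (calN q).smul_mem r ha
      simp only [map_smul, mul_smul_comm, smul_sub] at this ⊢
      exact this
  have := add_mem h1 h2
  simp only [map_add, mul_add, map_smul, mul_smul_comm, smul_sub] at this ⊢
  convert this using 1
  ring

end evaluation

/-! ### Sums over indices -/

/-- The positive integer `k + a`. -/
def shift (k : ℕ+) (a : ℕ) : ℕ+ := ⟨(k : ℕ) + a, Nat.add_pos_left k.pos a⟩

/-- The sum of `φ (k + e)` over the tuples `e` of weight `m`. -/
def sumA {V : Type*} [AddCommMonoid V] : (Index → V) → ℕ → Index → V
  | φ, m, [] => if m = 0 then φ [] else 0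
  | φ, m, k :: w => ∑ p ∈ Finset.HasAntidiagonal.antidiagonal m,
      sumA (fun l => φ (shift k p.1 :: l)) p.2 w

/-- The signed sum of `φ` over the indices that arise by inserting `m` entries `1`. -/
def sumM {V : Type*} [AddCommGroup V] : (Index → V) → ℕ → Index → V
  | φ, 0, k => φ k
  | φ, m + 1, [] => - sumM (fun l => φ (1 :: l)) m []
  | φ, m + 1, k :: w => sumM (fun l => φ (k :: l)) (m + 1) w - sumM (fun l => φ (1 :: l)) m (k :: w)
termination_by _ m k => m + k.length

theorem sumA_add {V : Type*} [AddCommMonoid V] (φ ψ : Index → V) (m : ℕ) (k : Index) :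
    sumA (fun l => φ l + ψ l) m k = sumA φ m k + sumA ψ m k := by
  induction k generalizing φ ψ m with
  | nil => simp only [sumA]; split_ifs <;> simp
  | cons k w ih =>
    simp only [sumA]
    rw [← Finset.sum_add_distrib]
    exact Finset.sum_congr rfl fun p _ => ih _ _ _

theorem map_sumA {V W : Type*} [AddCommMonoid V] [AddCommMonoid W] (g : V →+ W) (φ : Index → V)
    (m : ℕ) (k : Index) : g (sumA φ m k) = sumA (fun l => g (φ l)) m k := by
  induction k generalizing φ m with
  | nil => simp only [sumA]; split_ifs <;> simp
  | cons k w ih =>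
    simp only [sumA, map_sum]
    exact Finset.sum_congr rfl fun p _ => ih _ _

theorem sumA_mem {S : Submodule ℚ ℂ} {φ : Index → ℂ} (h : ∀ l, φ l ∈ S) (m : ℕ) (k : Index) :
    sumA φ m k ∈ S := by
  induction k generalizing φ m with
  | nil => simp only [sumA]; split_ifs <;> simp [h]
  | cons k w ih =>
    simp only [sumA]
    exact sum_mem fun p _ => ih (fun l => h _) _

theorem tendsto_sumA {φ : ℕ → Index → ℂ} {ψ : Index → ℂ}
    (h : ∀ l, Tendsto (fun M => φ M l) atTop (nhds (ψ l))) (m : ℕ) (k : Index) :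
    Tendsto (fun M => sumA (φ M) m k) atTop (nhds (sumA ψ m k)) := by
  induction k generalizing φ ψ m with
  | nil =>
    simp only [sumA]
    split_ifs
    · exact h []
    · exact tendsto_const_nhds
  | cons k w ih =>
    simp only [sumA]
    exact tendsto_finsetSum _ fun p _ => ih (fun l => h _) _

theorem sumM_add {V : Type*} [AddCommGroup V] (φ ψ : Index → V) (m : ℕ) (k : Index) :
    sumM (fun l => φ l + ψ l) m k = sumM φ m k + sumM ψ m k := by
  induction m generalizing φ ψ k with
  | zero => simp only [sumM]
  | succ m ih =>
    induction k generalizing φ ψ with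
    | nil => simp only [sumM, ih]; abel
    | cons k w ihk => simp only [sumM, ih, ihk]; abel

theorem map_sumM {V W : Type*} [AddCommGroup V] [AddCommGroup W] (g : V →+ W) (φ : Index → V)
    (m : ℕ) (k : Index) : g (sumM φ m k) = sumM (fun l => g (φ l)) m k := by
  induction m generalizing φ k with
  | zero => simp only [sumM]
  | succ m ih =>
    induction k generalizing φ with
    | nil => simp only [sumM, map_neg, ih]
    | cons k w ihk => simp only [sumM, map_sub, ih, ihk]

theorem tendsto_sumM {φ : ℕ → Index → ℂ} {ψ : Index → ℂ}
    (h : ∀ l, Tendsto (fun M => φ M l) atTop (nhds (ψ l))) (m : ℕ) (k : Index) :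
    Tendsto (fun M => sumM (φ M) m k) atTop (nhds (sumM ψ m k)) := by
  induction m generalizing φ ψ k with
  | zero => simp only [sumM]; exact h k
  | succ m ih =>
    induction k generalizing φ ψ with
    | nil => simp only [sumM]; exact (ih (fun l => h _) _).neg
    | cons k w ihk => simp only [sumM]; exact (ihk (fun l => h _)).sub (ih (fun l => h _) _)

/-- The generating series of `sumA`. -/
def serA (φ : Index → ℂ) (k : Index) : PowerSeries ℂ := PowerSeries.mk fun m => sumA φ m k

/-- The generating series of `sumM`. -/
def serM {V : Type*} [CommRing V] (φ : Index → V) (k : Index) : PowerSeries V :=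
  PowerSeries.mk fun m => sumM φ m k

theorem serM_nil {V : Type*} [CommRing V] (φ : Index → V) :
    serM φ [] = PowerSeries.C (φ []) - PowerSeries.X * serM (fun l => φ (1 :: l)) [] := by
  ext m
  cases m with
  | zero => simp [serM, sumM]
  | succ m => simp [serM, sumM, PowerSeries.coeff_succ_X_mul]

theorem serM_cons {V : Type*} [CommRing V] (φ : Index → V) (k : ℕ+) (w : Index) :
    serM φ (k :: w) = serM (fun l => φ (k :: l)) w -
      PowerSeries.X * serM (fun l => φ (1 :: l)) (k :: w) := by
  ext m
  cases m with
  | zero => simp [serM, sumM]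
  | succ m => simp [serM, sumM, PowerSeries.coeff_succ_X_mul]

theorem serM_add {V : Type*} [CommRing V] (φ ψ : Index → V) (k : Index) :
    serM (fun l => φ l + ψ l) k = serM φ k + serM ψ k := by
  ext m; simp [serM, sumM_add]

theorem serM_mul {V : Type*} [CommRing V] (c : V) (φ : Index → V) (k : Index) :
    serM (fun l => c * φ l) k = PowerSeries.C c * serM φ k := by
  ext m
  simp only [serM, PowerSeries.coeff_mk, PowerSeries.coeff_C_mul]
  exact (map_sumM (AddMonoidHom.mulLeft c) φ m k).symm

/-! ### Quasi-symmetric functions of finite lists -/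

/-- The sum of `∏ fᵢ ^ kᵢ` over the sublists of `fs` of the length of `k`. -/
def qsym : List ℂ → Index → ℂ
  | _, [] => 1
  | [], _ :: _ => 0
  | f :: fs, k :: w => qsym fs (k :: w) + f ^ (k : ℕ) * qsym fs w

theorem qsym_nil (fs : List ℂ) : qsym fs [] = 1 := by cases fs <;> rfl

theorem qsym_append (fs gs : List ℂ) (k : Index) : qsym (fs ++ gs) k =
    ∑ i ∈ Finset.range (k.length + 1), qsym fs (k.take i) * qsym gs (k.drop i) := by
  induction fs generalizing k with
  | nil =>
    rw [List.nil_append, Finset.sum_range_succ', Finset.sum_eq_zero, zero_add]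
    · simp [qsym_nil]
    · intro i hi
      cases k with
      | nil => simp at hi
      | cons k w => simp [qsym]
  | cons f fs ih =>
    cases k with
    | nil => simp [qsym_nil]
    | cons k w =>
      have h := ih (k :: w)
      rw [Finset.sum_range_succ'] at h ⊢
      rw [List.cons_append, qsym, ih w, h]
      simp only [List.length_cons, List.take_succ_cons, List.drop_succ_cons, qsym, add_mul,
        Finset.sum_add_distrib, List.take_zero, List.drop_zero, Finset.mul_sum, qsym_nil]
      simp only [mul_assoc]
      ring

theorem qsym_singleton (f : ℂ) (k : Index) : qsym [f] k =
    match k with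
    | [] => 1
    | [a] => f ^ (a : ℕ)
    | _ => 0 := by
  rcases k with _ | ⟨a, _ | ⟨b, w⟩⟩ <;> simp [qsym]

theorem qsym_concat_concat (fs : List ℂ) (f : ℂ) (k : Index) (a : ℕ+) :
    qsym (fs ++ [f]) (k ++ [a]) = qsym fs (k ++ [a]) + f ^ (a : ℕ) * qsym fs k := by
  rw [qsym_append, List.length_append, List.length_singleton, Finset.sum_range_succ,
    Finset.sum_range_succ, Finset.sum_eq_zero]
  · have h1 : (k ++ [a]).take (k.length + 1) = k ++ [a] := List.take_of_length_le (by simp)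
    have h2 : (k ++ [a]).drop (k.length + 1) = [] := List.drop_eq_nil_of_le (by simp)
    rw [h1, h2, List.take_left, List.drop_left, qsym_nil, qsym_singleton]
    ring
  · intro i hi
    rw [Finset.mem_range] at hi
    obtain ⟨b, c, w, h⟩ : ∃ b c w, (k ++ [a]).drop i = b :: c :: w := by
      have hl : ((k ++ [a]).drop i).length = k.length + 1 - i := by simp
      rcases h : (k ++ [a]).drop i with _ | ⟨b, _ | ⟨c, w⟩⟩
      · rw [h] at hl; simp at hl; omega
      · rw [h] at hl; simp at hl; omega
      · exact ⟨b, c, w, rfl⟩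
    rw [h, qsym_singleton, mul_zero]

theorem qsym_reverse (fs : List ℂ) (k : Index) : qsym fs.reverse k.reverse = qsym fs k := by
  induction fs generalizing k with
  | nil =>
    cases k with
    | nil => rfl
    | cons a w =>
      rw [List.reverse_nil, List.reverse_cons]
      cases h : w.reverse <;> simp [qsym]
  | cons f fs ih =>
    cases k with
    | nil => simp [qsym_nil]
    | cons a w =>
      rw [List.reverse_cons, List.reverse_cons, qsym_concat_concat, ← List.reverse_cons, ih, ih,
        qsym]

theorem qsym_neg (fs : List ℂ) (k : Index) : qsym (fs.map Neg.neg) k =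
    (k.map fun a : ℕ+ => (-1 : ℂ) ^ (a : ℕ)).prod * qsym fs k := by
  induction fs generalizing k with
  | nil => cases k <;> simp [qsym]
  | cons f fs ih =>
    cases k with
    | nil => simp [qsym]
    | cons a w =>
      rw [List.map_cons, qsym, qsym, ih, ih, List.map_cons, List.prod_cons, neg_pow]
      ring

/-- The series `∏ (1 - f t)`. -/
def charSeries (fs : List ℂ) : PowerSeries ℂ :=
  (fs.map fun f => 1 - PowerSeries.C f * PowerSeries.X).prod

theorem charSeries_cons (f : ℂ) (fs : List ℂ) :
    charSeries (f :: fs) = (1 - PowerSeries.C f * PowerSeries.X) * charSeries fs := rfl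

theorem coeff_charSeries (fs : List ℂ) (b : ℕ) : PowerSeries.coeff b (charSeries fs) =
    (-1) ^ b * qsym fs (List.replicate b 1) := by
  induction fs generalizing b with
  | nil =>
    rw [charSeries, List.map_nil, List.prod_nil, PowerSeries.coeff_one]
    cases b <;> simp [qsym, List.replicate_succ]
  | cons f fs ih =>
    rw [charSeries_cons, sub_mul, one_mul, map_sub, mul_assoc, PowerSeries.coeff_C_mul]
    cases b with
    | zero => simp [ih, qsym]
    | succ b =>
      rw [PowerSeries.coeff_succ_X_mul, ih, ih, List.replicate_succ, qsym]
      simp only [PNat.val_ofNat, pow_succ, pow_zero]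
      ring

theorem geom_mul (f : ℂ) :
    (1 - PowerSeries.C f * PowerSeries.X) * PowerSeries.mk (fun n => f ^ n) = 1 := by
  rw [sub_mul, one_mul, mul_assoc]
  ext n
  rw [map_sub, PowerSeries.coeff_C_mul]
  cases n with
  | zero => simp
  | succ n =>
    rw [PowerSeries.coeff_succ_X_mul, PowerSeries.coeff_mk, PowerSeries.coeff_mk,
      PowerSeries.coeff_one, pow_succ]
    simp
    ring

theorem derivative_charSeries (fs : List ℂ) : PowerSeries.derivative ℂ (charSeries fs) =
    - (charSeries fs * PowerSeries.mk fun n => qsym fs [n.succPNat]) := by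
  induction fs with
  | nil =>
    have h : (PowerSeries.mk fun n => qsym [] [n.succPNat]) = 0 := by ext n; simp [qsym]
    rw [h, charSeries]
    simp
  | cons f fs ih =>
    have h : (PowerSeries.mk fun n => qsym (f :: fs) [n.succPNat]) =
        (PowerSeries.mk fun n => qsym fs [n.succPNat]) +
          PowerSeries.C f * PowerSeries.mk (fun n => f ^ n) := by
      ext n
      simp [qsym, qsym_nil, pow_succ']
    rw [charSeries_cons, Derivation.leibniz, ih, h]
    simp only [smul_eq_mul, map_sub, Derivation.leibniz, Derivation.map_one_eq_zero,
      PowerSeries.derivative_X, PowerSeries.derivative_C]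
    linear_combination (PowerSeries.C f * charSeries fs) * geom_mul f

/-- Newton's identities. -/
theorem newton_qsym (fs : List ℂ) (n : ℕ) :
    ((n : ℂ) + 1) * ((-1) ^ (n + 1) * qsym fs (List.replicate (n + 1) 1)) =
      - ∑ p ∈ Finset.HasAntidiagonal.antidiagonal n,
        (-1) ^ p.1 * qsym fs (List.replicate p.1 1) * qsym fs [p.2.succPNat] := by
  have h := congrArg (PowerSeries.coeff n) (derivative_charSeries fs)
  rw [PowerSeries.coeff_derivative, coeff_charSeries, map_neg, PowerSeries.coeff_mul] at h
  simp only [coeff_charSeries, PowerSeries.coeff_mk] at h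
  rw [← h]
  ring

theorem serA_qsym_cons (f : ℂ) (fs : List ℂ) (k : ℕ+) (w : Index) :
    (1 - PowerSeries.C f * PowerSeries.X) * serA (qsym (f :: fs)) (k :: w) =
      (1 - PowerSeries.C f * PowerSeries.X) * serA (qsym fs) (k :: w) +
        PowerSeries.C (f ^ (k : ℕ)) * serA (qsym fs) w := by
  have h : serA (qsym (f :: fs)) (k :: w) = serA (qsym fs) (k :: w) +
      PowerSeries.C (f ^ (k : ℕ)) * (PowerSeries.mk (fun n => f ^ n) * serA (qsym fs) w) := by
    ext m
    rw [map_add, PowerSeries.coeff_C_mul, PowerSeries.coeff_mul]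
    simp only [serA, PowerSeries.coeff_mk, sumA, qsym, sumA_add, Finset.sum_add_distrib,
      Finset.mul_sum]
    congr 1
    refine Finset.sum_congr rfl fun p _ => ?_
    have := map_sumA (AddMonoidHom.mulLeft (f ^ (shift k p.1 : ℕ))) (qsym fs) p.2 w
    simp only [AddMonoidHom.coe_mulLeft] at this
    rw [← this, shift, PNat.mk_coe, pow_add, mul_assoc]
  rw [h]
  linear_combination (PowerSeries.C (f ^ (k : ℕ)) * serA (qsym fs) w) * geom_mul f

theorem serM_qsym_cons (f : ℂ) (fs : List ℂ) (k : ℕ+) (w : Index) :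
    serM (qsym (f :: fs)) (k :: w) =
      (1 - PowerSeries.C f * PowerSeries.X) * serM (qsym fs) (k :: w) +
        PowerSeries.C (f ^ (k : ℕ)) * serM (qsym fs) w := by
  rw [serM_cons]
  simp only [qsym, serM_add, serM_mul]
  rw [serM_cons (qsym fs)]
  simp only [PNat.val_ofNat, pow_one]
  ring

theorem serM_qsym_nil (f : ℂ) (fs : List ℂ) :
    serM (qsym (f :: fs)) [] = (1 - PowerSeries.C f * PowerSeries.X) * serM (qsym fs) [] := by
  rw [serM_nil]
  simp only [qsym, serM_add, serM_mul]
  have h := serM_nil (qsym fs)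
  rw [qsym_nil] at h
  simp only [PNat.val_ofNat, pow_one]
  linear_combination -h

theorem charSeries_mul_serA (fs : List ℂ) (k : Index) :
    charSeries fs * serA (qsym fs) k = serM (qsym fs) k := by
  induction fs generalizing k with
  | nil =>
    rw [charSeries, List.map_nil, List.prod_nil, one_mul]
    have hA0 : ∀ k, serA (fun _ => 0) k = 0 := fun k => by
      ext m
      simpa [serA] using (map_sumA (0 : ℂ →+ ℂ) (fun _ => 0) m k).symm
    have hM0 : ∀ k, serM (fun _ => (0 : ℂ)) k = 0 := fun k => by
      ext m
      simpa [serM] using (map_sumM (0 : ℂ →+ ℂ) (fun _ => 0) m k).symm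
    cases k with
    | nil =>
      rw [serM_nil]
      simp only [qsym, hM0]
      ext m
      simp [serA, sumA, qsym, PowerSeries.coeff_one]
    | cons k w =>
      rw [serM_cons]
      simp only [qsym, hM0]
      ext m
      have h : ∀ m, sumA (fun _ => (0 : ℂ)) m w = 0 := fun m => by
        simpa [serA] using congrArg (PowerSeries.coeff m) (hA0 w)
      simp [serA, sumA, qsym, h]
  | cons f fs ih =>
    cases k with
    | nil =>
      rw [serM_qsym_nil, ← ih, charSeries_cons, mul_assoc]
      congr 2
      ext m
      simp [serA, sumA, qsym_nil]
    | cons k w =>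
      rw [serM_qsym_cons, ← ih, ← ih, charSeries_cons]
      linear_combination charSeries fs * serA_qsym_cons f fs k w

theorem sum_qsym_mul_sumA (fs : List ℂ) (m : ℕ) (k : Index) :
    ∑ p ∈ Finset.HasAntidiagonal.antidiagonal m,
      (-1) ^ p.1 * qsym fs (List.replicate p.1 1) * sumA (qsym fs) p.2 k = sumM (qsym fs) m k := by
  have h := congrArg (PowerSeries.coeff m) (charSeries_mul_serA fs k)
  rw [PowerSeries.coeff_mul] at h
  simpa only [coeff_charSeries, serA, serM, PowerSeries.coeff_mk] using h

/-! ### Symmetric values -/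

section symmetric

variable {q : ℂ}

/-- The numbers `F_q(m; g_1)` for `m = M - 1, …, 1`. -/
def fDesc (q : ℂ) : ℕ → List ℂ
  | 0 => []
  | 1 => []
  | M + 2 => F q (M + 1) (.g 1) :: fDesc q (M + 1)

theorem F_g (q : ℂ) (m : ℕ) (k : ℕ+) : F q m (.g k) = F q m (.g 1) ^ (k : ℕ) := by
  simp only [F, PNat.val_ofNat, one_mul, pow_one]
  rw [div_pow, ← pow_mul, mul_comm]

theorem qsym_fDesc (q : ℂ) (M : ℕ) (k : Index) :
    qsym (fDesc q M) k = truncRev q (k.map Letter.g) M := by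
  induction M generalizing k with
  | zero => cases k <;> simp [fDesc, qsym, truncRev]
  | succ M ih =>
    cases M with
    | zero =>
      have h : Finset.Ioo 0 (0 + 1) = ∅ := rfl
      cases k <;> simp [fDesc, qsym, truncRev, h]
    | succ M =>
      cases k with
      | nil => simp [qsym_nil, truncRev]
      | cons a w =>
        rw [fDesc, qsym, ih, ih, List.map_cons, truncRev, truncRev,
          sum_Ioo_succ _ _ (Nat.succ_pos M), F_g q _ a]
        ring

/-- The numbers `∓ F_q(m; g_1)` with `0 < m < M`. -/
def fSym (q : ℂ) (M : ℕ) : List ℂ := (fDesc q M).reverse.map Neg.neg ++ fDesc q M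

/-- The sign `(-1)^{wt(b)}`. -/
def signI (b : Index) : ℂ := (b.map fun a : ℕ+ => (-1 : ℂ) ^ (a : ℕ)).prod

theorem aeval_sgn (q : ℂ) (b : Index) : aeval (1 - q) (sgn b) = signI b := by
  rw [sgn, map_list_prod, signI, List.map_map]
  congr 2
  ext a
  simp

theorem signI_reverse (b : Index) : signI b.reverse = signI b := by
  rw [signI, List.map_reverse, List.prod_reverse, signI]

theorem wS_gIndex (k : Index) : wS (gIndex k) = splitSum [] k := by
  rw [wS, gIndex, onWords_word, splitSum, List.length_map]
  refine Finset.sum_congr rfl fun i _ => ?_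
  rw [← List.map_take, ← List.map_drop, ← harm_psi]
  simp

theorem wS_mem_hatH0 (k : Index) : wS (gIndex k) ∈ hatH0 := H0_le_hatH0 (wS_gIndex_mem k)

theorem truncEval_term (q : ℂ) (a b : Index) (M : ℕ) : truncEval q M (term a b) =
    signI b * (truncRev q (a.map Letter.g) M * truncRev q (b.map Letter.g) M) := by
  rw [term, truncEval_smul, truncEval_harmRev q, aeval_sgn]

theorem truncEval_wS (q : ℂ) (k : Index) (M : ℕ) :
    truncEval q M (wS (gIndex k.reverse)) = qsym (fSym q M) k := by
  rw [wS_gIndex, splitSum, map_sum, List.length_reverse, fSym, qsym_append,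
    ← Finset.sum_range_reflect]
  refine Finset.sum_congr rfl fun i hi => ?_
  have hi' : i ≤ k.length := Nat.lt_succ_iff.mp (Finset.mem_range.mp hi)
  rw [truncEval_term, List.take_reverse, List.drop_reverse, List.reverse_reverse, List.append_nil,
    qsym_neg, ← signI, show k.length - (k.length + 1 - 1 - i) = i by omega,
    ← qsym_reverse _ (k.take i), List.reverse_reverse, qsym_fDesc, qsym_fDesc, signI_reverse]
  ring

/-- The value `Z_q(w^{𝒮,*}_ħ(g_k))`, where `k` is read from right to left. -/
def zetaR (q : ℂ) (k : Index) : ℂ := Zq q (wS (gIndex k.reverse))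

theorem tendsto_qsym (hq : ‖q‖ < 1) (k : Index) :
    Tendsto (fun M => qsym (fSym q M) k) atTop (nhds (zetaR q k)) := by
  simp only [← truncEval_wS]
  exact tendsto_truncEval hq (wS_mem_hatH0 _)

theorem zetaR_mem_calZ (q : ℂ) (k : Index) : zetaR q k ∈ calZ q := Zq_mem_calZ (wS_gIndex_mem _)

theorem gIndex_mem_hatH0 (k : Index) : gIndex k ∈ hatH0 := by
  rcases List.eq_nil_or_concat k with rfl | ⟨w, a, rfl⟩
  · rw [gIndex, List.map_nil, word_nil]; exact one_mem_hatH0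
  · rw [gIndex, List.concat_eq_append, List.map_append]
    exact endsInG_le_hatH0 (word_mem_endsInG _ a.pos)

theorem gIndex_nil : gIndex [] = 1 := word_nil

theorem Zq_term (hq : ‖q‖ < 1) (a b : Index) : Zq q (term a b) =
    signI b * (Zq q (gIndex a.reverse) * Zq q (gIndex b.reverse)) := by
  rw [← Zq_harm hq (gIndex_mem_hatH0 _) (gIndex_mem_hatH0 _), gIndex, gIndex, harm_word, term,
    Zq_smul, aeval_sgn]
  simp

theorem Zq_wS (hq : ‖q‖ < 1) (k : Index) : Zq q (wS (gIndex k)) =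
    ∑ i ∈ Finset.range (k.length + 1), signI (k.drop i) *
      (Zq q (gIndex (k.take i)) * Zq q (gIndex (k.drop i).reverse)) := by
  rw [wS_gIndex, splitSum, map_sum]
  refine Finset.sum_congr rfl fun i _ => ?_
  rw [Zq_term hq, List.append_nil, List.reverse_reverse]

theorem zetaR_nil (hq : ‖q‖ < 1) : zetaR q [] = 1 := by
  rw [zetaR, List.reverse_nil, Zq_wS hq]
  simp [gIndex_nil, Zq_one, signI]

theorem zetaR_singleton (hq : ‖q‖ < 1) (a : ℕ+) :
    zetaR q [a] = (1 + (-1) ^ (a : ℕ)) * Zq q (gIndex [a]) := by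
  rw [zetaR, List.reverse_singleton, Zq_wS hq]
  simp [Finset.sum_range_succ, gIndex_nil, Zq_one, signI]
  ring

theorem zetaR_replicate (hq : ‖q‖ < 1) (b : ℕ) : zetaR q (List.replicate b 1) =
    ∑ p ∈ Finset.HasAntidiagonal.antidiagonal b, (-1) ^ p.2 *
      (Zq q (gIndex (List.replicate p.1 1)) * Zq q (gIndex (List.replicate p.2 1))) := by
  rw [zetaR, List.reverse_replicate, Zq_wS hq, List.length_replicate,
    Finset.Nat.sum_antidiagonal_eq_sum_range_succ_mk]
  refine Finset.sum_congr rfl fun i hi => ?_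
  have hi' : i ≤ b := Nat.lt_succ_iff.mp (Finset.mem_range.mp hi)
  rw [List.drop_replicate, List.take_replicate, List.reverse_replicate, min_eq_left hi', signI]
  simp

theorem newton_zetaR (hq : ‖q‖ < 1) (n : ℕ) :
    ((n : ℂ) + 1) * ((-1) ^ (n + 1) * zetaR q (List.replicate (n + 1) 1)) =
      - ∑ p ∈ Finset.HasAntidiagonal.antidiagonal n,
        (-1) ^ p.1 * zetaR q (List.replicate p.1 1) * zetaR q [p.2.succPNat] := by
  refine tendsto_nhds_unique
    (((tendsto_qsym hq (List.replicate (n + 1) 1)).const_mul _).const_mul _) ?_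
  simp only [newton_qsym]
  exact (tendsto_finsetSum _ fun p _ =>
    ((tendsto_qsym hq _).const_mul _).mul (tendsto_qsym hq _)).neg

theorem sum_zetaR_mul_sumA (hq : ‖q‖ < 1) (m : ℕ) (k : Index) :
    ∑ p ∈ Finset.HasAntidiagonal.antidiagonal m,
      (-1) ^ p.1 * zetaR q (List.replicate p.1 1) * sumA (zetaR q) p.2 k =
        sumM (zetaR q) m k := by
  have h := tendsto_sumM (tendsto_qsym hq) m k
  simp only [← sum_qsym_mul_sumA] at h
  refine tendsto_nhds_unique (tendsto_finsetSum _ fun p _ => ?_) h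
  exact ((tendsto_qsym hq _).const_mul _).mul (tendsto_sumA (tendsto_qsym hq) _ _)

theorem zetaR_singleton_mul_mem_calP (hq : ‖q‖ < 1) (a : ℕ+) {x : ℂ} (hx : x ∈ calZ q) :
    zetaR q [a] * x ∈ calP q := by
  rw [zetaR_singleton hq]
  rcases Nat.even_or_odd (a : ℕ) with h | h
  · obtain ⟨n, hn⟩ := even_iff_two_dvd.mp h
    have hpos : 0 < n := by have := a.pos; omega
    lift n to ℕ+ using hpos
    have ha : a = 2 * n := PNat.eq (by rw [PNat.mul_coe]; exact hn)
    rw [h.neg_one_pow]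
    have := Submodule.mul_mem_mul hx (Submodule.subset_span (R := ℚ)
      (Set.mem_range_self (f := fun k : ℕ+ => Zq q (gIndex [2 * k])) n))
    have h2 := (calP q).smul_mem (2 : ℚ) this
    rw [ha]
    convert h2 using 1
    rw [Rat.smul_def]
    push_cast
    ring
  · rw [h.neg_one_pow, add_neg_cancel, zero_mul, zero_mul]
    exact zero_mem _

theorem neg_one_pow_mul_mem {S : Submodule ℚ ℂ} {x : ℂ} (hx : x ∈ S) (n : ℕ) :
    (-1) ^ n * x ∈ S := by
  have := S.smul_mem ((-1 : ℚ) ^ n) hx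
  rw [Rat.smul_def] at this
  simpa using this

theorem zetaR_replicate_mul_mem_calP (hq : ‖q‖ < 1) (n : ℕ) {x : ℂ} (hx : x ∈ calZ q) :
    zetaR q (List.replicate (n + 1) 1) * x ∈ calP q := by
  have h : ((n : ℂ) + 1) * ((-1) ^ (n + 1) * (zetaR q (List.replicate (n + 1) 1) * x)) ∈
      calP q := by
    have e : ((n : ℂ) + 1) * ((-1) ^ (n + 1) * (zetaR q (List.replicate (n + 1) 1) * x)) =
        - ∑ p ∈ Finset.HasAntidiagonal.antidiagonal n, (-1) ^ p.1 * (zetaR q [p.2.succPNat] *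
          (zetaR q (List.replicate p.1 1) * x)) := by
      calc _ = (((n : ℂ) + 1) * ((-1) ^ (n + 1) * zetaR q (List.replicate (n + 1) 1))) * x := by
              ring
        _ = _ := by
          rw [newton_zetaR hq, neg_mul, Finset.sum_mul]
          congr 1
          exact Finset.sum_congr rfl fun p _ => by ring
    rw [e]
    exact neg_mem (sum_mem fun p _ => neg_one_pow_mul_mem (zetaR_singleton_mul_mem_calP hq _
      (mul_mem_calZ hq (zetaR_mem_calZ q _) hx)) _)
  have h2 := neg_one_pow_mul_mem ((calP q).smul_mem ((n : ℚ) + 1)⁻¹ h) (n + 1)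
  rw [Rat.smul_def] at h2
  convert h2 using 1
  have h3 : ((n : ℂ) + 1) ≠ 0 := by exact_mod_cast Nat.succ_ne_zero n
  have h4 : ((-1 : ℂ) ^ (n + 1)) * (-1) ^ (n + 1) = 1 := by rw [← mul_pow]; simp
  push_cast
  field_simp
  linear_combination (-(zetaR q (List.replicate (n + 1) 1) * x)) * h4

/-- Raising the entries of an index agrees, up to `𝒫_q`, with inserting entries `1`. -/
theorem sumA_sub_sumM_mem_calP (hq : ‖q‖ < 1) (m : ℕ) (k : Index) :
    sumA (zetaR q) m k - sumM (zetaR q) m k ∈ calP q := by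
  rw [← sum_zetaR_mul_sumA hq, ← neg_sub, neg_mem_iff]
  cases m with
  | zero => simp [zetaR_nil hq]
  | succ m =>
    rw [Finset.Nat.sum_antidiagonal_succ, List.replicate_zero, zetaR_nil hq, pow_zero, mul_one,
      one_mul, add_sub_cancel_left]
    refine sum_mem fun p _ => ?_
    rw [mul_assoc]
    exact neg_one_pow_mul_mem
      (zetaR_replicate_mul_mem_calP hq _ (sumA_mem (zetaR_mem_calZ q) _ _)) _

end symmetric

section deconcatenation

open TensorProduct

variable {q : ℂ}

/-- The span of the tensors of words of length less than `L` that are empty or begin with `y`. -/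
def tens (L : ℕ) : Submodule ℚ (Sh ⊗[ℚ] Sh) :=
  Submodule.span ℚ {t | ∃ v w : List XY, (v = [] ∨ v.getLast? = some XY.y) ∧
    (w = [] ∨ w.getLast? = some XY.y) ∧ v.length < L ∧ w.length < L ∧ t = Sh.of v ⊗ₜ Sh.of w}

/-- The map `a ⊗ b ↦ f a * g b`. -/
def tmap (f : Sh →ₗ[ℚ] ℂ) : Sh ⊗[ℚ] Sh →ₗ[ℚ] ℂ := LinearMap.mul' ℚ ℂ ∘ₗ TensorProduct.map f f

theorem tmap_tmul (f : Sh →ₗ[ℚ] ℂ) (a b : Sh) : tmap f (a ⊗ₜ b) = f a * f b := by simp [tmap]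

theorem sign_of (w : List XY) : Sh.sign (Sh.of w) = (-1 : ℚ) ^ w.length • Sh.of w := by
  simp [Sh.sign]

theorem deltaₗ_mem_tens (L : ℕ) : ∀ s p : List XY, s.getLast? = some XY.y →
    ((p ++ s).length ≤ L) → (p = [] ∨ p.getLast? = some XY.y) → (p = [] → s.head? = some XY.y) →
    Sh.deltaₗ (Sh.of p) (Sh.of s) ∈ tens L
  | [], _, h, _, _, _ => by simp at h
  | l :: s, p, h, hL, hp, hps => by
    have hlen : p.length + (s.length + 1) ≤ L := by simpa using hL
    rw [← Sh.snoc_of, Sh.deltaₗ_snoc, Sh.snoc_of, sign_of, tmul_smul]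
    refine add_mem ((tens L).smul_mem _ ((tens L).smul_mem _ (Submodule.subset_span
      ⟨p, s, hp, (starts_of_cons (Or.inr h)).1, by omega, by omega, rfl⟩))) ?_
    cases s with
    | nil =>
      rw [← Sh.one_def, Sh.deltaₗ_one]
      exact zero_mem _
    | cons l' s =>
      refine deltaₗ_mem_tens L (l' :: s) (l :: p) (by simpa using h) (by simp at hL ⊢; omega)
        (Or.inr ?_) (by simp)
      rcases hp with rfl | hp
      · simpa using hps rfl
      · cases p with
        | nil => simp at hp
        | cons a p => simpa using hp

theorem strip_of_tens (w : List XY) (h : w = [] ∨ w.getLast? = some XY.y) :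
    Sh.strip (Sh.of w) = 0 ∨ ∃ w', (w' = [] ∨ w'.getLast? = some XY.y) ∧ w'.length + 1 = w.length ∧
      Sh.strip (Sh.of w) = Sh.of w' := by
  cases w with
  | nil => left; simp [← Sh.one_def]
  | cons l w =>
    rw [← Sh.snoc_of, Sh.strip_snoc]
    cases l with
    | x => left; simp [Sh.isY]
    | y => right; exact ⟨w, (starts_of_cons h).1, rfl, by simp [Sh.isY]⟩

theorem rTensor_strip_mem {L : ℕ} {t : Sh ⊗[ℚ] Sh} (ht : t ∈ tens L) :
    Sh.strip.rTensor Sh t ∈ tens L := by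
  induction ht using Submodule.span_induction with
  | mem t h =>
    obtain ⟨v, w, hv, hw, hvL, hwL, rfl⟩ := h
    rw [LinearMap.rTensor_tmul]
    rcases strip_of_tens v hv with h | ⟨v', hv', hl, h⟩
    · rw [h, zero_tmul]; exact zero_mem _
    · rw [h]; exact Submodule.subset_span ⟨v', w, hv', hw, by omega, hwL, rfl⟩
  | zero => simp
  | add a b _ _ ha hb => rw [map_add]; exact add_mem ha hb
  | smul r a _ ha => rw [map_smul]; exact (tens L).smul_mem r ha

theorem iterate_strip_of (w : List XY) (h : w = [] ∨ w.getLast? = some XY.y) (n : ℕ) :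
    Sh.strip^[n] (Sh.of w) = 0 ∨ ∃ w', (w' = [] ∨ w'.getLast? = some XY.y) ∧
      w'.length + n = w.length ∧ Sh.strip^[n] (Sh.of w) = Sh.of w' := by
  induction n with
  | zero => exact Or.inr ⟨w, h, rfl, rfl⟩
  | succ n ih =>
    rw [Function.iterate_succ_apply']
    rcases ih with ih | ⟨w', hw', hl, ih⟩
    · left; rw [ih, map_zero]
    · rw [ih]
      rcases strip_of_tens w' hw' with h | ⟨v', hv', hl', h⟩
      · exact Or.inl h
      · exact Or.inr ⟨v', hv', by omega, h⟩

theorem iterate_strip_mem_H1 (w : List XY) (h : w = [] ∨ w.getLast? = some XY.y) (n : ℕ) :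
    Sh.strip^[n] (Sh.of w) ∈ Sh.H1 := by
  rcases iterate_strip_of w h n with h | ⟨w', hw', _, h⟩
  · rw [h]; exact zero_mem _
  · rw [h]; exact Sh.of_mem_H1 hw'

theorem iterate_rTensor (f : Sh →ₗ[ℚ] Sh) (n : ℕ) (a b : Sh) :
    (f.rTensor Sh)^[n] (a ⊗ₜ b) = (f^[n] a) ⊗ₜ b := by
  induction n generalizing a with
  | zero => rfl
  | succ n ih => rw [Function.iterate_succ_apply, LinearMap.rTensor_tmul, ih,
      Function.iterate_succ_apply]

theorem iterate_lTensor (f : Sh →ₗ[ℚ] Sh) (n : ℕ) (a b : Sh) :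
    (f.lTensor Sh)^[n] (a ⊗ₜ b) = a ⊗ₜ (f^[n] b) := by
  induction n generalizing b with
  | zero => rfl
  | succ n ih => rw [Function.iterate_succ_apply, LinearMap.lTensor_tmul, ih,
      Function.iterate_succ_apply]

theorem iterate_map_add' {V : Type*} [AddCommGroup V] [Module ℚ V] (f : V →ₗ[ℚ] V) (n : ℕ)
    (a b : V) : f^[n] (a + b) = f^[n] a + f^[n] b := by
  rw [← Module.End.pow_apply, map_add, Module.End.pow_apply, Module.End.pow_apply]

theorem iterate_map_smul' {V : Type*} [AddCommGroup V] [Module ℚ V] (f : V →ₗ[ℚ] V) (n : ℕ)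
    (r : ℚ) (a : V) : f^[n] (r • a) = r • f^[n] a := by
  rw [← Module.End.pow_apply, map_smul, Module.End.pow_apply]

theorem iterate_map_zero' {V : Type*} [AddCommGroup V] [Module ℚ V] (f : V →ₗ[ℚ] V) (n : ℕ) :
    f^[n] 0 = 0 := by
  rw [← Module.End.pow_apply, map_zero]

theorem iterate_rTensor_strip_mem {L : ℕ} {t : Sh ⊗[ℚ] Sh} (ht : t ∈ tens L) (n : ℕ) :
    (Sh.strip.rTensor Sh)^[n] t ∈ tens L := by
  induction n with
  | zero => exact ht
  | succ n ih => rw [Function.iterate_succ_apply']; exact rTensor_strip_mem ih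

theorem iterate_rTensor_strip_eq_zero {L : ℕ} {t : Sh ⊗[ℚ] Sh} (ht : t ∈ tens L) {n : ℕ}
    (hn : L ≤ n) : (Sh.strip.rTensor Sh)^[n] t = 0 := by
  induction ht using Submodule.span_induction with
  | mem t h =>
    obtain ⟨v, w, hv, hw, hvL, hwL, rfl⟩ := h
    rw [iterate_rTensor]
    rcases iterate_strip_of v hv n with h | ⟨v', hv', hl, h⟩
    · rw [h, zero_tmul]
    · omega
  | zero => exact iterate_map_zero' _ _
  | add a b _ _ ha hb => rw [iterate_map_add', ha, hb, add_zero]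
  | smul r a _ ha => rw [iterate_map_smul', ha, smul_zero]

/-- The regularized value. -/
def rho (q : ℂ) : Sh →ₗ[ℚ] ℂ := zSh q ∘ₗ Sh.reg

theorem rho_mem_calZ {a : Sh} (ha : a ∈ Sh.H1) : rho q a ∈ calZ q :=
  zSh_mem_calZ (Sh.reg_mem_H0 ha)

theorem tmap_rho_mem_calZ (hq : ‖q‖ < 1) {L : ℕ} {t : Sh ⊗[ℚ] Sh} (ht : t ∈ tens L) :
    tmap (rho q) t ∈ calZ q := by
  induction ht using Submodule.span_induction with
  | mem t h =>
    obtain ⟨v, w, hv, hw, -, -, rfl⟩ := h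
    rw [tmap_tmul]
    exact mul_mem_calZ hq (rho_mem_calZ (Sh.of_mem_H1 hv)) (rho_mem_calZ (Sh.of_mem_H1 hw))
  | zero => simp
  | add a b _ _ ha hb => rw [map_add]; exact add_mem ha hb
  | smul r a _ ha => rw [map_smul]; exact (calZ q).smul_mem r ha

theorem tmap_rho_sub_mem_calN (hq : ‖q‖ < 1) {L : ℕ} {t : Sh ⊗[ℚ] Sh} (ht : t ∈ tens L) :
    tmap (rho q) t - rho q (LinearMap.mul' ℚ Sh t) ∈ calN q := by
  induction ht using Submodule.span_induction with
  | mem t h =>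
    obtain ⟨v, w, hv, hw, -, -, rfl⟩ := h
    have h := zSh_mul_sub_mem hq (Sh.reg_mem_H0 (Sh.of_mem_H1 hv))
      (Sh.H0_le_H1 (Sh.reg_mem_H0 (Sh.of_mem_H1 hw)))
    rw [tmap_tmul, LinearMap.mul'_apply, ← neg_sub, neg_mem_iff]
    simpa [rho, Sh.reg_mul] using h
  | zero => simp
  | add a b _ _ ha hb =>
    rw [map_add, map_add, map_add, add_sub_add_comm]; exact add_mem ha hb
  | smul r a _ ha =>
    rw [map_smul, map_smul, map_smul, ← smul_sub]; exact (calN q).smul_mem r ha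

theorem zSh_sub_sum_mem_calN (hq : ‖q‖ < 1) (w : List XY) (hw : w = [] ∨ w.getLast? = some XY.y)
    {L : ℕ} (hL : w.length < L) :
    zSh q (Sh.of w) - ∑ j ∈ Finset.range L, rho q (Sh.strip^[j] (Sh.of w)) * zSh q (Sh.yPow j) ∈
      calN q := by
  have e := congrArg (zSh q) (Sh.eq_sum_reg w L hL)
  rw [map_sum] at e
  rw [e, ← Finset.sum_sub_distrib]
  exact sum_mem fun j _ => zSh_mul_sub_mem hq (Sh.reg_mem_H0 (iterate_strip_mem_H1 w hw j))
    (Sh.yPow_mem_H1 j)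

theorem tmap_zSh_sub_sum_mem_calN (hq : ‖q‖ < 1) {L : ℕ} {t : Sh ⊗[ℚ] Sh} (ht : t ∈ tens L) :
    tmap (zSh q) t - ∑ i ∈ Finset.range L, ∑ j ∈ Finset.range L,
      tmap (rho q) ((Sh.strip.rTensor Sh)^[i] ((Sh.strip.lTensor Sh)^[j] t)) *
        (zSh q (Sh.yPow i) * zSh q (Sh.yPow j)) ∈ calN q := by
  induction ht using Submodule.span_induction with
  | mem t h =>
    obtain ⟨v, w, hv, hw, hvL, hwL, rfl⟩ := h
    have h1 := zSh_sub_sum_mem_calN hq v hv hvL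
    have h2 := zSh_sub_sum_mem_calN hq w hw hwL
    set A := ∑ j ∈ Finset.range L, rho q (Sh.strip^[j] (Sh.of v)) * zSh q (Sh.yPow j) with hA
    set B := ∑ j ∈ Finset.range L, rho q (Sh.strip^[j] (Sh.of w)) * zSh q (Sh.yPow j) with hB
    have hAm : A ∈ hatZ q := sum_mem fun j _ => mul_mem_hatZ hq
      (calZ_le_hatZ q (rho_mem_calZ (iterate_strip_mem_H1 v hv j))) (zSh_mem_hatZ _)
    have e : (∑ i ∈ Finset.range L, ∑ j ∈ Finset.range L,
        tmap (rho q) ((Sh.strip.rTensor Sh)^[i] ((Sh.strip.lTensor Sh)^[j] (Sh.of v ⊗ₜ Sh.of w))) *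
          (zSh q (Sh.yPow i) * zSh q (Sh.yPow j))) = A * B := by
      rw [hA, hB, Finset.sum_mul_sum]
      refine Finset.sum_congr rfl fun i _ => Finset.sum_congr rfl fun j _ => ?_
      rw [iterate_lTensor, iterate_rTensor, tmap_tmul]
      ring
    rw [e, tmap_tmul]
    have := add_mem (mul_mem_calN hq h1 (zSh_mem_hatZ (Sh.of w))) (mul_mem_calN hq h2 hAm)
    convert this using 1
    ring
  | zero => simp
  | add a b _ _ ha hb =>
    simp only [iterate_map_add', map_add, add_mul, Finset.sum_add_distrib]
    rw [add_sub_add_comm]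
    exact add_mem ha hb
  | smul r a _ ha =>
    simp only [iterate_map_smul', map_smul, smul_mul_assoc, ← Finset.smul_sum]
    rw [← smul_sub]
    exact (calN q).smul_mem r ha

theorem gIndex_replicate (n : ℕ) : gIndex (List.replicate n 1) = embₗ (Sh.yPow n) := by
  induction n with
  | zero => rw [Sh.yPow_zero, Sh.one_def, embₗ_of]; exact gIndex_nil
  | succ n ih =>
    rw [Sh.yPow_succ, embₗ_snoc, ← ih, List.replicate_succ', gIndex, gIndex, List.map_append, opL,
      opY_word]
    rfl

theorem zetaR_replicate' (hq : ‖q‖ < 1) (b : ℕ) : zetaR q (List.replicate b 1) =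
    ∑ p ∈ Finset.HasAntidiagonal.antidiagonal b, (-1) ^ p.2 *
      (zSh q (Sh.yPow p.1) * zSh q (Sh.yPow p.2)) := by
  rw [zetaR_replicate hq]
  simp only [gIndex_replicate]
  rfl

theorem lTensor_strip_iterate {t : Sh ⊗[ℚ] Sh}
    (h : Sh.strip.rTensor Sh t + Sh.strip.lTensor Sh t = 0) (j : ℕ) :
    (Sh.strip.lTensor Sh)^[j] t = (-1 : ℚ) ^ j • (Sh.strip.rTensor Sh)^[j] t := by
  have hc : ∀ t : Sh ⊗[ℚ] Sh, Sh.strip.lTensor Sh (Sh.strip.rTensor Sh t) =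
      Sh.strip.rTensor Sh (Sh.strip.lTensor Sh t) := fun t => by
    rw [← LinearMap.comp_apply, LinearMap.lTensor_comp_rTensor, ← LinearMap.comp_apply,
      LinearMap.rTensor_comp_lTensor]
  induction j with
  | zero => simp
  | succ j ih =>
    have h2 : ∀ j, Sh.strip.lTensor Sh ((Sh.strip.rTensor Sh)^[j] t) =
        (Sh.strip.rTensor Sh)^[j] (Sh.strip.lTensor Sh t) := fun j => by
      induction j with
      | zero => rfl
      | succ j ihj => rw [Function.iterate_succ_apply', hc, ihj, Function.iterate_succ_apply']
    rw [Function.iterate_succ_apply', ih, map_smul, h2, eq_neg_of_add_eq_zero_right h,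
      Function.iterate_succ_apply, ← neg_one_smul ℚ (Sh.strip.rTensor Sh t), iterate_map_smul', smul_smul, pow_succ]

theorem tmap_zSh_sub_rho_mem (hq : ‖q‖ < 1) {L : ℕ} {t : Sh ⊗[ℚ] Sh} (ht : t ∈ tens L)
    (h : Sh.strip.rTensor Sh t + Sh.strip.lTensor Sh t = 0) :
    tmap (zSh q) t - rho q (LinearMap.mul' ℚ Sh t) ∈ calN q ⊔ calP q := by
  have h1 := tmap_zSh_sub_sum_mem_calN hq ht
  set f : ℕ → ℂ := fun n => tmap (rho q) ((Sh.strip.rTensor Sh)^[n] t) with hf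
  have hf0 : ∀ n, L ≤ n → f n = 0 := fun n hn => by
    rw [hf]; simp only; rw [iterate_rTensor_strip_eq_zero ht hn, map_zero]
  have e : (∑ i ∈ Finset.range L, ∑ j ∈ Finset.range L,
      tmap (rho q) ((Sh.strip.rTensor Sh)^[i] ((Sh.strip.lTensor Sh)^[j] t)) *
        (zSh q (Sh.yPow i) * zSh q (Sh.yPow j))) =
      ∑ n ∈ Finset.range L, zetaR q (List.replicate n 1) * f n := by
    have e1 : ∀ i j, tmap (rho q) ((Sh.strip.rTensor Sh)^[i] ((Sh.strip.lTensor Sh)^[j] t)) =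
        (-1) ^ j * f (i + j) := fun i j => by
      rw [lTensor_strip_iterate h, iterate_map_smul', ← Function.iterate_add_apply, map_smul,
        Rat.smul_def]
      push_cast
      rfl
    simp only [e1]
    have e2 := Finset.sum_range_diag_flip L fun i j => (-1) ^ j * f (i + j) *
      (zSh q (Sh.yPow i) * zSh q (Sh.yPow j))
    calc _ = ∑ i ∈ Finset.range L, ∑ j ∈ Finset.range (L - i), (-1) ^ j * f (i + j) *
          (zSh q (Sh.yPow i) * zSh q (Sh.yPow j)) := by
          refine Finset.sum_congr rfl fun i _ => (Finset.sum_subset ?_ ?_).symm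
          · intro j
            simp only [Finset.mem_range]
            omega
          · intro j _ hj
            rw [Finset.mem_range] at hj
            rw [hf0 _ (by omega), mul_zero, zero_mul]
      _ = _ := by
          rw [← e2]
          refine Finset.sum_congr rfl fun n _ => ?_
          rw [zetaR_replicate' hq, Finset.Nat.sum_antidiagonal_eq_sum_range_succ_mk,
            Finset.sum_mul]
          refine Finset.sum_congr rfl fun i hi => ?_
          have hi' := Finset.mem_range.mp hi
          rw [show i + (n - i) = n by omega]
          ring
  rw [e] at h1
  have hZ : ∀ n, f n ∈ calZ q := fun n => tmap_rho_mem_calZ hq (iterate_rTensor_strip_mem ht n)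
  have h2 : ∑ n ∈ Finset.range L, zetaR q (List.replicate n 1) * f n - f 0 ∈ calP q := by
    cases L with
    | zero => simp [hf0]
    | succ L =>
      rw [Finset.sum_range_succ', List.replicate_zero, zetaR_nil hq, one_mul, add_sub_cancel_right]
      exact sum_mem fun n _ => zetaR_replicate_mul_mem_calP hq n (hZ _)
  have h3 := tmap_rho_sub_mem_calN hq ht
  have := add_mem (Submodule.mem_sup_left (T := calP q) (add_mem h1 h3))
    (Submodule.mem_sup_right (S := calN q) h2)
  convert this using 1
  simp only [hf, Function.iterate_zero, id]
  ring

/-- The symmetric value of a word `w`, defined by means of the word `w y`. -/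
def zSym (q : ℂ) : Sh →ₗ[ℚ] ℂ := tmap (zSh q) ∘ₗ Sh.deltaₗ 1 ∘ₗ Sh.rev ∘ₗ Sh.snoc .y

theorem zSym_sub_rho_mem (hq : ‖q‖ < 1) {a : Sh} (ha : a ∈ Sh.H1) :
    zSym q a - rho q (Sh.D 1 (Sh.rev (Sh.snoc .y a))) ∈ calN q ⊔ calP q := by
  have key : ∀ w : List XY, (w = [] ∨ w.getLast? = some XY.y) →
      zSym q (Sh.of w) - rho q (Sh.D 1 (Sh.rev (Sh.snoc .y (Sh.of w)))) ∈ calN q ⊔ calP q := by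
    intro w hw
    simp only [zSym, LinearMap.comp_apply, Sh.snoc_of, Sh.rev_of, Sh.D, LinearMap.compr₂_apply]
    refine tmap_zSh_sub_rho_mem hq (L := (.y :: w : List XY).reverse.length) ?_ ?_
    · rw [Sh.one_def]
      refine deltaₗ_mem_tens _ _ [] ?_ ?_ (Or.inl rfl) fun _ => ?_
      · simp
      · simp
      · rw [List.head?_reverse]
        rcases hw with rfl | hw
        · rfl
        · cases w with
          | nil => simp at hw
          | cons l w => simpa using hw
    · rw [Sh.strip_delta, Sh.strip_one, zero_tmul]
  obtain ⟨b₀, h₀, b, hb', rfl⟩ := Submodule.mem_sup.mp ha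
  obtain ⟨s, rfl⟩ := Submodule.mem_span_singleton.mp h₀
  have h1 := (calN q ⊔ calP q).smul_mem s (key [] (Or.inl rfl))
  rw [← Sh.one_def] at h1
  clear ha h₀
  have h2 : zSym q b - rho q (Sh.D 1 (Sh.rev (Sh.snoc .y b))) ∈ calN q ⊔ calP q := by
    induction hb' using Submodule.span_induction with
    | mem a h =>
      obtain ⟨w, hw, rfl⟩ := h
      exact key w (Or.inr hw)
    | zero => simp
    | add a b _ _ ha hb =>
      simp only [map_add, add_sub_add_comm]; exact add_mem ha hb
    | smul r a _ ha =>
      simp only [map_smul, ← smul_sub]; exact Submodule.smul_mem _ r ha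
  simp only [map_add, map_smul, add_sub_add_comm, ← smul_sub]
  exact add_mem h1 h2

theorem snoc_iter_mem_H1 {a : Sh} (ha : a ∈ Sh.H1) (n : ℕ) : (Sh.snoc .y)^[n] a ∈ Sh.H1 := by
  induction n with
  | zero => exact ha
  | succ n ih =>
    rw [Function.iterate_succ_apply']
    exact Sh.startsY_le_H1 (Sh.snoc_y_mem_startsY ih)

/-- Symmetric values of shuffle products with powers of `y`. -/
theorem zSym_mul_yPow_sub_mem (hq : ‖q‖ < 1) {a : Sh} (ha : a ∈ Sh.H1) (n : ℕ) :
    zSym q ((-1 : ℚ) ^ n • (a * Sh.yPow n)) - zSym q ((Sh.snoc .y)^[n] a) ∈ calN q ⊔ calP q := by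
  have h1 := Submodule.smul_mem _ ((-1 : ℚ) ^ n)
    (zSym_sub_rho_mem hq (Sh.mul_mem_H1 ha (Sh.yPow_mem_H1 n)))
  have h2 := zSym_sub_rho_mem hq (snoc_iter_mem_H1 ha n)
  rw [Sh.D_rev_mul_yPow, map_smul, smul_sub, smul_smul, ← mul_pow, neg_one_mul, neg_neg, one_pow,
    one_smul] at h1
  have := sub_mem h1 h2
  rw [map_smul]
  convert this using 1
  ring

end deconcatenation

/-! ### Words attached to indices -/

/-- The word `z_k`, for an index and a word read from right to left. -/
def rz : Index → List XY
  | [] => []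
  | k :: w => List.replicate ((k : ℕ) - 1) XY.x ++ XY.y :: rz w

theorem zWord_concat_y (k : Index) : zWord k ++ [XY.y] = XY.y :: rz k := by
  induction k with
  | nil => rfl
  | cons a w ih =>
    rw [rz, ← ih]
    simp [zWord]

theorem rz_reverse (k : Index) : (rz k).reverse = zWord k.reverse := by
  induction k with
  | nil => rfl
  | cons a w ih =>
    rw [rz, List.reverse_append, List.reverse_cons, ih, List.reverse_cons, List.reverse_replicate]
    simp [zWord]

theorem length_rz (k : Index) : (-1 : ℂ) ^ (rz k).length = signI k := by
  induction k with
  | nil => simp [rz, signI]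
  | cons a w ih =>
    have h : ((a : ℕ) - 1) + ((rz w).length + 1) = (a : ℕ) + (rz w).length := by
      have := a.pos
      omega
    rw [rz, List.length_append, List.length_replicate, List.length_cons, h, pow_add, ih]
    simp [signI]

theorem opX_pow_word (n : ℕ) (v : List Letter) (c : ℕ+) :
    opX^[n] (word (v ++ [Letter.g c])) = word (v ++ [Letter.g (shift c n)]) := by
  induction n with
  | zero => rfl
  | succ n ih => rw [Function.iterate_succ_apply', ih, opX_word]; rfl

theorem emb_rz (k : Index) : emb (rz k) = gIndex k.reverse := by
  induction k with
  | nil => exact gIndex_nil.symm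
  | cons a w ih =>
    have h : ∀ n v, emb (List.replicate n XY.x ++ v) = opX^[n] (emb v) := fun n v => by
      induction n with
      | zero => rfl
      | succ n ih =>
        rw [List.replicate_succ, List.cons_append, emb, ih, Function.iterate_succ_apply']
        rfl
    have hs : shift 1 ((a : ℕ) - 1) = a := PNat.eq (by
      have := a.pos
      change 1 + ((a : ℕ) - 1) = a
      omega)
    rw [rz, h, emb, ih, gIndex, opL, opY_word, opX_pow_word, hs, gIndex, List.reverse_cons,
      List.map_append]
    rfl

theorem zSh_rz (q : ℂ) (k : Index) : zSh q (Sh.of (rz k)) = Zq q (gIndex k.reverse) := by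
  rw [zSh, LinearMap.comp_apply, embₗ_of, emb_rz]

theorem deltaₗ_replicate_x (n : ℕ) (p s : List XY) :
    Sh.deltaₗ (Sh.of p) (Sh.of (List.replicate n XY.x ++ s)) =
      Sh.deltaₗ (Sh.of (List.replicate n XY.x ++ p)) (Sh.of s) := by
  induction n generalizing p with
  | zero => rfl
  | succ n ih =>
    have h : List.replicate n XY.x ++ XY.x :: p = XY.x :: List.replicate n XY.x ++ p := by
      rw [List.append_cons, ← List.replicate_succ', List.replicate_succ]
    rw [List.replicate_succ, List.cons_append, ← Sh.snoc_of, Sh.deltaₗ_snoc, Sh.isY, zero_smul,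
      zero_add, Sh.snoc_of, ih, h]

theorem tmap_deltaₗ {q : ℂ} (hq : ‖q‖ < 1) (k a : Index) :
    tmap (zSh q) (Sh.deltaₗ (Sh.of (rz a)) (Sh.of (zWord k ++ [XY.y]))) = Zq q (splitSum a k) := by
  induction k generalizing a with
  | nil =>
    rw [zWord_concat_y, ← Sh.snoc_of, Sh.deltaₗ_snoc, rz, ← Sh.one_def, Sh.deltaₗ_one, Sh.isY,
      one_smul, add_zero, Sh.sign_one, tmap_tmul, zSh_one, zSh_rz]
    simp [splitSum, Zq_term hq, signI, gIndex_nil, Zq_one]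
  | cons c b ih =>
    rw [zWord_concat_y, ← Sh.snoc_of, Sh.deltaₗ_snoc, Sh.snoc_of, Sh.isY, one_smul, map_add,
      tmap_tmul, sign_of, map_smul, zSh_rz, zSh_rz, splitSum_cons, map_add, ← ih, Zq_term hq,
      add_comm]
    congr 1
    · rw [zWord_concat_y]
      exact congrArg _ (deltaₗ_replicate_x _ _ _)
    · rw [← length_rz, Rat.smul_def]
      push_cast
      ring

/-- The symmetric values in terms of words. -/
theorem zetaR_eq_zSym {q : ℂ} (hq : ‖q‖ < 1) (k : Index) : zetaR q k = zSym q (Sh.of (rz k)) := by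
  have h := tmap_deltaₗ hq k.reverse []
  rw [← wS_gIndex] at h
  rw [zetaR, ← h, zSym, LinearMap.comp_apply, LinearMap.comp_apply, LinearMap.comp_apply,
    Sh.snoc_of, Sh.rev_of, List.reverse_cons, rz_reverse]
  rfl

theorem serM_snoc (l' : XY) (φ : Index → Sh) (k : Index) :
    serM (fun l => Sh.snoc l' (φ l)) k = Sh.snocS l' (serM φ k) := by
  ext m
  simp only [serM, PowerSeries.coeff_mk, Sh.coeff_snocS]
  exact (map_sumM (Sh.snoc l').toAddMonoidHom φ m k).symm

theorem serM_eq_geo (k : Index) :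
    serM (fun l => Sh.of (rz l)) k = Sh.geo (-1) (Sh.insBeforeY (rz k)) := by
  have h1 : (fun l => Sh.of (rz (1 :: l))) = fun l => Sh.snoc .y (Sh.of (rz l)) := by
    ext1 l
    rw [Sh.snoc_of]
    rfl
  induction k with
  | nil =>
    apply Sh.eq_geo
    conv_lhs => rw [serM_nil, h1, serM_snoc]
    rw [rz, ← Sh.one_def, map_one, Sh.insBeforeY, neg_one_smul]
    ring
  | cons a w ih =>
    apply Sh.eq_geo
    have h2 : ∀ (n : ℕ) (φ : Index → List XY),
        serM (fun l => Sh.of (List.replicate n XY.x ++ φ l)) w =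
          (Sh.snocS .x)^[n] (serM (fun l => Sh.of (φ l)) w) := fun n φ => by
      induction n with
      | zero => rfl
      | succ n ihn =>
        rw [Function.iterate_succ_apply', ← ihn, ← serM_snoc]
        simp only [Sh.snoc_of, List.replicate_succ, List.cons_append]
    have h3 : ∀ n v, Sh.insBeforeY (List.replicate n XY.x ++ v) =
        (Sh.snocS .x)^[n] (Sh.insBeforeY v) := fun n v => by
      induction n with
      | zero => rfl
      | succ n ihn =>
        rw [Function.iterate_succ_apply', ← ihn, List.replicate_succ, List.cons_append,
          Sh.insBeforeY]
    conv_lhs => rw [serM_cons, h1, serM_snoc]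
    simp only [rz]
    rw [h2, h3, Sh.insBeforeY, ← ih, ← serM_snoc, ← serM_snoc, neg_one_smul]
    simp only [Sh.snoc_of]
    ring

theorem sumM_zetaR {q : ℂ} (hq : ‖q‖ < 1) (m : ℕ) (k : Index) : sumM (zetaR q) m k =
    zSym q (PowerSeries.coeff m (Sh.geo (-1) (Sh.insBeforeY (rz k)))) := by
  rw [← serM_eq_geo, serM, PowerSeries.coeff_mk]
  have h := map_sumM (zSym q).toAddMonoidHom (fun l => Sh.of (rz l)) m k
  simp only [LinearMap.toAddMonoidHom_coe] at h
  rw [h]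
  congr 1
  ext l
  exact zetaR_eq_zSym hq l

/-! ### Sums over tuples -/

theorem sum_antidiagonalTuple_succ {V : Type*} [AddCommMonoid V] (n m : ℕ)
    (f : (Fin (n + 1) → ℕ) → V) : ∑ e ∈ Finset.Nat.antidiagonalTuple (n + 1) m, f e =
      ∑ p ∈ Finset.HasAntidiagonal.antidiagonal m,
        ∑ e ∈ Finset.Nat.antidiagonalTuple n p.2, f (Fin.cons p.1 e) := by
  rw [Finset.sum_sigma']
  refine Finset.sum_nbij' (fun e => ⟨(e 0, ∑ i, Fin.tail e i), Fin.tail e⟩)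
    (fun x => Fin.cons x.1.1 x.2) ?_ ?_ ?_ ?_ ?_
  · intro e he
    rw [Finset.Nat.mem_antidiagonalTuple, Fin.sum_univ_succ] at he
    simpa [Finset.HasAntidiagonal.mem_antidiagonal, Finset.Nat.mem_antidiagonalTuple, Fin.tail]
      using he
  · rintro ⟨⟨a, b⟩, e⟩ he
    simp only [Finset.mem_sigma, Finset.HasAntidiagonal.mem_antidiagonal,
      Finset.Nat.mem_antidiagonalTuple] at he ⊢
    rw [Fin.sum_univ_succ]
    simpa [he.2] using he.1
  · intro e _
    simp
  · rintro ⟨⟨a, b⟩, e⟩ he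
    simp only [Finset.mem_sigma, Finset.HasAntidiagonal.mem_antidiagonal,
      Finset.Nat.mem_antidiagonalTuple] at he
    simp [he.2]
  · intro e _
    simp

theorem sum_addTuple {V : Type*} [AddCommMonoid V] (φ : Index → V) (m : ℕ) (k : Index) :
    ∑ e ∈ Finset.Nat.antidiagonalTuple k.length m, φ (addTuple k e) = sumA φ m k := by
  induction k generalizing φ m with
  | nil =>
    rw [sumA]
    cases m with
    | zero => simp; rfl
    | succ m => simp
  | cons a w ih =>
    rw [sumA]
    refine (sum_antidiagonalTuple_succ w.length m fun e => φ (addTuple (a :: w) e)).trans ?_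
    refine Finset.sum_congr rfl fun p _ => ?_
    rw [← ih]
    refine Finset.sum_congr rfl fun e _ => ?_
    congr 1
    exact List.ofFn_succ (f := fun i : Fin (w.length + 1) =>
      (⟨((a :: w).get i : ℕ) + (Fin.cons p.1 e : Fin (w.length + 1) → ℕ) i,
        Nat.add_pos_left ((a :: w).get i).pos _⟩ : ℕ+))

theorem sumA_congr {V : Type*} [AddCommMonoid V] {φ ψ : Index → V} (m : ℕ) {k : Index}
    (h : ∀ l : Index, l.length = k.length → φ l = ψ l) : sumA φ m k = sumA ψ m k := by
  induction k generalizing φ ψ m with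
  | nil => simp only [sumA]; rw [h [] rfl]
  | cons a w ih =>
    simp only [sumA]
    exact Finset.sum_congr rfl fun p _ => ih _ fun l hl => h _ (by simp [hl])

theorem sum_antidiagonal_antidiagonal {V : Type*} [AddCommMonoid V] (f : ℕ → ℕ → ℕ → V) (m : ℕ) :
    ∑ p ∈ Finset.HasAntidiagonal.antidiagonal m,
      ∑ r ∈ Finset.HasAntidiagonal.antidiagonal p.2, f p.1 r.1 r.2 =
    ∑ p ∈ Finset.HasAntidiagonal.antidiagonal m,
      ∑ r ∈ Finset.HasAntidiagonal.antidiagonal p.2, f r.1 p.1 r.2 := by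
  rw [Finset.sum_sigma', Finset.sum_sigma']
  refine Finset.sum_nbij' (fun x => ⟨(x.2.1, x.1.1 + x.2.2), (x.1.1, x.2.2)⟩)
    (fun x => ⟨(x.2.1, x.1.1 + x.2.2), (x.1.1, x.2.2)⟩) ?_ ?_ ?_ ?_ (fun _ _ => rfl)
  all_goals
    rintro ⟨⟨a, b⟩, ⟨c, d⟩⟩ h
    simp only [Finset.mem_sigma, Finset.HasAntidiagonal.mem_antidiagonal] at h
    obtain ⟨h1, rfl⟩ := h
  · simp only [Finset.mem_sigma, Finset.HasAntidiagonal.mem_antidiagonal, and_true]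
    omega
  · simp only [Finset.mem_sigma, Finset.HasAntidiagonal.mem_antidiagonal, and_true]
    omega
  · rfl
  · rfl

theorem sumA_concat {V : Type*} [AddCommMonoid V] (φ : Index → V) (m : ℕ) (w : Index) (k : ℕ+) :
    sumA φ m (w ++ [k]) = ∑ p ∈ Finset.HasAntidiagonal.antidiagonal m,
      sumA (fun l => φ (l ++ [shift k p.1])) p.2 w := by
  induction w generalizing φ m with
  | nil => simp only [List.nil_append, sumA]
  | cons a w ih =>
    simp only [List.cons_append, sumA, ih]
    exact sum_antidiagonal_antidiagonal
      (fun i j d => sumA (fun l => φ (shift a i :: (l ++ [shift k j]))) d w) m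

theorem sumA_reverse {V : Type*} [AddCommMonoid V] (φ : Index → V) (m : ℕ) (k : Index) :
    sumA φ m k.reverse = sumA (fun l => φ l.reverse) m k := by
  induction k generalizing φ m with
  | nil => rfl
  | cons a w ih =>
    simp only [List.reverse_cons, sumA_concat, ih, sumA]

/-! ### Dual words -/

/-- The word of the Hoffman dual, read from right to left. -/
def rd : Index → List XY
  | [] => []
  | [a] => List.replicate (a : ℕ) XY.y
  | a :: b :: w => List.replicate ((a : ℕ) - 1) XY.y ++ XY.x :: rd (b :: w)

theorem exists_rz_rd (a : ℕ+) (w : Index) : ∃ u : List XY, rz (a :: w) = u ++ [XY.y] ∧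
    rd (a :: w) = u.map XY.swap ++ [XY.y] := by
  induction w generalizing a with
  | nil =>
    refine ⟨List.replicate ((a : ℕ) - 1) XY.x, rfl, ?_⟩
    have h : (a : ℕ) = ((a : ℕ) - 1) + 1 := by have := a.pos; omega
    rw [rd, h, List.replicate_succ']
    simp [XY.swap]
  | cons b w ih =>
    obtain ⟨u, h1, h2⟩ := ih b
    refine ⟨List.replicate ((a : ℕ) - 1) XY.x ++ XY.y :: u, ?_, ?_⟩
    · rw [rz, h1]; simp
    · rw [rd, h2]; simp [XY.swap]

theorem zWord_hoffmanDual_reverse (l : Index) (hl : l ≠ []) :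
    (zWord (hoffmanDual l)).reverse = rd l.reverse := by
  obtain ⟨a, w, h⟩ := List.exists_cons_of_ne_nil (List.reverse_ne_nil_iff.mpr hl)
  obtain ⟨u, h1, h2⟩ := exists_rz_rd a w
  have h3 : zWord l = XY.y :: u.reverse := by
    rw [← List.reverse_reverse l, ← rz_reverse, h, h1]
    simp
  rw [zWord_hoffmanDual l _ h3, h, h2]
  simp

theorem hoffmanDual_ne_nil {k : Index} (hk : k ≠ []) : hoffmanDual k ≠ [] := by
  intro h
  have h2 := zWord_hoffmanDual_reverse k hk
  rw [h] at h2
  obtain ⟨a, w, h3⟩ := List.exists_cons_of_ne_nil (List.reverse_ne_nil_iff.mpr hk)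
  obtain ⟨u, -, h4⟩ := exists_rz_rd a w
  rw [h3, h4] at h2
  simp [zWord] at h2

theorem rd_hoffmanDual_reverse {k : Index} (hk : k ≠ []) :
    rd (hoffmanDual k).reverse = rz k.reverse := by
  rw [← zWord_hoffmanDual_reverse _ (hoffmanDual_ne_nil hk)]
  obtain ⟨a, w, h⟩ := List.exists_cons_of_ne_nil hk
  obtain ⟨v, hv⟩ : ∃ v, zWord k = XY.y :: v := by rw [h]; exact ⟨_, rfl⟩
  have h2 := zWord_hoffmanDual _ _ (zWord_hoffmanDual k v hv)
  have h3 : XY.swap ∘ XY.swap = id := by ext l; cases l <;> rfl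
  rw [List.map_map, h3, List.map_id, ← hv] at h2
  rw [h2, ← List.reverse_reverse k, ← rz_reverse]
  simp

theorem coeff_snocS_iterate (l : XY) (n j : ℕ) (F : PowerSeries Sh) :
    PowerSeries.coeff j ((Sh.snocS l)^[n] F) = (Sh.snoc l)^[n] (PowerSeries.coeff j F) := by
  induction n with
  | zero => rfl
  | succ n ih => rw [Function.iterate_succ_apply', Sh.coeff_snocS, ih, Function.iterate_succ_apply']

theorem insBeforeX_replicate_append (n : ℕ) (w : List XY) :
    Sh.insBeforeX (List.replicate n XY.y ++ w) = (Sh.snocS .y)^[n] (Sh.insBeforeX w) := by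
  induction n with
  | zero => rfl
  | succ n ih =>
    rw [List.replicate_succ, List.cons_append, Sh.insBeforeX, ih, Function.iterate_succ_apply']

theorem of_replicate_append (n : ℕ) (w : List XY) :
    Sh.of (List.replicate n XY.y ++ w) = (Sh.snoc .y)^[n] (Sh.of w) := by
  induction n with
  | zero => rfl
  | succ n ih =>
    rw [List.replicate_succ, List.cons_append, ← Sh.snoc_of, ih, Function.iterate_succ_apply']

theorem sumA_rd (m : ℕ) (a : ℕ+) (w : Index) : sumA (fun l => Sh.of (rd l)) m (a :: w) =
    PowerSeries.coeff m (Sh.geo 1 (Sh.insBeforeX (rd (a :: w)))) := by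
  induction w generalizing a m with
  | nil =>
    rw [Sh.coeff_geo]
    simp only [sumA, one_pow, one_smul]
    refine Finset.sum_congr rfl fun p _ => ?_
    rw [rd, rd, ← List.append_nil (List.replicate (a : ℕ) XY.y), insBeforeX_replicate_append,
      coeff_snocS_iterate, Sh.insBeforeX, PowerSeries.coeff_one]
    have h : (shift a p.1 : ℕ) = p.1 + a := add_comm _ _
    split_ifs
    · rw [← List.append_nil (List.replicate _ _), of_replicate_append, h,
        Function.iterate_add_apply]
      rfl
    · rw [iterate_map_zero', iterate_map_zero']
  | cons b w ih =>
    rw [Sh.coeff_geo, sumA]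
    refine Finset.sum_congr rfl fun p _ => ?_
    have h : ((shift a p.1 : ℕ+) : ℕ) - 1 = p.1 + ((a : ℕ) - 1) := by
      have := a.pos
      change (a : ℕ) + p.1 - 1 = _
      omega
    have h2 := map_sumA (((Sh.snoc .y ^ (p.1 + ((a : ℕ) - 1)) : Module.End ℚ Sh) ∘ₗ
      Sh.snoc .x).toAddMonoidHom) (fun l => Sh.of (rd l)) p.2 (b :: w)
    simp only [LinearMap.toAddMonoidHom_coe, LinearMap.comp_apply, Module.End.pow_apply] at h2
    rw [rd, insBeforeX_replicate_append, coeff_snocS_iterate, Sh.insBeforeX, Sh.coeff_snocS, ← ih,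
      one_pow, one_smul, ← Function.iterate_add_apply, h2]
    refine sumA_congr _ fun l hl => ?_
    obtain ⟨c, l, rfl⟩ := List.exists_cons_of_length_eq_add_one hl
    rw [rd, of_replicate_append, h, Sh.snoc_of]

/-! ### The Ohno-type relation -/

theorem getLast_rz (k : Index) : rz k = [] ∨ (rz k).getLast? = some XY.y := by
  cases k with
  | nil => exact Or.inl rfl
  | cons a w =>
    obtain ⟨u, h, -⟩ := exists_rz_rd a w
    rw [h]
    simp

theorem sum_dual_eq {q : ℂ} (hq : ‖q‖ < 1) (m : ℕ) {k : Index} (hk : k ≠ []) :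
    ∑ e ∈ Finset.Nat.antidiagonalTuple (hoffmanDual k).length m,
      zetaR q (hoffmanDual (addTuple (hoffmanDual k) e)).reverse =
        zSym q (PowerSeries.coeff m (Sh.geo 1 (Sh.insBeforeX (rz k.reverse)))) := by
  have hd := hoffmanDual_ne_nil hk
  obtain ⟨a, w, hw⟩ := List.exists_cons_of_ne_nil (List.reverse_ne_nil_iff.mpr hd)
  have h := map_sumA (zSym q).toAddMonoidHom (fun l => Sh.of (rd l)) m (hoffmanDual k).reverse
  simp only [LinearMap.toAddMonoidHom_coe] at h
  rw [← rd_hoffmanDual_reverse hk, hw, ← sumA_rd, ← hw, h, sumA_reverse, ← sum_addTuple]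
  refine Finset.sum_congr rfl fun e _ => ?_
  have hne : addTuple (hoffmanDual k) e ≠ [] := by
    rw [← List.length_pos_iff]
    exact (List.length_pos_iff.mpr hd).trans_eq List.length_ofFn.symm
  rw [zetaR_eq_zSym hq, ← zWord_hoffmanDual_reverse _ hne, ← List.reverse_reverse (hoffmanDual _),
    ← rz_reverse]
  simp

theorem sum_sub_sum_mem {q : ℂ} (hq : ‖q‖ < 1) (m : ℕ) {k : Index} (hk : k ≠ []) :
    ∑ e ∈ Finset.Nat.antidiagonalTuple k.length m, zetaR q (addTuple k e).reverse -
      ∑ e ∈ Finset.Nat.antidiagonalTuple (hoffmanDual k).length m,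
        zetaR q (hoffmanDual (addTuple (hoffmanDual k) e)).reverse ∈ calN q ⊔ calP q := by
  rw [sum_dual_eq hq m hk, sum_addTuple (fun l => zetaR q l.reverse), ← sumA_reverse]
  have h1 := Submodule.mem_sup_right (S := calN q) (sumA_sub_sumM_mem_calP hq m k.reverse)
  rw [sumM_zetaR hq, ← Sh.sum_insBeforeX_mul_yPow, ← Finset.Nat.sum_antidiagonal_swap] at h1
  have h2 : ∑ p ∈ Finset.HasAntidiagonal.antidiagonal m,
      (zSym q ((-1 : ℚ) ^ p.1 • (PowerSeries.coeff p.2 (Sh.insBeforeX (rz k.reverse)) *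
        Sh.yPow p.1)) - zSym q ((Sh.snoc .y)^[p.1]
          (PowerSeries.coeff p.2 (Sh.insBeforeX (rz k.reverse))))) ∈ calN q ⊔ calP q :=
    sum_mem fun p _ => zSym_mul_yPow_sub_mem hq
      (Sh.coeff_insBeforeX_mem_H1 _ (getLast_rz _) _) _
  have := add_mem h1 h2
  rw [Finset.sum_sub_distrib] at this
  convert this using 1
  rw [Sh.coeff_geo, map_sum, map_sum]
  simp only [one_pow, one_smul, Prod.fst_swap, Prod.snd_swap]
  ring

theorem sum_zetaS_eq_mk {ι : Type*} (q : ℂ) (s : Finset ι) (f : ι → Index) :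
    ∑ e ∈ s, zetaS q (f e) = Submodule.Quotient.mk
      (∑ e ∈ s, (⟨zetaR q (f e).reverse, zetaR_mem_calZ q _⟩ : calZ q)) := by
  rw [← Submodule.mkQ_apply, map_sum]
  refine Finset.sum_congr rfl fun e _ => ?_
  rw [zetaS, Submodule.mkQ_apply]
  congr 2
  rw [zetaR, List.reverse_reverse]

end

end QSMZV

theorem mainTheorem6 (q : ℂ) (hq0 : 0 < ‖q‖) (hq1 : ‖q‖ < 1)
    (k : QSMZV.Index) (hne : k ≠ []) (hk : QSMZV.Admissible k) (m : ℕ) (hm : 1 ≤ m) :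
    ∑ e ∈ Finset.Nat.antidiagonalTuple k.length m,
        QSMZV.zetaS q (QSMZV.addTuple k e) =
      ∑ e ∈ Finset.Nat.antidiagonalTuple (QSMZV.hoffmanDual k).length m,
        QSMZV.zetaS q (QSMZV.hoffmanDual (QSMZV.addTuple (QSMZV.hoffmanDual k) e)) := by
  rw [QSMZV.sum_zetaS_eq_mk, QSMZV.sum_zetaS_eq_mk, Submodule.Quotient.eq]
  refine Submodule.mem_comap.mpr ?_
  simpa using QSMZV.sum_sub_sum_mem hq1 m hne
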